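/- Let $G=(\mathbb{R}^N,\circ)$ be a Carnot group (stratified homogeneous group), with identity $0$, inverse $x^{-1}=-x$, dilations $D(\lambda)x=(\lambda^{\omega_1}x_1,\dots,\lambda^{\omega_N}x_N)$ that are group automorphisms, $(\omega_1,\dots,\omega_N)=(1,\dots,1,2,\dots,2,\dots,s,\dots,s)$, and homogeneous dimension $Q=\omega_1+\dots+\omega_N$. Let $X_i$ be the left invariant vector field that agrees with $\partial_{x_i}$ at $0$, let $X_1,\dots,X_q$ be those of weight $1$ (that is, with $\omega_i=1$); the stratification means that $[V_1,V_j]=V_{j+1}$ for all $j\ge1$, where $V_j$ is the span of the $X_i$ with $\omega_i=j$. Let $d$ be their control distance: $d(x,y)$ is the infimum of the $\delta>0$ such that there is an absolutely continuous $\varphi:[0,1]\to\mathbb{R}^N$ with $\varphi(0)=x$, $\varphi(1)=y$ and $\varphi'(t)=\sum_{i=1}^q a_i(t)(X_i)_{\varphi(t)}$, $|a_i(t)|\le\delta$, for a.e. $t$. All balls $B(x,r)$ and diameters are taken with respect to $d$. For $0<R_1<R_2$ and $f\in L^1_{loc}(B(\bar x,R_2))$ put $$[f]_{BMO_{loc}(B(\bar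 x,R_1;R_2))}=\sup\frac{1}{|B(x,r)|}\int_{B(x,r)}|f(y)-f_{B(x,r)}|\,dy,$$ $$[f]_{LMO_{loc}(B(\bar x,R_1;R_2))}=\sup\frac{1+\log\frac{\operatorname{diam}B(\bar x,R_2)}{r}}{|B(x,r)|}\int_{B(x,r)}|f(y)-f_{B(x,r)}|\,dy,$$ where both suprema are over all $x\in B(\bar x,R_1)$ and $r>0$ with $B(x,r)\subset B(\bar x,R_2)$, and $f_S=|S|^{-1}\int_S f$; say that $f\in BMO_{loc}(B(\bar x,R_1;R_2))$ (respectively $LMO_{loc}$) if the corresponding quantity is finite. Let $k:\mathbb{R}^N\times\mathbb{R}^N\to\mathbb{R}$ be a kernel (for instance a convolution kernel $k(x,y)=k_0(y^{-1}\circ x)$) such that for some constants $A,B$ - $|k(x,y)|\le A\,d(x,y)^{-Q}$ for all $x\ne y$; - $|k(x,y)-k(x_0,y)|+|k(y,x)-k(y,x_0)|\le B\,\dfrac{d(x_0,x)}{d(x_0,y)^{Q+1}}$ whenever $x_0\neq y$ and $d(x_0,y)\ge 2d(x_0,x)$; - $\displaystyle\int_{r_1<d(x,y)<r_2}k(x,y)\,dy=0=\int_{r_1<d(x,y)<r_2}k(y,x)\,dy$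 for all $x$ and $0<r_1<r_2<\infty$; and let $$Tf(x)=P.V.\int_{\mathbb{R}^N}k(x,y)f(y)\,dy=\lim_{\varepsilon\to0^+}\int_{d(x,y)>\varepsilon}k(x,y)f(y)\,dy.$$ **Theorem.** There is an absolute constant $K>3$ (depending on neither the group, the kernel, the ball nor the function) and, for every $G$, $A$, $B$, a constant $c=c(G,A,B)$ such that for every such kernel $k$, every $\bar x\in\mathbb{R}^N$, every $R>0$ and every $f$ that vanishes a.e. outside $B(\bar x,R)$: 1. if $f\in BMO_{loc}(B(\bar x,R;KR))$, then $Tf(x)$ exists for a.e. $x$, $Tf\in BMO_{loc}(B(\bar x,R;3R))$, and $$[Tf]_{BMO_{loc}(B(\bar x,R;3R))}\le c\,[f]_{BMO_{loc}(B(\bar x,R;KR))};$$ 2. if $f\in LMO_{loc}(B(\bar x,R;KR))$, then $Tf(x)$ exists for a.e. $x$, $Tf\in LMO_{loc}(B(\bar x,R;3R))$, and $$[Tf]_{LMO_{loc}(B(\bar x,R;3R))}\le c\,[f]_{LMO_{loc}(B(\bar x,R;KR))}.$$ In particular $c$ does not depend on $R$ or $f$. -/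

import Mathlib

open MeasureTheory Set Filter Topology
open scoped ContDiff

noncomputable section

/-- The vector field `x ↦ d/dt (x ∘ t e_i)` at `t = 0`: for a Lie group law `op` with identity `0`
this is the left invariant field `X_i` which agrees with `∂_{x_i}` at the origin. -/
def leftInvField {N : ℕ}
    (op : EuclideanSpace ℝ (Fin N) → EuclideanSpace ℝ (Fin N) → EuclideanSpace ℝ (Fin N))
    (i : Fin N) (x : EuclideanSpace ℝ (Fin N)) : EuclideanSpace ℝ (Fin N) :=
  fderiv ℝ (fun y => op x y) 0 (EuclideanSpace.single i 1)

/-- The space `V_j` spanned by the fields `X_i` of weight `j`. -/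
def layerOf {N : ℕ}
    (op : EuclideanSpace ℝ (Fin N) → EuclideanSpace ℝ (Fin N) → EuclideanSpace ℝ (Fin N))
    (weight : Fin N → ℕ) (j : ℕ) :
    Submodule ℝ (EuclideanSpace ℝ (Fin N) → EuclideanSpace ℝ (Fin N)) :=
  Submodule.span ℝ {Z | ∃ i, weight i = j ∧ Z = leftInvField op i}

/-- A Carnot group (stratified homogeneous group) on `ℝ^N`: a Lie group law with the origin as
identity and the Euclidean opposite as inverse, with weights `(1,…,1,2,…,2,…,s,…,s)` whose
dilations are group automorphisms, and such that the Lie algebra of left invariant vector fields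
is stratified.  Writing `X_i` for the left invariant field that equals `∂_{x_i}` at the origin and
`V_j` for the span of the `X_i` of weight `j`, the stratification is `[V_1, V_j] = V_{j+1}` for
all `j ≥ 1` (`V_j` is zero when `j` exceeds the largest weight `s`; in particular every weight
`1,…,s` occurs). -/
structure CarnotGroup (N : ℕ) where
  /-- the group law `x ∘ y` -/
  op : EuclideanSpace ℝ (Fin N) → EuclideanSpace ℝ (Fin N) → EuclideanSpace ℝ (Fin N)
  op_assoc : ∀ x y z, op (op x y) z = op x (op y z)
  zero_op : ∀ x, op 0 x = x
  op_zero : ∀ x, op x 0 = x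
  neg_op : ∀ x, op (-x) x = 0
  op_neg : ∀ x, op x (-x) = 0
  contDiff_op : ContDiff ℝ ∞
    (fun p : EuclideanSpace ℝ (Fin N) × EuclideanSpace ℝ (Fin N) => op p.1 p.2)
  /-- the exponents of the dilations -/
  weight : Fin N → ℕ
  one_le_weight : ∀ i, 1 ≤ weight i
  weight_mono : Monotone weight
  dilation_op : ∀ l : ℝ, 0 < l → ∀ x y : EuclideanSpace ℝ (Fin N),
    (WithLp.toLp 2 fun i => l ^ weight i * op x y i) =
      op (WithLp.toLp 2 fun i => l ^ weight i * x i) (WithLp.toLp 2 fun i => l ^ weight i * y i)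
  stratified : ∀ j : ℕ, 1 ≤ j →
    Submodule.span ℝ {W | ∃ Y ∈ layerOf op weight 1, ∃ Z ∈ layerOf op weight j,
      W = VectorField.lieBracket ℝ Y Z} = layerOf op weight (j + 1)

namespace CarnotGroup

variable {N : ℕ} (G : CarnotGroup N)

/-- The homogeneous dimension `Q`, the sum of the weights. -/
def homDim : ℕ := ∑ i, G.weight i

/-- There is an absolutely continuous curve on `[0,1]` from `x` to `y` with
`φ' = ∑ a_i X_i(φ)` almost everywhere, the sum being over the fields of weight one, and
`|a_i| ≤ δ`. -/
def Joins (δ : ℝ) (x y : EuclideanSpace ℝ (Fin N)) : Prop :=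
  ∃ (φ : ℝ → EuclideanSpace ℝ (Fin N)) (a : ℝ → Fin N → ℝ),
    AbsolutelyContinuousOnInterval φ 0 1 ∧ φ 0 = x ∧ φ 1 = y ∧ (∀ t i, |a t i| ≤ δ) ∧
    ∀ᵐ t ∂(volume.restrict (Ioo (0 : ℝ) 1)),
      HasDerivAt φ (∑ i with G.weight i = 1, a t i • leftInvField G.op i (φ t)) t

/-- The control distance.  The set is never empty, by Chow's connectivity theorem. -/
def dist (x y : EuclideanSpace ℝ (Fin N)) : ℝ :=
  sInf {δ : ℝ | 0 < δ ∧ G.Joins δ x y}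

/-- The balls of the control distance. -/
def ball (x : EuclideanSpace ℝ (Fin N)) (r : ℝ) : Set (EuclideanSpace ℝ (Fin N)) :=
  {y | G.dist x y < r}

/-- The diameter with respect to the control distance. -/
def diam (S : Set (EuclideanSpace ℝ (Fin N))) : ℝ :=
  sSup {t : ℝ | ∃ x ∈ S, ∃ y ∈ S, t = G.dist x y}

/-- The mean oscillation `|S|⁻¹ ∫_S |f - f_S|`, as an extended nonnegative number
(infinite if `f` is measurable but not integrable on a set `S` of positive finite measure). -/
def meanOsc (f : EuclideanSpace ℝ (Fin N) → ℝ) (S : Set (EuclideanSpace ℝ (Fin N))) : ENNReal :=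
  (volume S)⁻¹ * ∫⁻ y in S, ‖f y - ⨍ z in S, f z‖ₑ

/-- The seminorm `[f]_{BMO_loc(Ω₁,Ω₂)}`. -/
def bmoLoc (f : EuclideanSpace ℝ (Fin N) → ℝ) (Ω₁ Ω₂ : Set (EuclideanSpace ℝ (Fin N))) :
    ENNReal :=
  ⨆ (x ∈ Ω₁) (r : ℝ) (_ : 0 < r) (_ : G.ball x r ⊆ Ω₂), meanOsc f (G.ball x r)

/-- The seminorm `[f]_{LMO_loc(Ω₁,Ω₂)}`. -/
def lmoLoc (f : EuclideanSpace ℝ (Fin N) → ℝ) (Ω₁ Ω₂ : Set (EuclideanSpace ℝ (Fin N))) :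
    ENNReal :=
  ⨆ (x ∈ Ω₁) (r : ℝ) (_ : 0 < r) (_ : G.ball x r ⊆ Ω₂),
    ENNReal.ofReal (1 + Real.log (G.diam Ω₂ / r)) * meanOsc f (G.ball x r)

/-- The space `BMO_loc(Ω₁,Ω₂)`. -/
def MemBMOLoc (f : EuclideanSpace ℝ (Fin N) → ℝ) (Ω₁ Ω₂ : Set (EuclideanSpace ℝ (Fin N))) :
    Prop :=
  LocallyIntegrableOn f Ω₂ ∧ G.bmoLoc f Ω₁ Ω₂ < ⊤

/-- The space `LMO_loc(Ω₁,Ω₂)`. -/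
def MemLMOLoc (f : EuclideanSpace ℝ (Fin N) → ℝ) (Ω₁ Ω₂ : Set (EuclideanSpace ℝ (Fin N))) :
    Prop :=
  LocallyIntegrableOn f Ω₂ ∧ G.lmoLoc f Ω₁ Ω₂ < ⊤

/-- The kernel `k` satisfies the standard estimates with constants `A`, `B`, and has vanishing
integrals over all annuli, in each variable. -/
structure IsSingularKernel (k : EuclideanSpace ℝ (Fin N) → EuclideanSpace ℝ (Fin N) → ℝ)
    (A B : ℝ) : Prop where
  size : ∀ x y, x ≠ y → |k x y| ≤ A / G.dist x y ^ G.homDim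
  smooth : ∀ x₀ x y, 2 * G.dist x₀ x ≤ G.dist x₀ y →
    |k x y - k x₀ y| + |k y x - k y x₀| ≤ B * (G.dist x₀ x / G.dist x₀ y ^ (G.homDim + 1))
  cancel : ∀ (x : EuclideanSpace ℝ (Fin N)) (r₁ r₂ : ℝ), 0 < r₁ → r₁ < r₂ →
    (∫ y in {y | r₁ < G.dist x y ∧ G.dist x y < r₂}, k x y) = 0 ∧
    (∫ y in {y | r₁ < G.dist x y ∧ G.dist x y < r₂}, k y x) = 0

/-- The principal value integral of `k(x,y) f(y) dy` exists at `x` and equals `v`. -/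
def HasPV (k : EuclideanSpace ℝ (Fin N) → EuclideanSpace ℝ (Fin N) → ℝ)
    (f : EuclideanSpace ℝ (Fin N) → ℝ) (x : EuclideanSpace ℝ (Fin N)) (v : ℝ) : Prop :=
  (∀ ε : ℝ, 0 < ε → IntegrableOn (fun y => k x y * f y) {y | ε < G.dist x y}) ∧
  Tendsto (fun ε : ℝ => ∫ y in {y | ε < G.dist x y}, k x y * f y) (𝓝[>] 0) (𝓝 v)

/-- The singular integral operator `T f(x) = P.V. ∫ k(x,y) f(y) dy` (an arbitrary value is taken
where the limit does not exist). -/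
def singularIntegral (k : EuclideanSpace ℝ (Fin N) → EuclideanSpace ℝ (Fin N) → ℝ)
    (f : EuclideanSpace ℝ (Fin N) → ℝ) (x : EuclideanSpace ℝ (Fin N)) : ℝ :=
  limUnder (𝓝[>] (0 : ℝ)) (fun ε : ℝ => ∫ y in {y | ε < G.dist x y}, k x y * f y)

end CarnotGroup

end

/-!
# Singular integrals on Carnot groups and local mean oscillation

The theorem holds with `K = 4`, because singular integrals preserve every bound of the form
`M ψ(ρ)` for the mean oscillation over balls of radius `ρ`, as long as `ψ` is increasing and
`ψ(2ρ) ≤ (7/4) ψ(ρ)` (`BallGrowth.exists_osc_bound`).  The choice `ψ = 1` is the statement about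
`BMO`; the choice `ψ(ρ) = 1 / (1 + log⁺(R/ρ))` (`logWeight`) is the statement about `LMO`, the
constant `7/4` being admissible since `log 2 < 3/4`.  A function that vanishes off `B(z, R)` and
whose oscillation is controlled on the balls with centre in `B(z, R)` and radius at most `3R`, all
of them contained in `B(z, 4R)`, has its oscillation controlled on all balls
(`BallGrowth.exists_osc_of_local`): the zero values on `B(z, 2R) \ B(z, R)` control the mean, and
with it the integral of `|f|`.

**Oscillation of the singular integral.**  The analysis takes place on a metric measure space in
which the ball of radius `r` has measure exactly `v r ^ Q` (`BallGrowth`), for kernels with the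
size, smoothness and cancellation properties of the theorem (`StandardKernel`).  The dyadic pieces
of the kernel define almost orthogonal operators on `L²`: cancellation in one factor is played off
against the `L¹` modulus of continuity of the other (`StandardKernel.schur_comp`), and the modulus
survives the sharp truncation since thin shells have small measure.  By the Cotlar–Stein lemma
(`norm_sum_le_of_almost_orthogonal`, `exists_tendsto_sum_of_almost_orthogonal`) the truncated
integrals are uniformly bounded on `L²` and converge to a function `F`.  On a ball `B(x, ε)`, the
function `F` differs in mean from the single number `∫_{d(x,y) > 2ε} k(x,y) f(y) dy` by at most a
multiple of the `L²` oscillation of `f` on `B(x, 2ε)` plus a geometrically weighted sum of its mean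
oscillations over the balls `B(x, 2ʲ ε)` (`StandardKernel.setLIntegral_sub_tail_le`).  This one
estimate is used twice.  At common Lebesgue points of `f`, `f²` and `F` it shows that the principal
value exists and equals `F` (`StandardKernel.ae_tendsto_tail`).  Combined with the bounds `M ψ` it
gives the bound for the oscillation of `F`: the sum over `j` converges because `7/4 < 2`, and the
`L²` oscillation is bounded by the `L¹` oscillation through the John–Nirenberg inequality
(`BallGrowth.lintegral_sq_le`), which is proved by a stopping time argument and the Vitali covering
lemma.

**The Carnot group as such a space.**  Lebesgue measure is left invariant, because the Jacobian of
the left translations at the identity is invariant under the dilations and continuous, hence equal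
to its value one at the identity (`CarnotGroup.det_leftMap`).  The control distance is a metric
inducing the Euclidean topology (`CarnotGroup.topology_eq`) by Chow's theorem, which is proved as
follows: the velocities at the identity of curves of points that can be joined to it with bounded
controls form a linear space, which contains the horizontal vectors and is invariant under the
adjoint action of reachable points; differentiating this action shows that the space is closed
under brackets with horizontal vectors, so by stratification it is everything
(`CarnotGroup.attainable_eq_top`), and the inverse function theorem applies
(`CarnotGroup.exists_eventually_joins`).  Translations and dilations then give
`|B(x, r)| = r ^ Q |B(0, 1)|` (`CarnotGroup.volume_ball`, `CarnotGroup.ballGrowth`).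
-/

set_option linter.unusedSectionVars false

/-! ### Almost orthogonality -/

/-- The iterated sum `∑ i₁ ∈ s, …, ∑ iₙ ∈ s, g [i₁, …, iₙ]` over all words of length `n`. -/
def wordSum {ι M : Type*} [AddCommMonoid M] (s : Finset ι) : ℕ → (List ι → M) → M
  | 0, g => g []
  | n + 1, g => ∑ i ∈ s, wordSum s n fun l => g (i :: l)

lemma wordSum_mono {ι : Type*} (s : Finset ι) (n : ℕ) {g h : List ι → ℝ}
    (H : ∀ l, g l ≤ h l) : wordSum s n g ≤ wordSum s n h := by
  induction n generalizing g h with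
  | zero => exact H []
  | succ n ih => exact Finset.sum_le_sum fun i _ => ih fun l => H (i :: l)

lemma norm_wordSum_le {ι M : Type*} [SeminormedAddCommGroup M] (s : Finset ι) (n : ℕ)
    (g : List ι → M) : ‖wordSum s n g‖ ≤ wordSum s n fun l => ‖g l‖ := by
  induction n generalizing g with
  | zero => exact le_rfl
  | succ n ih => exact (norm_sum_le _ _).trans (Finset.sum_le_sum fun i _ => ih _)

lemma mul_wordSum {ι M : Type*} [Semiring M] (s : Finset ι) (n : ℕ) (c : M) (g : List ι → M) :
    c * wordSum s n g = wordSum s n fun l => c * g l := by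
  induction n generalizing g with
  | zero => rfl
  | succ n ih => simp only [wordSum, Finset.mul_sum, ih]

section CotlarStein

open ContinuousLinearMap

variable {H : Type*} [NormedAddCommGroup H] [InnerProductSpace ℝ H] [CompleteSpace H]
  {ι : Type*}

/-- The operator `A` or its adjoint, as told by a flag. -/
noncomputable def flagOp (b : Bool) (A : H →L[ℝ] H) : H →L[ℝ] H := if b then adjoint A else A

/-- The product over a word of operators that are alternately adjoint and not. -/
noncomputable def altProd (T : ι → H →L[ℝ] H) : Bool → List ι → (H →L[ℝ] H)
  | _, [] => 1
  | b, i :: l => flagOp b (T i) * altProd T (!b) l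

/-- The alternating product of `n` factors `A` and `A†`. -/
noncomputable def altPow (A : H →L[ℝ] H) : Bool → ℕ → (H →L[ℝ] H)
  | _, 0 => 1
  | b, n + 1 => flagOp b A * altPow A (!b) n

lemma flagOp_sum (b : Bool) (T : ι → H →L[ℝ] H) (s : Finset ι) :
    flagOp b (∑ i ∈ s, T i) = ∑ i ∈ s, flagOp b (T i) := by
  cases b <;> simp [flagOp]

lemma altPow_sum (T : ι → H →L[ℝ] H) (s : Finset ι) (b : Bool) (n : ℕ) :
    altPow (∑ i ∈ s, T i) b n = wordSum s n (altProd T b) := by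
  induction n generalizing b with
  | zero => rfl
  | succ n ih =>
    rw [altPow, ih, flagOp_sum, Finset.sum_mul]
    simp only [mul_wordSum]
    rfl

lemma altPow_two_mul (A : H →L[ℝ] H) (m : ℕ) : altPow A true (2 * m) = (adjoint A * A) ^ m := by
  induction m with
  | zero => rfl
  | succ m ih =>
    rw [Nat.mul_succ, pow_succ', ← ih]
    simp [altPow, flagOp, mul_assoc]

/-- The product of the bounds `γ` over neighbouring letters. -/
noncomputable def chainProd (γ : ι → ι → ℝ) : List ι → ℝ
  | [] => 1
  | [_] => 1
  | i :: j :: l => γ i j * chainProd γ (j :: l)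

/-- The bound on an alternating product that groups its letters in pairs from the start. -/
noncomputable def pairProd (γ : ι → ι → ℝ) (Γ : ℝ) : List ι → ℝ
  | [] => 1
  | [_] => Γ
  | i :: j :: l => γ i j ^ 2 * pairProd γ Γ l

/-- A word and its tail are paired off at complementary places, so that together the two pairings
use every neighbouring pair of letters once. -/
lemma pairProd_mul (γ : ι → ι → ℝ) (Γ : ℝ) (i : ι) (l : List ι) :
    pairProd γ Γ (i :: l) * pairProd γ Γ l = Γ * chainProd γ (i :: l) ^ 2 := by
  induction l generalizing i with
  | nil => simp [pairProd, chainProd]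
  | cons j l ih =>
    have := ih j
    simp only [pairProd, chainProd] at this ⊢
    linear_combination γ i j ^ 2 * this

lemma norm_adjoint_mul_comm (A B : H →L[ℝ] H) : ‖adjoint A * B‖ = ‖adjoint B * A‖ := by
  have h : star (star A * B) = star B * A := by rw [star_mul, star_star]
  have h' := congrArg norm h
  exact (LinearIsometryEquiv.norm_map adjoint (adjoint A * B)).symm.trans h'

variable {T : ι → H →L[ℝ] H} {γ : ι → ι → ℝ} {Γ : ℝ}

lemma norm_flagOp (b : Bool) (A : H →L[ℝ] H) : ‖flagOp b A‖ = ‖A‖ := by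
  cases b <;> simp [flagOp]

lemma norm_altProd_le_pairProd (hT : ∀ i, ‖T i‖ ≤ Γ)
    (h1 : ∀ i j, ‖adjoint (T i) * T j‖ ≤ γ i j ^ 2)
    (h2 : ∀ i j, ‖T i * adjoint (T j)‖ ≤ γ i j ^ 2) (b : Bool) (l : List ι) :
    ‖altProd T b l‖ ≤ pairProd γ Γ l := by
  match l with
  | [] => exact ContinuousLinearMap.norm_id_le
  | [i] => simpa [altProd, pairProd, norm_flagOp] using hT i
  | i :: j :: l =>
    have ih := norm_altProd_le_pairProd hT h1 h2 b l
    have : altProd T b (i :: j :: l) = (flagOp b (T i) * flagOp (!b) (T j)) * altProd T b l := by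
      simp [altProd, mul_assoc]
    rw [this, pairProd]
    refine (norm_mul_le _ _).trans (mul_le_mul ?_ ih (norm_nonneg _) (sq_nonneg _))
    cases b
    · exact h2 i j
    · exact h1 i j

lemma norm_altProd_cons_le (hγ : ∀ i j, 0 ≤ γ i j) (hΓ : 0 ≤ Γ) (hT : ∀ i, ‖T i‖ ≤ Γ)
    (h1 : ∀ i j, ‖adjoint (T i) * T j‖ ≤ γ i j ^ 2)
    (h2 : ∀ i j, ‖T i * adjoint (T j)‖ ≤ γ i j ^ 2) (b : Bool) (i : ι) (l : List ι) :
    ‖altProd T b (i :: l)‖ ≤ Γ * chainProd γ (i :: l) := by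
  have hc : ∀ l, 0 ≤ chainProd γ l := by
    intro l
    induction l with
    | nil => simp [chainProd]
    | cons i l ih =>
      cases l with
      | nil => simp [chainProd]
      | cons j l => exact mul_nonneg (hγ i j) ih
  have e1 := norm_altProd_le_pairProd hT h1 h2 b (i :: l)
  have e2 : ‖altProd T b (i :: l)‖ ≤ Γ * pairProd γ Γ l := by
    refine (norm_mul_le _ _).trans (mul_le_mul ?_ (norm_altProd_le_pairProd hT h1 h2 _ l)
      (norm_nonneg _) hΓ)
    rw [norm_flagOp]; exact hT i
  refine abs_le_of_sq_le_sq' ?_ (mul_nonneg hΓ (hc _)) |>.2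
  calc ‖altProd T b (i :: l)‖ ^ 2 ≤ pairProd γ Γ (i :: l) * (Γ * pairProd γ Γ l) := by
        rw [sq]; exact mul_le_mul e1 e2 (norm_nonneg _) ((norm_nonneg _).trans e1)
    _ = (Γ * chainProd γ (i :: l)) ^ 2 := by
        linear_combination Γ * pairProd_mul γ Γ i l

lemma wordSum_chainProd_le (s : Finset ι) (hγ : ∀ i j, 0 ≤ γ i j)
    (hs : ∀ i, ∑ j ∈ s, γ i j ≤ Γ) (n : ℕ) (i : ι) :
    wordSum s n (fun l => chainProd γ (i :: l)) ≤ Γ ^ n := by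
  induction n generalizing i with
  | zero => simp [wordSum, chainProd]
  | succ n ih =>
    have hΓ : 0 ≤ Γ := (Finset.sum_nonneg fun j _ => hγ i j).trans (hs i)
    simp only [wordSum, chainProd, ← mul_wordSum]
    calc ∑ j ∈ s, γ i j * wordSum s n (fun l => chainProd γ (j :: l))
        ≤ ∑ j ∈ s, γ i j * Γ ^ n :=
          Finset.sum_le_sum fun j _ => mul_le_mul_of_nonneg_left (ih j) (hγ i j)
      _ ≤ Γ ^ (n + 1) := by
          rw [← Finset.sum_mul, pow_succ']
          exact mul_le_mul_of_nonneg_right (hs i) (pow_nonneg hΓ n)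

/-- **Cotlar–Stein lemma**.  The power `(S† S) ^ m` of the sum `S` is expanded into alternating
words; a word is bounded by the geometric mean of its two groupings in pairs, and the sum of the
resulting chains of `γ` grows like `Γ ^ (2 m)`, up to the fixed factor `#s`. -/
theorem norm_sum_le_of_almost_orthogonal (s : Finset ι) (hγ : ∀ i j, 0 ≤ γ i j)
    (hs : ∀ i, ∑ j ∈ s, γ i j ≤ Γ) (hΓ : 0 < Γ) (hT : ∀ i, ‖T i‖ ≤ Γ)
    (h1 : ∀ i j, ‖adjoint (T i) * T j‖ ≤ γ i j ^ 2)
    (h2 : ∀ i j, ‖T i * adjoint (T j)‖ ≤ γ i j ^ 2) :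
    ‖∑ i ∈ s, T i‖ ≤ Γ := by
  set S := ∑ i ∈ s, T i with hS
  have key : ∀ k : ℕ, (‖S‖ ^ 2) ^ (2 ^ k) ≤ s.card * (Γ ^ 2) ^ (2 ^ k) := by
    intro k
    have hsa : IsSelfAdjoint (adjoint S * S) := IsSelfAdjoint.star_mul_self S
    have hn : ‖adjoint S * S‖ = ‖S‖ ^ 2 := by
      rw [sq]; exact CStarRing.norm_star_mul_self
    rw [← hn, ← hsa.norm_pow_two_pow, ← altPow_two_mul, altPow_sum]
    obtain ⟨n, hn⟩ : ∃ n, 2 * 2 ^ k = n + 1 := by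
      have := Nat.one_le_two_pow (n := k)
      exact ⟨2 * 2 ^ k - 1, by omega⟩
    rw [← pow_mul, hn]
    refine (norm_wordSum_le _ _ _).trans ?_
    simp only [wordSum]
    calc ∑ i ∈ s, wordSum s n (fun l => ‖altProd T true (i :: l)‖)
        ≤ ∑ i ∈ s, Γ ^ (n + 1) := by
          refine Finset.sum_le_sum fun i _ => ?_
          refine (wordSum_mono s n fun l =>
            norm_altProd_cons_le hγ hΓ.le hT h1 h2 true i l).trans ?_
          rw [← mul_wordSum, pow_succ']
          exact mul_le_mul_of_nonneg_left (wordSum_chainProd_le s hγ hs n i) hΓ.le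
      _ = s.card * Γ ^ (n + 1) := by simp
  -- The factor `#s` disappears when the `2 ^ k`-th root is taken and `k` tends to infinity.
  by_contra! hlt
  have hq : 1 < ‖S‖ ^ 2 / Γ ^ 2 := by
    rw [one_lt_div (by positivity)]
    exact pow_lt_pow_left₀ hlt hΓ.le two_ne_zero
  obtain ⟨n, hn⟩ := pow_unbounded_of_one_lt (s.card : ℝ) hq
  have h3 := key n
  have h4 : (‖S‖ ^ 2 / Γ ^ 2) ^ n ≤ (‖S‖ ^ 2 / Γ ^ 2) ^ (2 ^ n) :=
    pow_le_pow_right₀ hq.le Nat.lt_two_pow_self.le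
  rw [div_pow _ _ (2 ^ n), le_div_iff₀ (by positivity)] at h4
  have h5 : (s.card : ℝ) * (Γ ^ 2) ^ 2 ^ n < (‖S‖ ^ 2 / Γ ^ 2) ^ n * (Γ ^ 2) ^ 2 ^ n :=
    mul_lt_mul_of_pos_right hn (by positivity)
  linarith

/-- Partial sums of an almost orthogonal family converge strongly: the vectors with convergent
partial sums form a closed subspace, which contains the ranges of all adjoints, and on the
orthogonal complement of these ranges every term vanishes. -/
theorem exists_tendsto_sum_of_almost_orthogonal (s : ℕ → Finset ι)
    (hbound : ∀ n, ‖∑ i ∈ s n, T i‖ ≤ Γ)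
    (hsum : ∀ j, Summable fun i => ‖T i * adjoint (T j)‖) (hs : Tendsto s atTop atTop) (f : H) :
    ∃ g, Tendsto (fun n => ∑ i ∈ s n, T i f) atTop (𝓝 g) := by
  suffices h : CauchySeq fun n => ∑ i ∈ s n, T i f from cauchySeq_tendsto_of_complete h
  let U : Submodule ℝ H :=
    { carrier := {f | CauchySeq fun n => ∑ i ∈ s n, T i f}
      add_mem' := by
        intro a b ha hb
        have := CauchySeq.add ha hb
        simpa [Pi.add_def, Finset.sum_add_distrib] using this
      zero_mem' := by simpa using cauchySeq_const (0 : H)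
      smul_mem' := by
        intro c a ha
        have := (uniformContinuous_const_smul c).comp_cauchySeq ha
        simpa [Function.comp_def, Finset.smul_sum] using this }
  have hΓ : 0 ≤ Γ := (norm_nonneg _).trans (hbound 0)
  have happly : ∀ n x, ‖∑ i ∈ s n, T i x‖ ≤ Γ * ‖x‖ := by
    intro n x
    have := (∑ i ∈ s n, T i).le_of_opNorm_le (hbound n) x
    simpa using this
  have hclosed : U.topologicalClosure ≤ U := by
    intro x hx
    have hx' : x ∈ closure (U : Set H) := hx
    change CauchySeq _
    rw [Metric.cauchySeq_iff']
    intro ε hε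
    obtain ⟨y, hy, hxy⟩ := Metric.mem_closure_iff.1 hx' (ε / (4 * (Γ + 1))) (by positivity)
    have hy' : CauchySeq fun n => ∑ i ∈ s n, T i y := hy
    obtain ⟨n0, hn0⟩ := Metric.cauchySeq_iff'.1 hy' (ε / 2) (by positivity)
    refine ⟨n0, fun n hn => ?_⟩
    have h1 := hn0 n hn
    have hd : ∀ m, dist (∑ i ∈ s m, T i x) (∑ i ∈ s m, T i y) < ε / 4 := by
      intro m
      rw [dist_eq_norm, ← Finset.sum_sub_distrib]
      simp_rw [← map_sub]
      refine (happly m (x - y)).trans_lt ?_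
      rw [← dist_eq_norm]
      calc Γ * dist x y ≤ (Γ + 1) * dist x y :=
            mul_le_mul_of_nonneg_right (by linarith) dist_nonneg
        _ < (Γ + 1) * (ε / (4 * (Γ + 1))) := mul_lt_mul_of_pos_left hxy (by positivity)
        _ = ε / 4 := by field_simp
    have h2 := hd n
    have h3 := hd n0
    rw [dist_comm] at h3
    have h4 := dist_triangle4 (∑ i ∈ s n, T i x) (∑ i ∈ s n, T i y) (∑ i ∈ s n0, T i y)
      (∑ i ∈ s n0, T i x)
    linarith
  have hrange : ∀ j x, adjoint (T j) x ∈ U := by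
    intro j x
    change CauchySeq _
    have h1 : Summable fun i => (T i * adjoint (T j)) x := by
      refine Summable.of_norm_bounded ((hsum j).mul_right ‖x‖) fun i => ?_
      exact (T i * adjoint (T j)).le_opNorm x
    have h2 : Tendsto (fun n => ∑ i ∈ s n, (T i * adjoint (T j)) x) atTop
        (𝓝 (∑' i, (T i * adjoint (T j)) x)) :=
      h1.hasSum.comp hs
    exact h2.cauchySeq
  have hU : IsClosed (U : Set H) := by
    have : U.topologicalClosure = U := le_antisymm hclosed U.le_topologicalClosure
    rw [← this]; exact U.isClosed_topologicalClosure
  have : CompleteSpace U := hU.completeSpace_coe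
  obtain ⟨y, hy, z, hz, rfl⟩ := U.exists_add_mem_mem_orthogonal f
  -- The orthogonal component is killed by every `T j`, because it is orthogonal to the range of
  -- the adjoint of `T j`.
  have hz' : ∀ j, T j z = 0 := by
    intro j
    have h1 := (U.mem_orthogonal z).1 hz _ (hrange j (T j z))
    rw [adjoint_inner_left] at h1
    exact inner_self_eq_zero.1 h1
  have hy' : CauchySeq fun n => ∑ i ∈ s n, T i y := hy
  simpa [hz'] using hy'

end CotlarStein

/-! ### Integral operators on `L²` -/

section Schur

open scoped ENNReal NNReal InnerProductSpace

variable {X : Type*} [MeasurableSpace X] {μ : Measure X}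

/-- The Cauchy–Schwarz inequality against the constant function one. -/
lemma lintegral_sq_le {Y : Type*} [MeasurableSpace Y] (ν : Measure Y) {u : Y → ℝ≥0∞}
    (hu : AEMeasurable u ν) : (∫⁻ y, u y ∂ν) ^ 2 ≤ ν univ * ∫⁻ y, u y ^ 2 ∂ν := by
  have h := ENNReal.lintegral_mul_le_Lp_mul_Lq ν Real.HolderConjugate.two_two
    (f := fun _ => 1) aemeasurable_const hu
  simp only [Pi.mul_apply, one_mul, ENNReal.one_rpow, lintegral_const] at h
  calc (∫⁻ y, u y ∂ν) ^ 2
      ≤ (ν univ ^ (1 / 2 : ℝ) * (∫⁻ y, u y ^ (2 : ℝ) ∂ν) ^ (1 / 2 : ℝ)) ^ 2 := by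
        gcongr
    _ = _ := by
        rw [mul_pow, ← ENNReal.rpow_natCast, ← ENNReal.rpow_natCast, ← ENNReal.rpow_mul,
          ← ENNReal.rpow_mul]
        norm_num

lemma eLpNorm_two_sq {f : X → ℝ} : eLpNorm f 2 μ ^ 2 = ∫⁻ x, ‖f x‖ₑ ^ 2 ∂μ := by
  have := eLpNorm_nnreal_pow_eq_lintegral (μ := μ) (f := f) (p := 2) two_ne_zero
  simpa using this

/-- A measurable kernel whose absolute integral is at most `α` over every row and at most `β` over
every column. -/
structure SchurKernel (μ : Measure X) (K : X → X → ℝ) (α β : ℝ≥0) : Prop where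
  meas : Measurable (Function.uncurry K)
  row : ∀ x, ∫⁻ y, ‖K x y‖ₑ ∂μ ≤ α
  col : ∀ y, ∫⁻ x, ‖K x y‖ₑ ∂μ ≤ β

variable {K L : X → X → ℝ} {α β α' β' : ℝ≥0}

lemma SchurKernel.measurable_row (h : SchurKernel μ K α β) (x : X) : Measurable fun y => K x y :=
  h.meas.comp measurable_prodMk_left

lemma SchurKernel.measurable_col (h : SchurKernel μ K α β) (y : X) : Measurable fun x => K x y :=
  h.meas.comp measurable_prodMk_right

lemma SchurKernel.swap (h : SchurKernel μ K α β) : SchurKernel μ (fun x y => K y x) β α :=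
  ⟨h.meas.comp measurable_swap, h.col, h.row⟩

/-- **Schur test**: the inner integral is treated by the Cauchy–Schwarz inequality for the measure
with density `|K x ·|`. -/
lemma SchurKernel.lintegral_sq_le [SFinite μ] (h : SchurKernel μ K α β) {u : X → ℝ≥0∞}
    (hu : Measurable u) :
    ∫⁻ x, (∫⁻ y, ‖K x y‖ₑ * u y ∂μ) ^ 2 ∂μ ≤ α * β * ∫⁻ y, u y ^ 2 ∂μ := by
  have hm : Measurable fun p : X × X => ‖K p.1 p.2‖ₑ := h.meas.enorm
  calc ∫⁻ x, (∫⁻ y, ‖K x y‖ₑ * u y ∂μ) ^ 2 ∂μ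
      ≤ ∫⁻ x, α * ∫⁻ y, ‖K x y‖ₑ * u y ^ 2 ∂μ ∂μ := by
        refine lintegral_mono fun x => ?_
        have hx : Measurable fun y => ‖K x y‖ₑ := hm.comp measurable_prodMk_left
        have := _root_.lintegral_sq_le (μ.withDensity fun y => ‖K x y‖ₑ) hu.aemeasurable
        rw [lintegral_withDensity_eq_lintegral_mul _ hx hu,
          lintegral_withDensity_eq_lintegral_mul _ hx (hu.pow_const 2), withDensity_apply _ .univ,
          Measure.restrict_univ] at this
        exact this.trans (mul_le_mul_left (h.row x) _)
    _ = α * ∫⁻ y, ∫⁻ x, ‖K x y‖ₑ * u y ^ 2 ∂μ ∂μ := by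
        rw [lintegral_const_mul, lintegral_lintegral_swap]
        · exact (hm.mul ((hu.pow_const 2).comp measurable_snd)).aemeasurable
        · exact (hm.mul ((hu.pow_const 2).comp measurable_snd)).lintegral_prod_right'
    _ ≤ α * ∫⁻ y, β * u y ^ 2 ∂μ := by
        gcongr with y
        rw [lintegral_mul_const _ (h.measurable_col y).enorm]
        gcongr
        exact h.col y
    _ = _ := by rw [lintegral_const_mul _ (hu.pow_const 2), mul_assoc]

lemma SchurKernel.lintegral_sq_ne_top [SFinite μ] (h : SchurKernel μ K α β) {u : X → ℝ≥0∞}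
    (hu : Measurable u) (hu2 : ∫⁻ y, u y ^ 2 ∂μ ≠ ⊤) :
    ∫⁻ x, (∫⁻ y, ‖K x y‖ₑ * u y ∂μ) ^ 2 ∂μ ≠ ⊤ :=
  ((h.lintegral_sq_le hu).trans_lt (ENNReal.mul_lt_top (by finiteness) hu2.lt_top)).ne

lemma SchurKernel.measurable_lintegral [SFinite μ] (h : SchurKernel μ K α β) {u : X → ℝ≥0∞}
    (hu : Measurable u) : Measurable fun x => ∫⁻ y, ‖K x y‖ₑ * u y ∂μ :=
  (h.meas.enorm.mul (hu.comp measurable_snd)).lintegral_prod_right'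

lemma SchurKernel.ae_lintegral_lt_top [SFinite μ] (h : SchurKernel μ K α β) {u : X → ℝ≥0∞}
    (hu : Measurable u) (hu2 : ∫⁻ y, u y ^ 2 ∂μ ≠ ⊤) :
    ∀ᵐ x ∂μ, ∫⁻ y, ‖K x y‖ₑ * u y ∂μ < ⊤ := by
  filter_upwards [ae_lt_top ((h.measurable_lintegral hu).pow_const 2) (h.lintegral_sq_ne_top hu hu2)]
    with x hx
  by_contra hc
  rw [not_lt_top_iff] at hc
  simp [hc] at hx

lemma lintegral_enorm_sq_ne_top (f : Lp ℝ 2 μ) : ∫⁻ y, ‖f y‖ₑ ^ 2 ∂μ ≠ ⊤ := by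
  rw [← eLpNorm_two_sq]
  exact ENNReal.pow_ne_top (Lp.eLpNorm_ne_top f)

lemma SchurKernel.ae_integrable [SFinite μ] (h : SchurKernel μ K α β) (f : Lp ℝ 2 μ) :
    ∀ᵐ x ∂μ, Integrable (fun y => K x y * f y) μ := by
  have hf := (Lp.stronglyMeasurable f).measurable
  filter_upwards [h.ae_lintegral_lt_top hf.enorm (lintegral_enorm_sq_ne_top f)] with x hx
  refine ⟨((h.measurable_row x).mul hf).aestronglyMeasurable, ?_⟩
  simpa [HasFiniteIntegral, enorm_mul] using hx

lemma SchurKernel.stronglyMeasurable_integral [SFinite μ] (h : SchurKernel μ K α β) {f : X → ℝ}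
    (hf : Measurable f) : StronglyMeasurable fun x => ∫ y, K x y * f y ∂μ :=
  (h.meas.mul (hf.comp measurable_snd)).stronglyMeasurable.integral_prod_right'

lemma SchurKernel.eLpNorm_integral_le [SFinite μ] (h : SchurKernel μ K α β) (f : Lp ℝ 2 μ) :
    eLpNorm (fun x => ∫ y, K x y * f y ∂μ) 2 μ ≤ ENNReal.ofReal √(α * β) * eLpNorm f 2 μ := by
  have hf := (Lp.stronglyMeasurable f).measurable
  rw [← ENNReal.pow_le_pow_left_iff two_ne_zero, mul_pow, eLpNorm_two_sq, eLpNorm_two_sq,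
    ← ENNReal.ofReal_pow (Real.sqrt_nonneg _), Real.sq_sqrt (by positivity),
    ENNReal.ofReal_mul (by positivity), ENNReal.ofReal_coe_nnreal, ENNReal.ofReal_coe_nnreal]
  refine le_trans (lintegral_mono fun x => ?_) (h.lintegral_sq_le hf.enorm)
  gcongr
  refine (enorm_integral_le_lintegral_enorm _).trans_eq ?_
  simp [enorm_mul]

lemma SchurKernel.memLp_integral [SFinite μ] (h : SchurKernel μ K α β) (f : Lp ℝ 2 μ) :
    MemLp (fun x => ∫ y, K x y * f y ∂μ) 2 μ :=
  ⟨(h.stronglyMeasurable_integral (Lp.stronglyMeasurable f).measurable).aestronglyMeasurable,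
    (h.eLpNorm_integral_le f).trans_lt
      (ENNReal.mul_lt_top ENNReal.ofReal_lt_top (Lp.eLpNorm_lt_top f))⟩

/-- The bounded operator on `L²` with a given Schur kernel. -/
noncomputable def SchurKernel.op [SFinite μ] (h : SchurKernel μ K α β) :
    Lp ℝ 2 μ →L[ℝ] Lp ℝ 2 μ :=
  LinearMap.mkContinuous
    { toFun := fun f => (h.memLp_integral f).toLp _
      map_add' := by
        intro f g
        rw [← MemLp.toLp_add, MemLp.toLp_eq_toLp_iff]
        filter_upwards [h.ae_integrable f, h.ae_integrable g] with x hf hg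
        rw [Pi.add_apply, ← integral_add hf hg]
        refine integral_congr_ae ?_
        filter_upwards [Lp.coeFn_add f g] with y hy
        rw [hy, Pi.add_apply, mul_add]
      map_smul' := by
        intro c f
        rw [RingHom.id_apply, ← MemLp.toLp_const_smul, MemLp.toLp_eq_toLp_iff]
        refine Eventually.of_forall fun x => ?_
        rw [Pi.smul_apply, smul_eq_mul, ← integral_const_mul]
        refine integral_congr_ae ?_
        filter_upwards [Lp.coeFn_smul c f] with y hy
        rw [hy, Pi.smul_apply, smul_eq_mul]
        ring }
    √(α * β) (by
      intro f
      simp only [LinearMap.coe_mk, AddHom.coe_mk, Lp.norm_def]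
      rw [← ENNReal.toReal_ofReal (Real.sqrt_nonneg (α * β)), ← ENNReal.toReal_mul]
      exact ENNReal.toReal_mono (ENNReal.mul_ne_top ENNReal.ofReal_ne_top (Lp.eLpNorm_ne_top f))
        ((eLpNorm_congr_ae (MemLp.coeFn_toLp _)).trans_le (h.eLpNorm_integral_le f)))

lemma SchurKernel.coeFn_op [SFinite μ] (h : SchurKernel μ K α β) (f : Lp ℝ 2 μ) :
    h.op f =ᵐ[μ] fun x => ∫ y, K x y * f y ∂μ :=
  MemLp.coeFn_toLp (h.memLp_integral f)

lemma SchurKernel.norm_op_le [SFinite μ] (h : SchurKernel μ K α β) : ‖h.op‖ ≤ √(α * β) :=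
  LinearMap.mkContinuous_norm_le _ (Real.sqrt_nonneg _) _

lemma SchurKernel.adjoint_op [SFinite μ] (h : SchurKernel μ K α β) :
    ContinuousLinearMap.adjoint h.op = h.swap.op := by
  symm
  rw [ContinuousLinearMap.eq_adjoint_iff]
  intro f g
  have hf := (Lp.stronglyMeasurable f).measurable
  have hg := (Lp.stronglyMeasurable g).measurable
  rw [L2.inner_def, L2.inner_def]
  have hm : Measurable fun p : X × X => g p.1 * (K p.2 p.1 * f p.2) :=
    (hg.comp measurable_fst).mul
      ((h.meas.comp measurable_swap).mul (hf.comp measurable_snd))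
  have e1 : ∫ x, ⟪h.swap.op f x, g x⟫_ℝ ∂μ = ∫ x, ∫ y, g x * (K y x * f y) ∂μ ∂μ := by
    refine integral_congr_ae ?_
    filter_upwards [h.swap.coeFn_op f] with x hx
    rw [hx, integral_const_mul]
    simp
  have e2 : ∫ x, ⟪f x, h.op g x⟫_ℝ ∂μ = ∫ y, ∫ x, g x * (K y x * f y) ∂μ ∂μ := by
    refine integral_congr_ae ?_
    filter_upwards [h.coeFn_op g] with y hy
    rw [hy]
    simp only [RCLike.inner_apply, conj_trivial, ← integral_mul_const]
    congr 1; ext x; ring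
  rw [e1, e2]
  refine integral_integral_swap ⟨hm.aestronglyMeasurable, ?_⟩
  have hfin := h.swap.lintegral_sq_ne_top hf.enorm (lintegral_enorm_sq_ne_top f)
  refine lt_of_eq_of_lt (lintegral_prod _ hm.enorm.aemeasurable) ?_
  calc ∫⁻ x, ∫⁻ y, ‖g x * (K y x * f y)‖ₑ ∂μ ∂μ
      = ∫⁻ x, ‖g x‖ₑ * ∫⁻ y, ‖K y x‖ₑ * ‖f y‖ₑ ∂μ ∂μ := by
        refine lintegral_congr fun x => ?_
        simp_rw [enorm_mul]
        rw [lintegral_const_mul]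
        exact (h.swap.measurable_row x).enorm.mul hf.enorm
    _ ≤ (∫⁻ x, ‖g x‖ₑ ^ (2 : ℝ) ∂μ) ^ (1 / 2 : ℝ) *
        (∫⁻ x, (∫⁻ y, ‖K y x‖ₑ * ‖f y‖ₑ ∂μ) ^ (2 : ℝ) ∂μ) ^ (1 / 2 : ℝ) :=
        ENNReal.lintegral_mul_le_Lp_mul_Lq μ Real.HolderConjugate.two_two hg.enorm.aemeasurable
          (h.swap.measurable_lintegral hf.enorm).aemeasurable
    _ < ⊤ := by
        have := lintegral_enorm_sq_ne_top g
        refine ENNReal.mul_lt_top (ENNReal.rpow_lt_top_of_nonneg (by norm_num) ?_)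
          (ENNReal.rpow_lt_top_of_nonneg (by norm_num) ?_)
        · simpa using this
        · simpa using hfin

/-- The kernel of the composition of two integral operators. -/
noncomputable def kernelComp (μ : Measure X) (K L : X → X → ℝ) (x z : X) : ℝ :=
  ∫ y, K x y * L y z ∂μ

lemma SchurKernel.op_mul_op [SFinite μ] (hK : SchurKernel μ K α β) (hL : SchurKernel μ L α' β')
    {α₀ β₀ : ℝ≥0} (hM : SchurKernel μ (kernelComp μ K L) α₀ β₀) :
    hK.op * hL.op = hM.op := by
  ext1 f
  have hf := (Lp.stronglyMeasurable f).measurable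
  refine Lp.ext ?_
  have hu := hL.measurable_lintegral hf.enorm
  have hfin := hL.lintegral_sq_ne_top hf.enorm (lintegral_enorm_sq_ne_top f)
  filter_upwards [hK.coeFn_op (hL.op f), hM.coeFn_op f, hK.ae_lintegral_lt_top hu hfin]
    with x h1 h2 h3
  rw [mul_apply_eq_comp, h1, h2]
  have hm : Measurable fun p : X × X => K x p.1 * (L p.1 p.2 * f p.2) :=
    ((hK.measurable_row x).comp measurable_fst).mul
      (hL.meas.mul (hf.comp measurable_snd))
  calc ∫ y, K x y * hL.op f y ∂μ = ∫ y, ∫ z, K x y * (L y z * f z) ∂μ ∂μ := by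
        refine integral_congr_ae ?_
        filter_upwards [hL.coeFn_op f] with y hy
        rw [hy, integral_const_mul]
    _ = ∫ z, ∫ y, K x y * (L y z * f z) ∂μ ∂μ := by
        refine integral_integral_swap ⟨hm.aestronglyMeasurable, ?_⟩
        refine lt_of_eq_of_lt (lintegral_prod _ hm.enorm.aemeasurable) ?_
        refine lt_of_eq_of_lt (lintegral_congr fun y => ?_) h3
        change ∫⁻ z, ‖K x y * (L y z * f z)‖ₑ ∂μ = _
        simp_rw [enorm_mul]
        rw [lintegral_const_mul]
        exact (hL.measurable_row y).enorm.mul hf.enorm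
    _ = ∫ z, kernelComp μ K L x z * f z ∂μ := by
        refine integral_congr_ae (Eventually.of_forall fun z => ?_)
        simp only [kernelComp, ← integral_mul_const, mul_assoc]

lemma measurable_kernelComp [SFinite μ] (hK : Measurable (Function.uncurry K))
    (hL : Measurable (Function.uncurry L)) : Measurable (Function.uncurry (kernelComp μ K L)) := by
  have : Measurable fun q : (X × X) × X => K q.1.1 q.2 * L q.2 q.1.2 :=
    (hK.comp (measurable_fst.fst.prodMk measurable_snd)).mul
      (hL.comp (measurable_snd.prodMk measurable_fst.snd))
  exact this.stronglyMeasurable.integral_prod_right'.measurable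

/-- The columns of a composition need no cancellation. -/
lemma SchurKernel.comp_col_le [SFinite μ] (hK : SchurKernel μ K α β) (hL : SchurKernel μ L α' β')
    (z : X) : ∫⁻ x, ‖kernelComp μ K L x z‖ₑ ∂μ ≤ β * β' := by
  have hm : Measurable fun p : X × X => ‖K p.1 p.2‖ₑ * ‖L p.2 z‖ₑ :=
    hK.meas.enorm.mul ((hL.measurable_col z).comp measurable_snd).enorm
  calc ∫⁻ x, ‖kernelComp μ K L x z‖ₑ ∂μ
      ≤ ∫⁻ x, ∫⁻ y, ‖K x y‖ₑ * ‖L y z‖ₑ ∂μ ∂μ := by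
        refine lintegral_mono fun x => ?_
        refine (enorm_integral_le_lintegral_enorm _).trans_eq ?_
        simp [enorm_mul]
    _ = ∫⁻ y, ∫⁻ x, ‖K x y‖ₑ * ‖L y z‖ₑ ∂μ ∂μ := lintegral_lintegral_swap hm.aemeasurable
    _ ≤ ∫⁻ y, β * ‖L y z‖ₑ ∂μ := by
        refine lintegral_mono fun y => ?_
        rw [lintegral_mul_const _ (hK.measurable_col y).enorm]
        gcongr
        exact hK.col y
    _ ≤ β * β' := by
        rw [lintegral_const_mul _ (hL.measurable_col z).enorm]
        gcongr
        exact hL.col z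

end Schur

/-! ### Standard kernels on spaces with exact ball growth -/

section Kernel

open scoped ENNReal NNReal

lemma measurableSet_annulus {X : Type*} [PseudoMetricSpace X] [MeasurableSpace X]
    [OpensMeasurableSpace X] (x : X) (a b : ℝ) :
    MeasurableSet {y | a ≤ dist x y ∧ dist x y < b} := by
  have : Measurable fun y => dist x y := (continuous_const.dist continuous_id).measurable
  exact (measurableSet_le measurable_const this).inter (measurableSet_lt this measurable_const)

/-- Every ball of radius `r` has measure `v * r ^ Q`. -/
structure BallGrowth {X : Type*} [MetricSpace X] [MeasurableSpace X] (μ : Measure X) (Q : ℕ)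
    (v : ℝ) : Prop where
  one_le : 1 ≤ Q
  pos : 0 < v
  ball : ∀ x r, 0 < r → μ (Metric.ball x r) = ENNReal.ofReal (v * r ^ Q)

variable {X : Type*} [MetricSpace X] [MeasurableSpace X] [BorelSpace X]
  {μ : Measure X} {Q : ℕ} {v : ℝ}

namespace BallGrowth

lemma closedBall (h : BallGrowth μ Q v) (x : X) {r : ℝ} (hr : 0 ≤ r) :
    μ (Metric.closedBall x r) = ENNReal.ofReal (v * r ^ Q) := by
  refine le_antisymm ?_ ?_
  · have ht : Tendsto (fun ε : ℝ => ENNReal.ofReal (v * (r + ε) ^ Q)) (𝓝[>] 0)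
        (𝓝 (ENNReal.ofReal (v * (r + 0) ^ Q))) := by
      refine (ENNReal.continuous_ofReal.comp ?_).continuousWithinAt
      fun_prop
    rw [add_zero] at ht
    refine ge_of_tendsto ht ?_
    filter_upwards [self_mem_nhdsWithin] with ε hε
    have hε : 0 < ε := hε
    rw [← h.ball x _ (by positivity)]
    exact measure_mono (Metric.closedBall_subset_ball (by linarith))
  · rcases hr.eq_or_lt with rfl | hr
    · simp [Nat.one_le_iff_ne_zero.1 h.one_le]
    · rw [← h.ball x r hr]
      exact measure_mono Metric.ball_subset_closedBall

lemma sphere (h : BallGrowth μ Q v) (x : X) (r : ℝ) : μ {y | dist x y = r} = 0 := by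
  rcases lt_trichotomy r 0 with hr | rfl | hr
  · convert measure_empty (μ := μ)
    ext y
    simpa using (hr.trans_le dist_nonneg).ne'
  · have := h.closedBall x le_rfl
    rw [Metric.closedBall_zero, zero_pow (Nat.one_le_iff_ne_zero.1 h.one_le)] at this
    simpa [eq_comm] using this
  · have : {y | dist x y = r} = Metric.closedBall x r \ Metric.ball x r := by
      ext y
      simp [dist_comm x y, le_antisymm_iff]
    rw [this, measure_sdiff Metric.ball_subset_closedBall measurableSet_ball.nullMeasurableSet,
      h.closedBall x hr.le, h.ball x r hr, tsub_self]
    rw [h.ball x r hr]; exact ENNReal.ofReal_ne_top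

/-- The measure of a thin shell is proportional to its width. This uses the exact growth of balls;
doubling alone would not suffice. -/
lemma shell_le (h : BallGrowth μ Q v) (x : X) {a b c : ℝ} (ha : 0 < a) (hab : a ≤ b) (hbc : b ≤ c) :
    μ {y | a ≤ dist x y ∧ dist x y < b} ≤ ENNReal.ofReal (v * (Q * c ^ (Q - 1)) * (b - a)) := by
  have : {y | a ≤ dist x y ∧ dist x y < b} = Metric.ball x b \ Metric.ball x a := by
    ext y
    simp [dist_comm x y, and_comm]
  rw [this, measure_sdiff (Metric.ball_subset_ball hab) measurableSet_ball.nullMeasurableSet,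
    h.ball x b (ha.trans_le hab), h.ball x a ha, ← ENNReal.ofReal_sub]
  · refine ENNReal.ofReal_le_ofReal ?_
    rw [← mul_sub, mul_assoc]
    refine mul_le_mul_of_nonneg_left ?_ h.pos.le
    have hb : 0 ≤ b := ha.le.trans hab
    have hc : 0 ≤ c := hb.trans hbc
    have e : b ^ Q - a ^ Q = (∑ i ∈ Finset.range Q, b ^ i * a ^ (Q - 1 - i)) * (b - a) :=
      (Commute.all b a).geom_sum₂_mul Q |>.symm
    rw [e]
    refine mul_le_mul_of_nonneg_right ?_ (by linarith)
    calc ∑ i ∈ Finset.range Q, b ^ i * a ^ (Q - 1 - i)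
        ≤ ∑ i ∈ Finset.range Q, c ^ (Q - 1) := by
          refine Finset.sum_le_sum fun i hi => ?_
          have hi' : i + (Q - 1 - i) = Q - 1 := by have := Finset.mem_range.1 hi; omega
          calc b ^ i * a ^ (Q - 1 - i) ≤ c ^ i * c ^ (Q - 1 - i) := by
                gcongr
                exact hab.trans hbc
            _ = c ^ (Q - 1) := by rw [← pow_add, hi']
      _ = Q * c ^ (Q - 1) := by simp
  · have := h.pos
    positivity
  · rw [h.ball x a ha]; exact ENNReal.ofReal_ne_top

lemma ball_ne_top (h : BallGrowth μ Q v) (x : X) (r : ℝ) : μ (Metric.ball x r) ≠ ⊤ := by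
  rcases le_or_gt r 0 with hr | hr
  · simp [Metric.ball_eq_empty.2 hr]
  · rw [h.ball x r hr]; exact ENNReal.ofReal_ne_top

lemma real_ball (h : BallGrowth μ Q v) (x : X) {r : ℝ} (hr : 0 < r) :
    μ.real (Metric.ball x r) = v * r ^ Q := by
  have := h.pos
  rw [measureReal_def, h.ball x r hr, ENNReal.toReal_ofReal (by positivity)]

end BallGrowth

/-- A kernel with the standard size and smoothness estimates in both variables, whose integrals
over all annuli vanish. -/
structure StandardKernel (μ : Measure X) (Q : ℕ) (k : X → X → ℝ) (A B : ℝ) : Prop where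
  nonneg_size : 0 ≤ A
  nonneg_smooth : 0 ≤ B
  size : ∀ x y, x ≠ y → |k x y| ≤ A / dist x y ^ Q
  smooth_left : ∀ x₀ x y, 2 * dist x₀ x ≤ dist x₀ y →
    |k x y - k x₀ y| ≤ B * (dist x₀ x / dist x₀ y ^ (Q + 1))
  smooth_right : ∀ x₀ x y, 2 * dist x₀ x ≤ dist x₀ y →
    |k y x - k y x₀| ≤ B * (dist x₀ x / dist x₀ y ^ (Q + 1))
  cancel_left : ∀ x r₁ r₂, 0 < r₁ → r₁ < r₂ →
    ∫ y in {y | r₁ < dist x y ∧ dist x y < r₂}, k x y ∂μ = 0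
  cancel_right : ∀ x r₁ r₂, 0 < r₁ → r₁ < r₂ →
    ∫ y in {y | r₁ < dist x y ∧ dist x y < r₂}, k y x ∂μ = 0

open Classical in
/-- The kernel `k` cut off to `a ≤ d(x, y) < b`. -/
noncomputable def truncKernel (k : X → X → ℝ) (a b : ℝ) (x y : X) : ℝ :=
  if a ≤ dist x y ∧ dist x y < b then k x y else 0

lemma truncKernel_of_mem {k : X → X → ℝ} {a b : ℝ} {x y : X}
    (h : a ≤ dist x y ∧ dist x y < b) : truncKernel k a b x y = k x y := if_pos h

lemma truncKernel_of_notMem {k : X → X → ℝ} {a b : ℝ} {x y : X}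
    (h : ¬(a ≤ dist x y ∧ dist x y < b)) : truncKernel k a b x y = 0 := if_neg h

lemma truncKernel_swap (k : X → X → ℝ) (a b : ℝ) :
    (fun x y => truncKernel k a b y x) = truncKernel (fun x y => k y x) a b := by
  ext x y
  simp only [truncKernel, dist_comm y x]

namespace StandardKernel

variable {k : X → X → ℝ} {A B : ℝ}

lemma swap (hk : StandardKernel μ Q k A B) : StandardKernel μ Q (fun x y => k y x) A B where
  nonneg_size := hk.nonneg_size
  nonneg_smooth := hk.nonneg_smooth
  size x y h := by rw [dist_comm]; exact hk.size y x h.symm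
  smooth_left := hk.smooth_right
  smooth_right := hk.smooth_left
  cancel_left := hk.cancel_right
  cancel_right := hk.cancel_left

lemma abs_le_of_le_dist (hk : StandardKernel μ Q k A B) {x y : X} {a : ℝ} (ha : 0 < a)
    (h : a ≤ dist x y) : |k x y| ≤ A / a ^ Q := by
  refine (hk.size x y (dist_pos.1 (ha.trans_le h))).trans ?_
  have := hk.nonneg_size
  gcongr

lemma abs_truncKernel_le (hk : StandardKernel μ Q k A B) {a : ℝ} (ha : 0 < a) (b : ℝ) (x y : X) :
    |truncKernel k a b x y| ≤ A / a ^ Q := by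
  have := hk.nonneg_size
  by_cases h : a ≤ dist x y ∧ dist x y < b
  · rw [truncKernel_of_mem h]
    exact hk.abs_le_of_le_dist ha h.1
  · rw [truncKernel_of_notMem h, abs_zero]
    positivity

lemma abs_sub_le_of_le (hk : StandardKernel μ Q k A B) {x₀ x y : X} {a : ℝ} (ha : 0 < a)
    (h : 2 * dist x₀ x ≤ dist x₀ y) (hay : a ≤ dist x₀ y) :
    |k x y - k x₀ y| ≤ B * (dist x₀ x / a ^ (Q + 1)) := by
  refine (hk.smooth_left x₀ x y h).trans ?_
  have := hk.nonneg_smooth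
  gcongr

/-- Off the diagonal the kernel is jointly continuous. -/
lemma continuousOn (hk : StandardKernel μ Q k A B) :
    ContinuousOn (Function.uncurry k) {p : X × X | p.1 ≠ p.2} := by
  rintro ⟨x₀, y₀⟩ hne
  refine ContinuousAt.continuousWithinAt ?_
  have hd : 0 < dist x₀ y₀ := dist_pos.2 hne
  have hB := hk.nonneg_smooth
  set a := dist x₀ y₀ / 2 with ha
  have hapos : 0 < a := by positivity
  rw [ContinuousAt, tendsto_iff_dist_tendsto_zero]
  have hlim : Tendsto (fun p : X × X => B * (dist x₀ p.1 / a ^ (Q + 1)) +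
      B * (dist y₀ p.2 / a ^ (Q + 1))) (𝓝 (x₀, y₀)) (𝓝 0) := by
    have : Continuous (fun p : X × X => B * (dist x₀ p.1 / a ^ (Q + 1)) +
      B * (dist y₀ p.2 / a ^ (Q + 1))) := by fun_prop
    simpa using this.tendsto (x₀, y₀)
  refine squeeze_zero' (Eventually.of_forall fun _ => dist_nonneg) ?_ hlim
  have h1 : ∀ᶠ p : X × X in 𝓝 (x₀, y₀), dist x₀ p.1 < a / 4 := by
    have : Continuous fun p : X × X => dist x₀ p.1 := by fun_prop
    exact this.tendsto (x₀, y₀) |>.eventually_lt_const (by simp; positivity)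
  have h2 : ∀ᶠ p : X × X in 𝓝 (x₀, y₀), dist y₀ p.2 < a / 4 := by
    have : Continuous fun p : X × X => dist y₀ p.2 := by fun_prop
    exact this.tendsto (x₀, y₀) |>.eventually_lt_const (by simp; positivity)
  filter_upwards [h1, h2] with p hp1 hp2
  obtain ⟨x, y⟩ := p
  simp only at hp1 hp2 ⊢
  have t1 := dist_triangle x₀ y y₀
  rw [dist_comm y y₀] at t1
  have e1 : |k x y - k x₀ y| ≤ B * (dist x₀ x / a ^ (Q + 1)) :=
    hk.abs_sub_le_of_le hapos (by linarith) (by linarith)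
  have e2 : |k x₀ y - k x₀ y₀| ≤ B * (dist y₀ y / a ^ (Q + 1)) := by
    have hd' : dist y₀ x₀ = dist x₀ y₀ := dist_comm _ _
    exact hk.swap.abs_sub_le_of_le (x₀ := y₀) (x := y) (y := x₀) hapos (by linarith)
      (by linarith)
  simp only [Function.uncurry, Real.dist_eq]
  have := abs_sub_le (k x y) (k x₀ y) (k x₀ y₀)
  linarith

lemma measurable_truncKernel [SecondCountableTopology X] (hk : StandardKernel μ Q k A B)
    {a : ℝ} (ha : 0 < a) (b : ℝ) :
    Measurable (Function.uncurry (truncKernel k a b)) := by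
  classical
  have hoff : MeasurableSet {p : X × X | p.1 ≠ p.2} :=
    (isOpen_ne_fun continuous_fst continuous_snd).measurableSet
  have hm : Measurable (({p : X × X | p.1 ≠ p.2}).piecewise (Function.uncurry k) fun _ => 0) :=
    hk.continuousOn.measurable_piecewise continuousOn_const hoff
  have hs : MeasurableSet {p : X × X | a ≤ dist p.1 p.2 ∧ dist p.1 p.2 < b} :=
    (measurableSet_le measurable_const measurable_dist).inter
      (measurableSet_lt measurable_dist measurable_const)
  convert hm.indicator hs using 1
  ext ⟨x, y⟩
  by_cases h : a ≤ dist x y ∧ dist x y < b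
  · have hxy : x ≠ y := dist_pos.1 (ha.trans_le h.1)
    have hmem : (x, y) ∈ {p : X × X | a ≤ dist p.1 p.2 ∧ dist p.1 p.2 < b} := h
    rw [indicator_of_mem hmem, piecewise_eq_of_mem _ _ _ (by exact hxy)]
    exact truncKernel_of_mem h
  · have hmem : (x, y) ∉ {p : X × X | a ≤ dist p.1 p.2 ∧ dist p.1 p.2 < b} := h
    rw [indicator_of_notMem hmem]
    exact truncKernel_of_notMem h

lemma lintegral_truncKernel_le (hk : StandardKernel μ Q k A B) (hμ : BallGrowth μ Q v)
    {a b : ℝ} (ha : 0 < a) (hab : a < b) (x : X) :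
    ∫⁻ y, ‖truncKernel k a b x y‖ₑ ∂μ ≤ ENNReal.ofReal (A / a ^ Q * (v * b ^ Q)) := by
  have hA := hk.nonneg_size
  calc ∫⁻ y, ‖truncKernel k a b x y‖ₑ ∂μ
      ≤ ∫⁻ y, (Metric.ball x b).indicator (fun _ => ENNReal.ofReal (A / a ^ Q)) y ∂μ := by
        refine lintegral_mono fun y => ?_
        by_cases h : y ∈ Metric.ball x b
        · rw [indicator_of_mem h, Real.enorm_eq_ofReal_abs]
          exact ENNReal.ofReal_le_ofReal (hk.abs_truncKernel_le ha b x y)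
        · rw [indicator_of_notMem h, truncKernel_of_notMem, enorm_zero]
          rintro ⟨-, h2⟩
          rw [dist_comm] at h2
          exact h h2
    _ = ENNReal.ofReal (A / a ^ Q * (v * b ^ Q)) := by
        rw [lintegral_indicator measurableSet_ball, setLIntegral_const, hμ.ball x b (ha.trans hab),
          ← ENNReal.ofReal_mul (by positivity)]

lemma integrable_truncKernel [SecondCountableTopology X] (hk : StandardKernel μ Q k A B)
    (hμ : BallGrowth μ Q v) {a b : ℝ} (ha : 0 < a) (hab : a < b) (x : X) :
    Integrable (truncKernel k a b x) μ :=
  ⟨((hk.measurable_truncKernel ha b).comp measurable_prodMk_left).aestronglyMeasurable,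
    (hk.lintegral_truncKernel_le hμ ha hab x).trans_lt ENNReal.ofReal_lt_top⟩

lemma integral_truncKernel (hk : StandardKernel μ Q k A B) (hμ : BallGrowth μ Q v) {a b : ℝ}
    (ha : 0 < a) (hab : a < b) (x : X) : ∫ y, truncKernel k a b x y ∂μ = 0 := by
  have hd : Measurable fun y => dist x y := (continuous_const.dist continuous_id).measurable
  have hm : MeasurableSet {y | a < dist x y ∧ dist x y < b} :=
    (measurableSet_lt measurable_const hd).inter (measurableSet_lt hd measurable_const)
  rw [← hk.cancel_left x a b ha hab, ← integral_indicator hm]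
  refine integral_congr_ae ?_
  -- The truncation is half-open whereas the cancellation is over open annuli; spheres are null.
  have h0 : ∀ᵐ y ∂μ, ¬ dist x y = a := by
    rw [ae_iff]; simpa using hμ.sphere x a
  filter_upwards [h0] with y hy
  by_cases h : a < dist x y ∧ dist x y < b
  · rw [indicator_of_mem (by exact h), truncKernel_of_mem ⟨h.1.le, h.2⟩]
  · rw [indicator_of_notMem (by exact h), truncKernel_of_notMem]
    exact fun h' => h ⟨lt_of_le_of_ne h'.1 (Ne.symm hy), h'.2⟩

/-- The constant in the `L¹` modulus of continuity of the dyadic pieces of a kernel. -/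
noncomputable def modulusConst (Q : ℕ) (v A B : ℝ) : ℝ := 2 ^ Q * v * (B + 4 * A * Q + 4 * A)

/-- The `L¹` modulus of continuity of a dyadic piece of the kernel.  For the sharp cut-off the
points that lie in only one of the two annuli fill thin shells, whose measure is known exactly. -/
lemma lintegral_truncKernel_sub_le [SecondCountableTopology X] (hk : StandardKernel μ Q k A B)
    (hμ : BallGrowth μ Q v) {a : ℝ} (ha : 0 < a) (x₀ x : X) :
    ∫⁻ y, ‖truncKernel k a (2 * a) x y - truncKernel k a (2 * a) x₀ y‖ₑ ∂μ ≤
      ENNReal.ofReal (modulusConst Q v A B * (dist x₀ x / a)) := by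
  have hA := hk.nonneg_size
  have hB := hk.nonneg_smooth
  have hv := hμ.pos
  have hmx : ∀ x, Measurable fun y => ‖truncKernel k a (2 * a) x y‖ₑ := fun x =>
    ((hk.measurable_truncKernel ha (2 * a)).comp measurable_prodMk_left).enorm
  -- For points that are far apart at scale `a` the two pieces are bounded separately.
  rcases le_or_gt a (2 * dist x₀ x) with hδ | hδ
  · calc ∫⁻ y, ‖truncKernel k a (2 * a) x y - truncKernel k a (2 * a) x₀ y‖ₑ ∂μ
        ≤ ∫⁻ y, ‖truncKernel k a (2 * a) x y‖ₑ + ‖truncKernel k a (2 * a) x₀ y‖ₑ ∂μ :=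
          lintegral_mono fun y => enorm_sub_le
      _ ≤ ENNReal.ofReal (A / a ^ Q * (v * (2 * a) ^ Q)) +
          ENNReal.ofReal (A / a ^ Q * (v * (2 * a) ^ Q)) := by
          rw [lintegral_add_left (hmx x)]
          exact add_le_add (hk.lintegral_truncKernel_le hμ ha (by linarith) x)
            (hk.lintegral_truncKernel_le hμ ha (by linarith) x₀)
      _ ≤ _ := by
          rw [← ENNReal.ofReal_add (by positivity) (by positivity)]
          refine ENNReal.ofReal_le_ofReal ?_
          have e : A / a ^ Q * (v * (2 * a) ^ Q) = 2 ^ Q * v * A := by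
            rw [mul_pow]; field_simp
          have h1 : 1 ≤ 2 * (dist x₀ x / a) := by
            rw [← mul_div_assoc, le_div_iff₀ ha]; linarith
          rw [e, modulusConst]
          have h2 : 0 ≤ 2 ^ Q * v * A := by positivity
          have h3 : 0 ≤ 2 ^ Q * v * (B + 4 * A * Q) * (dist x₀ x / a) := by positivity
          nlinarith
  · set δ := dist x₀ x with hδdef
    have hδ0 : 0 ≤ δ := dist_nonneg
    let E1 : Set X := Metric.ball x₀ (2 * a)
    let S : X → Set X := fun x => {y | a ≤ dist x y ∧ dist x y < a + δ}
    let S' : X → Set X := fun x => {y | 2 * a - δ ≤ dist x y ∧ dist x y < 2 * a}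
    have hmS : ∀ x, MeasurableSet (S x) := fun x => measurableSet_annulus x _ _
    have hmS' : ∀ x, MeasurableSet (S' x) := fun x => measurableSet_annulus x _ _
    let c1 := ENNReal.ofReal (B * (δ / a ^ (Q + 1)))
    let c2 := ENNReal.ofReal (A / a ^ Q)
    -- A point in the annulus about `z` but not in that about `w` lies within `δ` of the boundary of
    -- the former.
    have hone : ∀ z w y : X, dist z w = δ → (a ≤ dist z y ∧ dist z y < 2 * a) →
        ¬(a ≤ dist w y ∧ dist w y < 2 * a) →
        c2 ≤ (S z).indicator (fun _ => c2) y + (S' z).indicator (fun _ => c2) y := by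
      intro z w y hzw hz hw
      have t1 := dist_triangle z w y
      have t2 := dist_triangle w z y
      rw [dist_comm w z] at t2
      by_cases hwa : a ≤ dist w y
      · have hw2 : 2 * a ≤ dist w y := not_lt.1 fun h => hw ⟨hwa, h⟩
        have : y ∈ S' z := ⟨by linarith, hz.2⟩
        rw [indicator_of_mem this]
        exact le_add_self
      · have : y ∈ S z := ⟨hz.1, by linarith⟩
        rw [indicator_of_mem this]
        exact le_self_add
    have hpt : ∀ y, ‖truncKernel k a (2 * a) x y - truncKernel k a (2 * a) x₀ y‖ₑ ≤
        E1.indicator (fun _ => c1) y +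
        ((S x).indicator (fun _ => c2) y + (S' x).indicator (fun _ => c2) y) +
        ((S x₀).indicator (fun _ => c2) y + (S' x₀).indicator (fun _ => c2) y) := by
      intro y
      by_cases hx : a ≤ dist x y ∧ dist x y < 2 * a <;>
        by_cases hx0 : a ≤ dist x₀ y ∧ dist x₀ y < 2 * a
      · have : y ∈ E1 := by
          change dist y x₀ < 2 * a
          rw [dist_comm]; exact hx0.2
        rw [indicator_of_mem this, truncKernel_of_mem hx, truncKernel_of_mem hx0, add_assoc]
        refine le_add_right ?_
        rw [Real.enorm_eq_ofReal_abs]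
        exact ENNReal.ofReal_le_ofReal (hk.abs_sub_le_of_le ha (by linarith [hx0.1]) hx0.1)
      · rw [truncKernel_of_notMem hx0, sub_zero]
        refine le_trans ?_ ((hone x x₀ y (dist_comm _ _) hx hx0).trans
          (le_add_right le_add_self))
        rw [Real.enorm_eq_ofReal_abs]
        exact ENNReal.ofReal_le_ofReal (hk.abs_truncKernel_le ha _ x y)
      · rw [truncKernel_of_notMem hx, zero_sub, enorm_neg]
        refine le_trans ?_ ((hone x₀ x y rfl hx0 hx).trans le_add_self)
        rw [Real.enorm_eq_ofReal_abs]
        exact ENNReal.ofReal_le_ofReal (hk.abs_truncKernel_le ha _ x₀ y)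
      · simp [truncKernel_of_notMem hx, truncKernel_of_notMem hx0]
    have hS : ∀ x, μ (S x) ≤ ENNReal.ofReal (v * (Q * (2 * a) ^ (Q - 1)) * δ) := by
      intro x
      have := hμ.shell_le x ha (b := a + δ) (c := 2 * a) (by linarith) (by linarith)
      simpa using this
    have hS' : ∀ x, μ (S' x) ≤ ENNReal.ofReal (v * (Q * (2 * a) ^ (Q - 1)) * δ) := by
      intro x
      have := hμ.shell_le x (a := 2 * a - δ) (b := 2 * a) (c := 2 * a) (by linarith)
        (by linarith) le_rfl
      rwa [sub_sub_cancel] at this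
    have hterm : ∀ x, ∫⁻ y, ((S x).indicator (fun _ => c2) y + (S' x).indicator (fun _ => c2) y) ∂μ
        ≤ ENNReal.ofReal (2 * (A / a ^ Q * (v * (Q * (2 * a) ^ (Q - 1)) * δ))) := by
      intro x
      rw [lintegral_add_left (measurable_const.indicator (hmS x)),
        lintegral_indicator (hmS x), lintegral_indicator (hmS' x), setLIntegral_const,
        setLIntegral_const, two_mul, ENNReal.ofReal_add (by positivity) (by positivity),
        ENNReal.ofReal_mul (by positivity)]
      gcongr
      · exact hS x
      · exact hS' x
    calc ∫⁻ y, ‖truncKernel k a (2 * a) x y - truncKernel k a (2 * a) x₀ y‖ₑ ∂μ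
        ≤ ∫⁻ y, (E1.indicator (fun _ => c1) y +
        ((S x).indicator (fun _ => c2) y + (S' x).indicator (fun _ => c2) y) +
        ((S x₀).indicator (fun _ => c2) y + (S' x₀).indicator (fun _ => c2) y)) ∂μ :=
          lintegral_mono hpt
      _ ≤ ENNReal.ofReal (B * (δ / a ^ (Q + 1)) * (v * (2 * a) ^ Q)) +
          ENNReal.ofReal (2 * (A / a ^ Q * (v * (Q * (2 * a) ^ (Q - 1)) * δ))) +
          ENNReal.ofReal (2 * (A / a ^ Q * (v * (Q * (2 * a) ^ (Q - 1)) * δ))) := by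
          have m1 : Measurable (E1.indicator fun _ => c1) :=
            measurable_const.indicator measurableSet_ball
          have m2 : ∀ x, Measurable fun y =>
              (S x).indicator (fun _ => c2) y + (S' x).indicator (fun _ => c2) y := fun x =>
            (measurable_const.indicator (hmS x)).add (measurable_const.indicator (hmS' x))
          have m3 : Measurable fun y => E1.indicator (fun _ => c1) y +
              ((S x).indicator (fun _ => c2) y + (S' x).indicator (fun _ => c2) y) :=
            m1.add (m2 x)
          rw [lintegral_add_left m3, lintegral_add_left m1]
          gcongr
          · rw [lintegral_indicator measurableSet_ball, setLIntegral_const,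
              hμ.ball x₀ _ (by positivity), ← ENNReal.ofReal_mul (by positivity)]
          · exact hterm x
          · exact hterm x₀
      _ ≤ _ := by
          rw [← ENNReal.ofReal_add (by positivity) (by positivity),
            ← ENNReal.ofReal_add (by positivity) (by positivity)]
          refine ENNReal.ofReal_le_ofReal ?_
          obtain ⟨q, rfl⟩ : ∃ q, Q = q + 1 := ⟨Q - 1, by have := hμ.one_le; omega⟩
          have e1 : B * (δ / a ^ (q + 1 + 1)) * (v * (2 * a) ^ (q + 1)) =
              2 ^ (q + 1) * v * B * (δ / a) := by
            rw [mul_pow]; field_simp; ring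
          have e2 : 2 * (A / a ^ (q + 1) * (v * ((q + 1 : ℕ) * (2 * a) ^ (q + 1 - 1)) * δ)) =
              2 ^ (q + 1) * v * (A * (q + 1 : ℕ)) * (δ / a) := by
            rw [Nat.add_sub_cancel, mul_pow, pow_succ 2 q]; field_simp; ring
          rw [e1, e2, modulusConst]
          have h3 : 0 ≤ 2 ^ (q + 1) * v * (2 * A * (q + 1 : ℕ) + 4 * A) * (δ / a) := by
            positivity
          linarith

end StandardKernel

end Kernel

/-! ### `L²` bounds for truncated singular integrals -/

section L2

open scoped ENNReal NNReal

variable {X : Type*} [MetricSpace X] [MeasurableSpace X] [BorelSpace X] [SecondCountableTopology X]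
  {μ : Measure X} {Q : ℕ} {v : ℝ} {k k' : X → X → ℝ} {A B : ℝ}

namespace StandardKernel

/-- The bound for the rows and columns of a dyadic piece of the kernel. -/
noncomputable def rowConst (Q : ℕ) (v A : ℝ) : ℝ≥0 := (2 ^ Q * v * A).toNNReal

lemma schur_dyadic (hk : StandardKernel μ Q k A B) (hμ : BallGrowth μ Q v) {a : ℝ} (ha : 0 < a) :
    SchurKernel μ (truncKernel k a (2 * a)) (rowConst Q v A) (rowConst Q v A) := by
  have e : A / a ^ Q * (v * (2 * a) ^ Q) = 2 ^ Q * v * A := by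
    rw [mul_pow]; field_simp
  have h : ∀ {k : X → X → ℝ}, StandardKernel μ Q k A B → ∀ x,
      ∫⁻ y, ‖truncKernel k a (2 * a) x y‖ₑ ∂μ ≤ rowConst Q v A := by
    intro k hk x
    have := hk.lintegral_truncKernel_le hμ ha (by linarith : a < 2 * a) x
    rwa [e] at this
  refine ⟨hk.measurable_truncKernel ha _, h hk, fun y => ?_⟩
  have := h hk.swap y
  rwa [← truncKernel_swap] at this

/-- The bound for the rows of a composition of two dyadic pieces, for equal scales. -/
noncomputable def compConst (Q : ℕ) (v A B : ℝ) : ℝ :=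
  2 * (2 ^ Q * v * A) * modulusConst Q v A B

/-- Cancellation of the first kernel and smoothness of the second make the rows of the composition
of two dyadic pieces small by the ratio of the scales. The columns are merely bounded, which by the
Schur test is enough for a gain in the operator norm. -/
lemma schur_comp [SFinite μ] (hk : StandardKernel μ Q k A B) (hk' : StandardKernel μ Q k' A B)
    (hμ : BallGrowth μ Q v) {a b : ℝ} (ha : 0 < a) (hb : 0 < b) :
    SchurKernel μ (kernelComp μ (truncKernel k a (2 * a)) (truncKernel k' b (2 * b)))
      (compConst Q v A B * (a / b)).toNNReal (rowConst Q v A * rowConst Q v A) := by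
  have hA := hk.nonneg_size
  have hB := hk.nonneg_smooth
  have hv := hμ.pos
  have hC : 0 ≤ modulusConst Q v A B := by unfold modulusConst; positivity
  have s1 := hk.schur_dyadic hμ ha
  have s2 := hk'.schur_dyadic hμ hb
  refine ⟨measurable_kernelComp s1.meas s2.meas, fun x => ?_, fun z => ?_⟩
  swap
  · rw [ENNReal.coe_mul]; exact s1.comp_col_le s2 z
  have hm2 : Measurable fun p : X × X =>
      ‖truncKernel k' b (2 * b) p.2 p.1 - truncKernel k' b (2 * b) x p.1‖ₑ :=
    ((s2.meas.comp measurable_swap).sub ((s2.measurable_row x).comp measurable_fst)).enorm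
  have hm : Measurable fun p : X × X => ‖truncKernel k a (2 * a) x p.2‖ₑ *
      ‖truncKernel k' b (2 * b) p.2 p.1 - truncKernel k' b (2 * b) x p.1‖ₑ :=
    ((s1.measurable_row x).comp measurable_snd).enorm.mul hm2
  calc ∫⁻ z, ‖kernelComp μ (truncKernel k a (2 * a)) (truncKernel k' b (2 * b)) x z‖ₑ ∂μ
      ≤ ∫⁻ z, ∫⁻ y, ‖truncKernel k a (2 * a) x y‖ₑ *
          ‖truncKernel k' b (2 * b) y z - truncKernel k' b (2 * b) x z‖ₑ ∂μ ∂μ := by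
        refine lintegral_mono fun z => ?_
        have hint := hk.integrable_truncKernel hμ ha (by linarith : a < 2 * a) x
        have hint2 : Integrable (fun y => truncKernel k a (2 * a) x y *
            truncKernel k' b (2 * b) y z) μ :=
          hint.mul_bdd (c := A / b ^ Q) (s2.measurable_col z).aestronglyMeasurable
            (Eventually.of_forall fun y => hk'.abs_truncKernel_le hb _ y z)
        -- The first kernel integrates to zero, so the value at `x` of the second may be subtracted.
        have e : kernelComp μ (truncKernel k a (2 * a)) (truncKernel k' b (2 * b)) x z =
            ∫ y, truncKernel k a (2 * a) x y *
              (truncKernel k' b (2 * b) y z - truncKernel k' b (2 * b) x z) ∂μ := by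
          simp_rw [mul_sub]
          rw [integral_sub hint2 (hint.mul_const _), integral_mul_const,
            hk.integral_truncKernel hμ ha (by linarith : a < 2 * a) x, zero_mul, sub_zero]
          rfl
        rw [e]
        refine (enorm_integral_le_lintegral_enorm _).trans_eq ?_
        simp [enorm_mul]
    _ = ∫⁻ y, ∫⁻ z, ‖truncKernel k a (2 * a) x y‖ₑ *
          ‖truncKernel k' b (2 * b) y z - truncKernel k' b (2 * b) x z‖ₑ ∂μ ∂μ :=
        lintegral_lintegral_swap hm.aemeasurable
    _ ≤ ∫⁻ y, ‖truncKernel k a (2 * a) x y‖ₑ *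
          ENNReal.ofReal (modulusConst Q v A B * (2 * a / b)) ∂μ := by
        refine lintegral_mono fun y => ?_
        have hmz : Measurable fun z =>
            ‖truncKernel k' b (2 * b) y z - truncKernel k' b (2 * b) x z‖ₑ :=
          ((s2.measurable_row y).sub (s2.measurable_row x)).enorm
        rw [lintegral_const_mul _ hmz]
        by_cases h : a ≤ dist x y ∧ dist x y < 2 * a
        · gcongr
          refine (hk'.lintegral_truncKernel_sub_le hμ hb x y).trans (ENNReal.ofReal_le_ofReal ?_)
          have := h.2.le
          gcongr
        · rw [truncKernel_of_notMem h, enorm_zero, zero_mul]; exact zero_le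
    _ ≤ ENNReal.ofReal (2 ^ Q * v * A) * ENNReal.ofReal (modulusConst Q v A B * (2 * a / b)) := by
        rw [lintegral_mul_const _ (s1.measurable_row x).enorm]
        gcongr
        exact s1.row x
    _ = ENNReal.ofReal (compConst Q v A B * (a / b)) := by
        rw [← ENNReal.ofReal_mul (by positivity)]
        congr 1
        rw [compConst]; ring

/-- The dyadic piece of the operator at scale `2 ^ j`. -/
noncomputable def dyadicOp [SFinite μ] (hk : StandardKernel μ Q k A B) (hμ : BallGrowth μ Q v)
    (j : ℤ) : Lp ℝ 2 μ →L[ℝ] Lp ℝ 2 μ :=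
  (hk.schur_dyadic hμ (a := 2 ^ j) (by positivity)).op

/-- The almost orthogonality constant of the dyadic pieces. -/
noncomputable def orthoConst (Q : ℕ) (v A B : ℝ) : ℝ :=
  √(compConst Q v A B * (rowConst Q v A * rowConst Q v A))

lemma op_congr [SFinite μ] {K L : X → X → ℝ} {α β : ℝ≥0} (hK : SchurKernel μ K α β)
    (hL : SchurKernel μ L α β) (h : K = L) : hK.op = hL.op := by
  subst h; rfl

lemma adjoint_dyadicOp [SFinite μ] (hk : StandardKernel μ Q k A B) (hμ : BallGrowth μ Q v)
    (j : ℤ) : ContinuousLinearMap.adjoint (hk.dyadicOp hμ j) = hk.swap.dyadicOp hμ j := by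
  rw [dyadicOp, SchurKernel.adjoint_op]
  exact op_congr _ _ (truncKernel_swap _ _ _)

lemma norm_dyadicOp_mul_le_of_le [SFinite μ] (hk : StandardKernel μ Q k A B)
    (hk' : StandardKernel μ Q k' A B) (hμ : BallGrowth μ Q v) {i j : ℤ} (hij : i ≤ j) :
    ‖hk.dyadicOp hμ i * hk'.dyadicOp hμ j‖ ≤
      orthoConst Q v A B * ((9 / 10) ^ (i - j).natAbs) ^ 2 := by
  have hA := hk.nonneg_size
  have hB := hk.nonneg_smooth
  have hv := hμ.pos
  have hC : 0 ≤ compConst Q v A B := by unfold compConst modulusConst; positivity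
  have hi : (0 : ℝ) < 2 ^ i := by positivity
  have hj : (0 : ℝ) < 2 ^ j := by positivity
  rw [dyadicOp, dyadicOp, SchurKernel.op_mul_op _ _ (hk.schur_comp hk' hμ hi hj)]
  refine (SchurKernel.norm_op_le _).trans ?_
  rw [Real.coe_toNNReal _ (by positivity)]
  obtain ⟨n, rfl⟩ : ∃ n : ℕ, j = i + n := ⟨(j - i).toNat, by omega⟩
  have e1 : (2 : ℝ) ^ i / 2 ^ (i + n : ℤ) = (1 / 2) ^ n := by
    rw [zpow_add₀ two_ne_zero, zpow_natCast, one_div, inv_pow]; field_simp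
  have e2 : (i - (i + n : ℤ)).natAbs = n := by omega
  rw [e1, e2, orthoConst]
  refine Real.sqrt_le_iff.2 ⟨by positivity, ?_⟩
  rw [mul_pow, Real.sq_sqrt (by positivity), NNReal.coe_mul]
  -- The operator norm gains `(1 / 2) ^ (n / 2)`, and the lemma of Cotlar and Stein asks for the
  -- square of a summable bound; any base below one whose fourth power is at least `1 / 2` serves.
  have : ((1 : ℝ) / 2) ^ n ≤ (((9 / 10) ^ n) ^ 2) ^ 2 := by
    rw [← pow_mul, ← pow_mul, mul_comm n, pow_mul]
    exact pow_le_pow_left₀ (by norm_num) (by norm_num) n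
  have h0 : 0 ≤ compConst Q v A B * ((rowConst Q v A : ℝ) * rowConst Q v A) := by positivity
  nlinarith

lemma norm_adjoint_mul_le [SFinite μ] (hk : StandardKernel μ Q k A B) (hμ : BallGrowth μ Q v)
    (i j : ℤ) : ‖ContinuousLinearMap.adjoint (hk.dyadicOp hμ i) * hk.dyadicOp hμ j‖ ≤
      orthoConst Q v A B * ((9 / 10) ^ (i - j).natAbs) ^ 2 := by
  rcases le_total i j with h | h
  · rw [adjoint_dyadicOp]
    exact hk.swap.norm_dyadicOp_mul_le_of_le hk hμ h
  · rw [norm_adjoint_mul_comm, adjoint_dyadicOp, ← Int.natAbs_neg, neg_sub]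
    exact hk.swap.norm_dyadicOp_mul_le_of_le hk hμ h

lemma norm_mul_adjoint_le [SFinite μ] (hk : StandardKernel μ Q k A B) (hμ : BallGrowth μ Q v)
    (i j : ℤ) : ‖hk.dyadicOp hμ i * ContinuousLinearMap.adjoint (hk.dyadicOp hμ j)‖ ≤
      orthoConst Q v A B * ((9 / 10) ^ (i - j).natAbs) ^ 2 := by
  have h := hk.swap.norm_adjoint_mul_le hμ i j
  rw [adjoint_dyadicOp] at h ⊢
  exact h

lemma sum_Ico_truncKernel (k : X → X → ℝ) (m : ℤ) (n : ℕ) (x y : X) :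
    ∑ j ∈ Finset.Ico m (m + n), truncKernel k (2 ^ j) (2 * 2 ^ j) x y =
      truncKernel k (2 ^ m) (2 ^ (m + n)) x y := by
  induction n with
  | zero =>
    simp only [Nat.cast_zero, add_zero, Finset.Ico_self, Finset.sum_empty]
    rw [truncKernel_of_notMem]
    rintro ⟨h1, h2⟩
    linarith
  | succ n ih =>
    have e : Finset.Ico m (m + (n + 1 : ℕ)) = insert (m + n : ℤ) (Finset.Ico m (m + n)) := by
      ext j; simp only [Finset.mem_Ico, Finset.mem_insert]; omega
    rw [e, Finset.sum_insert (by simp), ih]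
    have e2 : (2 : ℝ) ^ (m + (n + 1 : ℕ)) = 2 * 2 ^ (m + n) := by
      rw [mul_comm, ← zpow_add_one₀ two_ne_zero]; push_cast; ring_nf
    have hle : (2 : ℝ) ^ m ≤ 2 ^ (m + n) := zpow_le_zpow_right₀ (by norm_num) (by omega)
    have hpos : (0 : ℝ) < 2 ^ (m + n) := by positivity
    rw [e2]
    unfold truncKernel
    split_ifs with h1 h2 h3 h3 h3 h3 <;> first | (exfalso; grind) | simp

/-- The truncated operator is bounded on `L²`, uniformly in the truncation, and its values
converge in `L²`. -/
theorem exists_l2_limit [SFinite μ] (hμ : BallGrowth μ Q v) (A B : ℝ) :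
    ∃ Γ : ℝ, 0 < Γ ∧ ∀ k, StandardKernel μ Q k A B → ∀ f, MemLp f 2 μ →
      (∀ n : ℕ, MemLp (fun x => ∫ y, truncKernel k (2 ^ (-n : ℤ)) (2 ^ n) x y * f y ∂μ) 2 μ ∧
        eLpNorm (fun x => ∫ y, truncKernel k (2 ^ (-n : ℤ)) (2 ^ n) x y * f y ∂μ) 2 μ ≤
          ENNReal.ofReal Γ * eLpNorm f 2 μ) ∧
      ∃ F, MemLp F 2 μ ∧ Tendsto (fun n : ℕ => eLpNorm
        (fun x => ∫ y, truncKernel k (2 ^ (-n : ℤ)) (2 ^ n) x y * f y ∂μ - F x) 2 μ)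
        atTop (𝓝 0) := by
  have hsumm : Summable fun n : ℤ => (9 / 10 : ℝ) ^ n.natAbs := by
    have : Summable fun n : ℕ => (9 / 10 : ℝ) ^ n :=
      summable_geometric_of_lt_one (by norm_num) (by norm_num)
    refine Summable.of_nat_of_neg ?_ ?_ <;> simpa using this
  set D := orthoConst Q v A B with hD
  set Z := ∑' n : ℤ, (9 / 10 : ℝ) ^ n.natAbs with hZ
  have hD0 : 0 ≤ D := Real.sqrt_nonneg _
  have hZ0 : 0 ≤ Z := tsum_nonneg fun n => by positivity
  refine ⟨rowConst Q v A + √D * Z + 1, by positivity, fun k hk f hf => ?_⟩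
  set Γ := rowConst Q v A + √D * Z + 1 with hΓ
  let T : ℤ → Lp ℝ 2 μ →L[ℝ] Lp ℝ 2 μ := hk.dyadicOp hμ
  let γ : ℤ → ℤ → ℝ := fun i j => √D * (9 / 10) ^ (i - j).natAbs
  have hγ2 : ∀ i j, γ i j ^ 2 = D * ((9 / 10) ^ (i - j).natAbs) ^ 2 := by
    intro i j
    simp only [γ]
    rw [mul_pow, Real.sq_sqrt hD0]
  have hγs : ∀ i, Summable fun j => γ i j := fun i =>
    ((Equiv.subLeft i).summable_iff.2 hsumm).mul_left _
  have hbound : ∀ s : Finset ℤ, ‖∑ j ∈ s, T j‖ ≤ Γ := by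
    intro s
    refine norm_sum_le_of_almost_orthogonal (γ := γ) s (fun i j => by positivity) (fun i => ?_)
      (by positivity) (fun i => ?_) (fun i j => ?_) fun i j => ?_
    · calc ∑ j ∈ s, γ i j ≤ ∑' j, γ i j :=
            (hγs i).sum_le_tsum s fun j _ => by positivity
        _ = √D * Z := by
            rw [tsum_mul_left, hZ]
            congr 1
            exact (Equiv.subLeft i).tsum_eq fun n : ℤ => (9 / 10 : ℝ) ^ n.natAbs
        _ ≤ Γ := by
            have : (0 : ℝ) ≤ rowConst Q v A := NNReal.coe_nonneg _
            linarith
    · refine (SchurKernel.norm_op_le _).trans ?_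
      rw [Real.sqrt_mul_self (NNReal.coe_nonneg _)]
      have : 0 ≤ √D * Z := by positivity
      linarith
    · rw [hγ2]; exact hk.norm_adjoint_mul_le hμ i j
    · rw [hγ2]; exact hk.norm_mul_adjoint_le hμ i j
  let s : ℕ → Finset ℤ := fun n => Finset.Ico (-n : ℤ) n
  have hs : Tendsto s atTop atTop := by
    refine tendsto_atTop_finset_of_monotone (fun m n h => ?_) fun j => ⟨j.natAbs + 1, ?_⟩
    · exact Finset.Ico_subset_Ico (by omega) (by omega)
    · simp only [s, Finset.mem_Ico]; omega
  have hcoe : ∀ n : ℕ, ∀ f : Lp ℝ 2 μ, (∑ j ∈ s n, T j f : Lp ℝ 2 μ) =ᵐ[μ]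
      fun x => ∫ y, truncKernel k (2 ^ (-n : ℤ)) (2 ^ n) x y * f y ∂μ := by
    intro n f
    have h1 : ∀ᵐ x ∂μ, ∀ j : ℤ, T j f x = ∫ y, truncKernel k (2 ^ j) (2 * 2 ^ j) x y * f y ∂μ :=
      ae_all_iff.2 fun j => SchurKernel.coeFn_op _ f
    have h2 : ∀ᵐ x ∂μ, ∀ j : ℤ,
        Integrable (fun y => truncKernel k (2 ^ j) (2 * 2 ^ j) x y * f y) μ :=
      ae_all_iff.2 fun j => (hk.schur_dyadic hμ (a := 2 ^ j) (by positivity)).ae_integrable f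
    filter_upwards [h1, h2, Lp.coeFn_finsetSum (s n) fun j => T j f] with x h1 h2 h3
    rw [h3, Finset.sum_apply, Finset.sum_congr rfl fun j _ => h1 j,
      ← integral_finsetSum _ fun j _ => h2 j]
    refine integral_congr_ae (Eventually.of_forall fun y => ?_)
    simp only [← Finset.sum_mul]
    congr 1
    have := sum_Ico_truncKernel k (-n : ℤ) (2 * n) x y
    have e : (-n : ℤ) + (2 * n : ℕ) = n := by push_cast; ring
    rw [e, zpow_natCast] at this
    exact this
  have hrep : ∀ n : ℕ, (∑ j ∈ s n, T j (hf.toLp f) : Lp ℝ 2 μ) =ᵐ[μ]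
      fun x => ∫ y, truncKernel k (2 ^ (-n : ℤ)) (2 ^ n) x y * f y ∂μ := by
    intro n
    filter_upwards [hcoe n (hf.toLp f)] with x hx
    rw [hx]
    refine integral_congr_ae ?_
    filter_upwards [hf.coeFn_toLp] with y hy
    rw [hy]
  refine ⟨fun n => ⟨(Lp.memLp _).ae_eq (hrep n), ?_⟩, ?_⟩
  · rw [← eLpNorm_congr_ae (hrep n)]
    have h := (∑ j ∈ s n, T j).le_of_opNorm_le (hbound (s n)) (hf.toLp f)
    rw [← ENNReal.ofReal_toReal hf.2.ne, ← Lp.norm_toLp f hf, ← ENNReal.ofReal_mul (by positivity)]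
    rw [← ENNReal.ofReal_toReal (Lp.eLpNorm_ne_top _)]
    refine ENNReal.ofReal_le_ofReal ?_
    simpa [Lp.norm_def] using h
  · obtain ⟨g, hg⟩ := exists_tendsto_sum_of_almost_orthogonal (T := T) s (fun n => hbound (s n))
      (fun j => by
        have h1 : Summable fun i : ℤ => D * (9 / 10 : ℝ) ^ (i - j).natAbs :=
          ((Equiv.subRight j).summable_iff.2 hsumm).mul_left _
        refine Summable.of_nonneg_of_le (fun i => norm_nonneg _)
          (fun i => (hk.norm_mul_adjoint_le hμ i j).trans ?_) h1
        refine mul_le_mul_of_nonneg_left ?_ hD0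
        exact pow_le_of_le_one (by positivity) (pow_le_one₀ (by norm_num) (by norm_num))
          two_ne_zero) hs (hf.toLp f)
    refine ⟨g, Lp.memLp g, ?_⟩
    have h1 := (Lp.tendsto_Lp_iff_tendsto_eLpNorm' _ _).1 hg
    refine h1.congr fun n => eLpNorm_congr_ae ?_
    filter_upwards [hrep n] with x hx
    rw [Pi.sub_apply, hx]

end StandardKernel

end L2

/-! ### Comparison of the limit operator with truncated integrals -/

section Comparison

open scoped ENNReal NNReal

variable {X : Type*} [MetricSpace X] [MeasurableSpace X] [BorelSpace X] [SecondCountableTopology X]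
  {μ : Measure X} {Q : ℕ} {v : ℝ} {k : X → X → ℝ} {A B : ℝ}

lemma setLIntegral_enorm_le_eLpNorm {h : X → ℝ} (hh : AEStronglyMeasurable h μ) (s : Set X) :
    ∫⁻ x in s, ‖h x‖ₑ ∂μ ≤ μ s ^ (1 / 2 : ℝ) * eLpNorm h 2 μ := by
  rw [← ENNReal.pow_le_pow_left_iff two_ne_zero, mul_pow, eLpNorm_two_sq, ← ENNReal.rpow_natCast,
    ← ENNReal.rpow_natCast, ← ENNReal.rpow_mul]
  have := lintegral_sq_le (μ.restrict s) hh.enorm.restrict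
  rw [Measure.restrict_apply_univ] at this
  norm_num
  refine this.trans ?_
  gcongr
  exact Measure.restrict_le_self

namespace StandardKernel

/-- The bound for the integral of the kernel over the points that lie on one side only of two
spheres of radius `2 ^ n` with centres at distance at most `ε`. -/
noncomputable def edgeConst (Q : ℕ) (v A ε : ℝ) (n : ℕ) : ℝ :=
  A / (2 ^ n / 2) ^ Q * (v * (Q * (2 * 2 ^ n) ^ (Q - 1)) * (2 * ε))

lemma tendsto_edgeConst (hμ : BallGrowth μ Q v) (A ε : ℝ) :
    Tendsto (edgeConst Q v A ε) atTop (𝓝 0) := by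
  obtain ⟨q, rfl⟩ : ∃ q, Q = q + 1 := ⟨Q - 1, by have := hμ.one_le; omega⟩
  have e : edgeConst (q + 1) v A ε = fun n : ℕ =>
      A * 2 ^ (q + 1) * v * ((q + 1 : ℕ) * 2 ^ q) * (2 * ε) * (1 / 2) ^ n := by
    ext n
    rw [edgeConst, Nat.add_sub_cancel, div_pow, mul_pow, one_div, inv_pow, pow_succ ((2 : ℝ) ^ n)]
    field_simp
  rw [e]
  simpa using (tendsto_pow_atTop_nhds_zero_of_lt_one (by norm_num : (0 : ℝ) ≤ 1 / 2)
    (by norm_num)).const_mul _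

/-- The truncated integral at `x'` is compared with the one at a nearby point `x`: since the kernel
integrates to zero over annuli, a constant `c` may be subtracted from `f`, and then the near part is
a truncated integral of `f - c` on a ball, the far part is controlled by the smoothness of the
kernel, and the truncation at `2 ^ n` leaves an error which is small because `f` has bounded
support. -/
lemma enorm_trunc_sub_tail_le (hk : StandardKernel μ Q k A B) (hμ : BallGrowth μ Q v) {f : X → ℝ}
    (hf : Integrable f μ) {x x' : X} {ε L c : ℝ} (hε : 0 < ε) (hx : dist x x' < ε)
    (hL : ∀ᵐ y ∂μ, L ≤ dist x y → f y = 0) {n : ℕ} (hn : (2 : ℝ) ^ (-n : ℤ) ≤ ε)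
    (hn2 : 4 * ε + 2 * |L| ≤ 2 ^ n) :
    ‖(∫ y, truncKernel k (2 ^ (-n : ℤ)) (2 ^ n) x' y * f y ∂μ) -
        ∫ y in {y | 2 * ε < dist x y}, k x y * f y ∂μ‖ₑ ≤
      ‖∫ y, truncKernel k (2 ^ (-n : ℤ)) (2 ^ n) x' y *
          (Metric.ball x (2 * ε)).indicator (fun y => f y - c) y ∂μ‖ₑ +
      (∫⁻ y in {y | 2 * ε ≤ dist x y},
          ENNReal.ofReal (B * (ε / dist x y ^ (Q + 1))) * ‖f y - c‖ₑ ∂μ +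
        ENNReal.ofReal (edgeConst Q v A ε n) * ‖c‖ₑ) := by
  have hA := hk.nonneg_size
  have hB := hk.nonneg_smooth
  have hv := hμ.pos
  set N : ℝ := 2 ^ n with hN
  set b : ℝ := 2 ^ (-n : ℤ) with hb
  have hb0 : 0 < b := by positivity
  have hN0 : 0 < N := by positivity
  have hL0 := abs_nonneg L
  have hLle := le_abs_self L
  have hbN : b < N := by linarith
  set U := Metric.ball x (2 * ε) with hU
  set K' : X → ℝ := truncKernel k b N x' with hK'
  set K'' : X → ℝ := truncKernel k (2 * ε) N x with hK''
  have hmK' : AEStronglyMeasurable K' μ :=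
    ((hk.measurable_truncKernel hb0 N).comp measurable_prodMk_left).aestronglyMeasurable
  have hmK'' : AEStronglyMeasurable K'' μ :=
    ((hk.measurable_truncKernel (by positivity : 0 < 2 * ε) N).comp
      measurable_prodMk_left).aestronglyMeasurable
  have iK' : Integrable K' μ := hk.integrable_truncKernel hμ hb0 hbN x'
  have iK'' : Integrable K'' μ := hk.integrable_truncKernel hμ (by positivity) (by linarith) x
  have iK'f : Integrable (fun y => K' y * f y) μ :=
    hf.bdd_mul hmK' (Eventually.of_forall fun y => hk.abs_truncKernel_le hb0 _ x' y)
  have iK''f : Integrable (fun y => K'' y * f y) μ :=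
    hf.bdd_mul hmK'' (Eventually.of_forall fun y => hk.abs_truncKernel_le (by positivity) _ x y)
  have iK'g : Integrable (fun y => K' y * (f y - c)) μ := by
    simp_rw [mul_sub]; exact iK'f.sub (iK'.mul_const c)
  have iK''g : Integrable (fun y => K'' y * (f y - c)) μ := by
    simp_rw [mul_sub]; exact iK''f.sub (iK''.mul_const c)
  -- Both kernels integrate to zero, so the constant `c` may be subtracted from `f`.
  have e1 : ∫ y, K' y * f y ∂μ = ∫ y, K' y * (f y - c) ∂μ := by
    simp_rw [mul_sub]
    rw [integral_sub iK'f (iK'.mul_const c), integral_mul_const,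
      hk.integral_truncKernel hμ hb0 hbN x', zero_mul, sub_zero]
  have e2 : ∫ y, K'' y * f y ∂μ = ∫ y, K'' y * (f y - c) ∂μ := by
    simp_rw [mul_sub]
    rw [integral_sub iK''f (iK''.mul_const c), integral_mul_const,
      hk.integral_truncKernel hμ (by positivity) (by linarith) x, zero_mul, sub_zero]
  have hmd : Measurable fun y => dist x y := (continuous_const.dist continuous_id).measurable
  have hms : MeasurableSet {y | 2 * ε < dist x y} := measurableSet_lt measurable_const hmd
  have hms' : MeasurableSet {y | 2 * ε ≤ dist x y} := measurableSet_le measurable_const hmd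
  have e3 : ∫ y in {y | 2 * ε < dist x y}, k x y * f y ∂μ = ∫ y, K'' y * f y ∂μ := by
    rw [← integral_indicator hms]
    refine integral_congr_ae ?_
    have h0 : ∀ᵐ y ∂μ, ¬ dist x y = 2 * ε := by
      rw [ae_iff]; simpa using hμ.sphere x (2 * ε)
    filter_upwards [h0, hL] with y hy hLy
    by_cases h : y ∈ {y | 2 * ε < dist x y}
    · rw [indicator_of_mem h]
      have h3 : 2 * ε < dist x y := h
      by_cases h' : dist x y < N
      · rw [hK'', truncKernel_of_mem ⟨h3.le, h'⟩]
      · rw [hLy (by linarith), mul_zero, mul_zero]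
    · rw [indicator_of_notMem h, hK'', truncKernel_of_notMem, zero_mul]
      rintro ⟨h1, -⟩
      exact h (lt_of_le_of_ne h1 (Ne.symm hy))
  have iK'U : Integrable (fun y => K' y * U.indicator (fun y => f y - c) y) μ := by
    have : (fun y => K' y * U.indicator (fun y => f y - c) y) =
        U.indicator fun y => K' y * (f y - c) := by
      ext y; by_cases h : y ∈ U <;> simp [h]
    rw [this]; exact iK'g.indicator measurableSet_ball
  have e4 : (∫ y, K' y * f y ∂μ) - ∫ y in {y | 2 * ε < dist x y}, k x y * f y ∂μ =
      (∫ y, K' y * U.indicator (fun y => f y - c) y ∂μ) +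
      ∫ y, (Uᶜ.indicator (fun y => K' y * (f y - c)) y - K'' y * (f y - c)) ∂μ := by
    rw [e3, e1, e2, integral_sub (iK'g.indicator measurableSet_ball.compl) iK''g, ← add_sub_assoc,
      ← integral_add iK'U (iK'g.indicator measurableSet_ball.compl)]
    congr 2
    ext y
    by_cases h : y ∈ U
    · rw [indicator_of_mem h, indicator_of_notMem (notMem_compl_iff.2 h), add_zero]
    · rw [indicator_of_notMem h, indicator_of_mem (mem_compl h), mul_zero, zero_add]
  rw [e4]
  refine (enorm_add_le _ _).trans ?_
  gcongr
  refine (enorm_integral_le_lintegral_enorm _).trans ?_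
  let S : Set X := {y | N - ε ≤ dist x y ∧ dist x y < N + ε}
  have hmS : MeasurableSet S := measurableSet_annulus x _ _
  have hpt : ∀ᵐ y ∂μ, ‖Uᶜ.indicator (fun y => K' y * (f y - c)) y - K'' y * (f y - c)‖ₑ ≤
      {y | 2 * ε ≤ dist x y}.indicator
        (fun y => ENNReal.ofReal (B * (ε / dist x y ^ (Q + 1))) * ‖f y - c‖ₑ) y +
      S.indicator (fun _ => ENNReal.ofReal (A / (N / 2) ^ Q) * ‖c‖ₑ) y := by
    filter_upwards [hL] with y hLy
    by_cases h : 2 * ε ≤ dist x y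
    · have hyU : y ∈ Uᶜ := by
        simp only [hU, mem_compl_iff, Metric.mem_ball, not_lt, dist_comm y x]; exact h
      have t1 := dist_triangle x x' y
      have t2 := dist_triangle x' x y
      rw [dist_comm x' x] at t2
      rw [indicator_of_mem hyU, indicator_of_mem (by exact h), ← sub_mul, enorm_mul]
      -- A point inside only one of the two spheres of radius `N` is in the shell `S`, where `f`
      -- vanishes.
      have hedge : ∀ r : ℝ, |r| ≤ A / (N / 2) ^ Q → N - ε ≤ dist x y → dist x y < N + ε →
          ‖r‖ₑ * ‖f y - c‖ₑ ≤ ENNReal.ofReal (B * (ε / dist x y ^ (Q + 1))) * ‖f y - c‖ₑ +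
            S.indicator (fun _ => ENNReal.ofReal (A / (N / 2) ^ Q) * ‖c‖ₑ) y := by
        intro r hr h1 h2
        have hyS : y ∈ S := ⟨h1, h2⟩
        rw [indicator_of_mem hyS, hLy (by linarith), zero_sub, enorm_neg]
        refine le_trans ?_ le_add_self
        gcongr
        rw [Real.enorm_eq_ofReal_abs]
        exact ENNReal.ofReal_le_ofReal hr
      by_cases h1 : dist x' y < N <;> by_cases h2 : dist x y < N
      · rw [hK', hK'', truncKernel_of_mem ⟨by linarith, h1⟩, truncKernel_of_mem ⟨h, h2⟩]
        refine le_add_right ?_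
        gcongr
        rw [Real.enorm_eq_ofReal_abs]
        refine ENNReal.ofReal_le_ofReal ((hk.smooth_left x x' y (by linarith)).trans ?_)
        gcongr
      · rw [hK', hK'', truncKernel_of_mem ⟨by linarith, h1⟩,
          truncKernel_of_notMem fun h' => h2 h'.2, sub_zero]
        exact hedge _ (hk.abs_le_of_le_dist (by positivity) (by linarith)) (by linarith)
          (by linarith)
      · rw [hK', hK'', truncKernel_of_mem ⟨h, h2⟩,
          truncKernel_of_notMem fun h' => h1 h'.2, zero_sub]
        refine hedge _ ?_ (by linarith) (by linarith)
        rw [abs_neg]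
        exact hk.abs_le_of_le_dist (by positivity) (by linarith)
      · rw [hK', hK'', truncKernel_of_notMem fun h' => h1 h'.2,
          truncKernel_of_notMem fun h' => h2 h'.2]
        simp
    · have hyU : y ∉ Uᶜ := by
        simp only [hU, mem_compl_iff, Metric.mem_ball, not_not, dist_comm y x]
        exact not_le.1 h
      rw [indicator_of_notMem hyU, hK'', truncKernel_of_notMem fun h' => h h'.1]
      simp
  refine (lintegral_mono_ae hpt).trans ?_
  rw [lintegral_add_right _ (measurable_const.indicator hmS), lintegral_indicator hms',
    lintegral_indicator hmS, setLIntegral_const]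
  refine add_le_add le_rfl ?_
  rw [mul_right_comm, edgeConst, ENNReal.ofReal_mul (by positivity)]
  gcongr
  have := hμ.shell_le x (a := N - ε) (b := N + ε) (c := 2 * N) (by linarith) (by linarith)
    (by linarith)
  refine this.trans (ENNReal.ofReal_le_ofReal (le_of_eq ?_))
  ring

/-- The far part of the comparison, summed over dyadic annuli. -/
lemma lintegral_far_le (hμ : BallGrowth μ Q v) (hB : 0 ≤ B) {g : X → ℝ} {x : X} {ε : ℝ}
    (hε : 0 < ε) {a : ℕ → ℝ≥0∞}
    (ha : ∀ j : ℕ, ∫⁻ y in Metric.ball x (2 ^ j * ε), ‖g y‖ₑ ∂μ ≤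
      a j * ENNReal.ofReal (v * (2 ^ j * ε) ^ Q)) :
    ∫⁻ y in {y | 2 * ε ≤ dist x y}, ENNReal.ofReal (B * (ε / dist x y ^ (Q + 1))) * ‖g y‖ₑ ∂μ ≤
      ENNReal.ofReal (B * v * 2 ^ Q) * ∑' j : ℕ, a (j + 2) * ENNReal.ofReal ((1 / 2) ^ (j + 1)) := by
  have hv := hμ.pos
  -- The dyadic annuli about `x` which cover the complement of the doubled ball.
  let E : ℕ → Set X := fun j => {y | 2 ^ (j + 1) * ε ≤ dist x y ∧ dist x y < 2 ^ (j + 2) * ε}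
  have hE : {y | 2 * ε ≤ dist x y} ⊆ ⋃ j, E j := by
    intro y (hy : 2 * ε ≤ dist x y)
    have h1 : 1 ≤ dist x y / (2 * ε) := by rwa [le_div_iff₀ (by positivity), one_mul]
    obtain ⟨n, hn1, hn2⟩ := exists_nat_pow_near h1 (by norm_num : (1 : ℝ) < 2)
    rw [le_div_iff₀ (by positivity)] at hn1
    rw [div_lt_iff₀ (by positivity)] at hn2
    refine mem_iUnion.2 ⟨n, ?_, ?_⟩
    · rw [pow_succ]; linarith
    · rw [pow_succ]; linarith
  calc ∫⁻ y in {y | 2 * ε ≤ dist x y}, ENNReal.ofReal (B * (ε / dist x y ^ (Q + 1))) * ‖g y‖ₑ ∂μ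
      ≤ ∫⁻ y in ⋃ j, E j, ENNReal.ofReal (B * (ε / dist x y ^ (Q + 1))) * ‖g y‖ₑ ∂μ :=
        lintegral_mono_set hE
    _ ≤ ∑' j, ∫⁻ y in E j, ENNReal.ofReal (B * (ε / dist x y ^ (Q + 1))) * ‖g y‖ₑ ∂μ :=
        lintegral_iUnion_le _ _
    _ ≤ ∑' j, ENNReal.ofReal (B * v * 2 ^ Q) *
          (a (j + 2) * ENNReal.ofReal ((1 / 2) ^ (j + 1))) := by
        refine ENNReal.tsum_le_tsum fun j => ?_
        have hpos : 0 < (2 : ℝ) ^ (j + 1) * ε := by positivity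
        calc ∫⁻ y in E j, ENNReal.ofReal (B * (ε / dist x y ^ (Q + 1))) * ‖g y‖ₑ ∂μ
            ≤ ∫⁻ y in E j, ENNReal.ofReal (B * (ε / (2 ^ (j + 1) * ε) ^ (Q + 1))) * ‖g y‖ₑ ∂μ := by
              refine setLIntegral_mono' (measurableSet_annulus x _ _) fun y hy => ?_
              have := hy.1
              gcongr
          _ = ENNReal.ofReal (B * (ε / (2 ^ (j + 1) * ε) ^ (Q + 1))) * ∫⁻ y in E j, ‖g y‖ₑ ∂μ :=
              lintegral_const_mul' _ _ ENNReal.ofReal_ne_top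
          _ ≤ ENNReal.ofReal (B * (ε / (2 ^ (j + 1) * ε) ^ (Q + 1))) *
                (a (j + 2) * ENNReal.ofReal (v * (2 ^ (j + 2) * ε) ^ Q)) := by
              gcongr
              refine le_trans (lintegral_mono_set fun y hy => ?_) (ha (j + 2))
              rw [Metric.mem_ball, dist_comm]; exact hy.2
          _ = ENNReal.ofReal (B * v * 2 ^ Q) *
                (a (j + 2) * ENNReal.ofReal ((1 / 2) ^ (j + 1))) := by
              rw [mul_left_comm, mul_left_comm (ENNReal.ofReal (B * v * 2 ^ Q)),
                ← ENNReal.ofReal_mul (by positivity), ← ENNReal.ofReal_mul (by positivity)]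
              congr 2
              have : (2 : ℝ) ^ (j + 2) * ε = 2 * (2 ^ (j + 1) * ε) := by ring
              rw [this, mul_pow 2, pow_succ _ Q, one_div, inv_pow]
              field_simp
    _ = _ := ENNReal.tsum_mul_left

/-- On a ball, the limit `F` of the truncated integrals of `f` is close in mean to the integral of
`k(x, ·) f` over the complement of the doubled ball about its centre. -/
lemma setLIntegral_sub_tail_le [SFinite μ] (hk : StandardKernel μ Q k A B) (hμ : BallGrowth μ Q v)
    {Γ : ℝ} (hΓ : ∀ g, MemLp g 2 μ → ∀ n : ℕ,
      MemLp (fun x => ∫ y, truncKernel k (2 ^ (-n : ℤ)) (2 ^ n) x y * g y ∂μ) 2 μ ∧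
        eLpNorm (fun x => ∫ y, truncKernel k (2 ^ (-n : ℤ)) (2 ^ n) x y * g y ∂μ) 2 μ ≤
          ENNReal.ofReal Γ * eLpNorm g 2 μ)
    {f F : X → ℝ} (hf : Integrable f μ) (hf2 : MemLp f 2 μ) (hF2 : MemLp F 2 μ) {z : X} {R : ℝ}
    (hsupp : ∀ᵐ y ∂μ, y ∉ Metric.ball z R → f y = 0)
    (hF : Tendsto (fun n : ℕ => eLpNorm
        (fun x => ∫ y, truncKernel k (2 ^ (-n : ℤ)) (2 ^ n) x y * f y ∂μ - F x) 2 μ) atTop (𝓝 0))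
    {x : X} {ε c : ℝ} (hε : 0 < ε) {a : ℕ → ℝ≥0∞}
    (ha : ∀ j : ℕ, ∫⁻ y in Metric.ball x (2 ^ j * ε), ‖f y - c‖ₑ ∂μ ≤
      a j * ENNReal.ofReal (v * (2 ^ j * ε) ^ Q)) :
    ∫⁻ x' in Metric.ball x ε, ‖F x' - ∫ y in {y | 2 * ε < dist x y}, k x y * f y ∂μ‖ₑ ∂μ ≤
      μ (Metric.ball x ε) ^ (1 / 2 : ℝ) * (ENNReal.ofReal Γ *
        (∫⁻ y in Metric.ball x (2 * ε), ‖f y - c‖ₑ ^ 2 ∂μ) ^ (1 / 2 : ℝ)) +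
      ENNReal.ofReal (B * v * 2 ^ Q) * (∑' j : ℕ, a (j + 2) * ENNReal.ofReal ((1 / 2) ^ (j + 1))) *
        μ (Metric.ball x ε) := by
  set t := ∫ y in {y | 2 * ε < dist x y}, k x y * f y ∂μ with ht
  set U := Metric.ball x (2 * ε) with hU
  set P := Metric.ball x ε with hP
  have hPtop : μ P ≠ ⊤ := hμ.ball_ne_top x ε
  set far := ENNReal.ofReal (B * v * 2 ^ Q) *
    (∑' j : ℕ, a (j + 2) * ENNReal.ofReal ((1 / 2) ^ (j + 1))) with hfar
  let S : ℕ → (X → ℝ) → X → ℝ := fun n g x =>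
    ∫ y, truncKernel k (2 ^ (-n : ℤ)) (2 ^ n) x y * g y ∂μ
  set g := U.indicator fun y => f y - c with hg
  have hg2 : MemLp g 2 μ := by
    have : g = U.indicator f - U.indicator fun _ => c := by
      ext y; by_cases h : y ∈ U <;> simp [hg, h]
    rw [this]
    exact (hf2.indicator measurableSet_ball).sub
      (memLp_indicator_const 2 measurableSet_ball c (Or.inr (hμ.ball_ne_top x _)))
  have hgnorm : eLpNorm g 2 μ = (∫⁻ y in U, ‖f y - c‖ₑ ^ 2 ∂μ) ^ (1 / 2 : ℝ) := by
    rw [hg, eLpNorm_indicator_eq_eLpNorm_restrict measurableSet_ball, ← eLpNorm_two_sq,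
      ← ENNReal.rpow_natCast, ← ENNReal.rpow_mul]
    norm_num [hU]
  rw [← hgnorm]
  have hlim : Tendsto (fun n : ℕ => μ P ^ (1 / 2 : ℝ) * eLpNorm (fun x => S n f x - F x) 2 μ +
      (μ P ^ (1 / 2 : ℝ) * (ENNReal.ofReal Γ * eLpNorm g 2 μ) +
        (far + ENNReal.ofReal (edgeConst Q v A ε n) * ‖c‖ₑ) * μ P)) atTop
      (𝓝 (μ P ^ (1 / 2 : ℝ) * 0 + (μ P ^ (1 / 2 : ℝ) * (ENNReal.ofReal Γ * eLpNorm g 2 μ) +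
        (far + ENNReal.ofReal 0 * ‖c‖ₑ) * μ P))) := by
    have h1 : μ P ^ (1 / 2 : ℝ) ≠ ⊤ := ENNReal.rpow_ne_top_of_nonneg (by norm_num) hPtop
    have h2 := ENNReal.tendsto_ofReal (tendsto_edgeConst hμ A ε)
    refine (ENNReal.Tendsto.const_mul hF (Or.inr h1)).add (tendsto_const_nhds.add ?_)
    refine ENNReal.Tendsto.mul_const (tendsto_const_nhds.add ?_) (Or.inr hPtop)
    exact ENNReal.Tendsto.mul_const h2 (Or.inr enorm_ne_top)
  simp only [mul_zero, zero_add, ENNReal.ofReal_zero, zero_mul, add_zero] at hlim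
  refine ge_of_tendsto hlim ?_
  set L := R + dist x z with hL
  have hsuppL : ∀ᵐ y ∂μ, L ≤ dist x y → f y = 0 := by
    filter_upwards [hsupp] with y hy hLy
    refine hy fun h => ?_
    have := dist_triangle x z y
    rw [Metric.mem_ball, dist_comm] at h
    linarith
  have hev1 : ∀ᶠ n : ℕ in atTop, (2 : ℝ) ^ (-n : ℤ) ≤ ε := by
    have h := tendsto_pow_atTop_nhds_zero_of_lt_one (by norm_num : (0 : ℝ) ≤ 1 / 2) (by norm_num)
    filter_upwards [h.eventually_lt_const hε] with n hn
    rw [zpow_neg, zpow_natCast, ← inv_pow, ← one_div]; exact hn.le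
  have hev2 : ∀ᶠ n : ℕ in atTop, 4 * ε + 2 * |L| ≤ (2 : ℝ) ^ n :=
    (tendsto_pow_atTop_atTop_of_one_lt (by norm_num : (1 : ℝ) < 2)).eventually_ge_atTop _
  filter_upwards [hev1, hev2] with n hn1 hn2
  have hSf := (hΓ f hf2 n).1
  have hSg := hΓ g hg2 n
  calc ∫⁻ x' in P, ‖F x' - t‖ₑ ∂μ
      ≤ ∫⁻ x' in P, (‖S n f x' - F x'‖ₑ + (‖S n g x'‖ₑ +
          (far + ENNReal.ofReal (edgeConst Q v A ε n) * ‖c‖ₑ))) ∂μ := by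
        refine setLIntegral_mono' measurableSet_ball fun x' hx' => ?_
        have h1 : F x' - t = -(S n f x' - F x') + (S n f x' - t) := by ring
        rw [h1]
        refine (enorm_add_le _ _).trans ?_
        rw [enorm_neg]
        gcongr
        have hx'' : dist x x' < ε := by rw [dist_comm]; exact hx'
        refine (hk.enorm_trunc_sub_tail_le hμ hf (c := c) hε hx'' hsuppL hn1 hn2).trans ?_
        gcongr
        exact lintegral_far_le hμ hk.nonneg_smooth hε ha
    _ ≤ _ := by
        have hm1 : AEMeasurable (fun x => ‖S n f x - F x‖ₑ) (μ.restrict P) :=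
          (hSf.1.sub hF2.1).enorm.restrict
        rw [lintegral_add_left' hm1, lintegral_add_left' hSg.1.1.enorm.restrict, setLIntegral_const]
        gcongr
        · exact setLIntegral_enorm_le_eLpNorm (hSf.1.sub hF2.1) P
        · refine (setLIntegral_enorm_le_eLpNorm hSg.1.1 P).trans ?_
          gcongr
          exact hSg.2

end StandardKernel

end Comparison

/-! ### Almost everywhere existence of principal values -/

section PrincipalValue

open scoped ENNReal NNReal

variable {X : Type*} [MetricSpace X] [MeasurableSpace X] [BorelSpace X] [SecondCountableTopology X]
  {μ : Measure X} {Q : ℕ} {v : ℝ} {k : X → X → ℝ} {A B : ℝ}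

lemma BallGrowth.isUnifLocDoublingMeasure (hμ : BallGrowth μ Q v) : IsUnifLocDoublingMeasure μ := by
  have hv := hμ.pos
  refine ⟨⟨2 ^ Q, ?_⟩⟩
  filter_upwards [self_mem_nhdsWithin] with ε hε x
  have hε : 0 < ε := hε
  rw [hμ.closedBall x (by positivity), hμ.closedBall x hε.le, mul_pow]
  rw [show v * (2 ^ Q * ε ^ Q) = 2 ^ Q * (v * ε ^ Q) by ring, ENNReal.ofReal_mul (by positivity)]
  rw [ENNReal.ofReal_pow (by norm_num)]
  simp

lemma BallGrowth.isLocallyFiniteMeasure (hμ : BallGrowth μ Q v) : IsLocallyFiniteMeasure μ :=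
  ⟨fun x => ⟨Metric.ball x 1, Metric.ball_mem_nhds x one_pos, (hμ.ball_ne_top x 1).lt_top⟩⟩

/-- The limit `F` of the truncated integrals of `f`, together with the bounds it is built on. -/
structure IsL2Limit (μ : Measure X) (k : X → X → ℝ) (Γ : ℝ) (f F : X → ℝ) : Prop where
  pos : 0 < Γ
  bound : ∀ g, MemLp g 2 μ → ∀ n : ℕ,
      MemLp (fun x => ∫ y, truncKernel k (2 ^ (-n : ℤ)) (2 ^ n) x y * g y ∂μ) 2 μ ∧
        eLpNorm (fun x => ∫ y, truncKernel k (2 ^ (-n : ℤ)) (2 ^ n) x y * g y ∂μ) 2 μ ≤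
          ENNReal.ofReal Γ * eLpNorm g 2 μ
  memLp : MemLp F 2 μ
  tendsto : Tendsto (fun n : ℕ => eLpNorm
        (fun x => ∫ y, truncKernel k (2 ^ (-n : ℤ)) (2 ^ n) x y * f y ∂μ - F x) 2 μ) atTop (𝓝 0)

namespace StandardKernel

/-- The comparison of the limit with the tails when the oscillation of `f` is controlled by real
numbers: `b` bounds its mean square on the doubled ball, `a j` its mean on the ball of radius
`2 ^ j * ε`. -/
lemma setLIntegral_sub_tail_le_ofReal [SFinite μ] (hk : StandardKernel μ Q k A B)
    (hμ : BallGrowth μ Q v) {Γ : ℝ}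
    {f F : X → ℝ} (hF : IsL2Limit μ k Γ f F) (hf : Integrable f μ) (hf2 : MemLp f 2 μ)
    {z : X} {R : ℝ} (hsupp : ∀ᵐ y ∂μ, y ∉ Metric.ball z R → f y = 0)
    {x : X} {ε c b : ℝ} (hε : 0 < ε) (hb : 0 ≤ b)
    (hbb : ∫⁻ y in Metric.ball x (2 * ε), ‖f y - c‖ₑ ^ 2 ∂μ ≤
      ENNReal.ofReal (b * (v * (2 * ε) ^ Q)))
    {a : ℕ → ℝ} (ha0 : ∀ j, 0 ≤ a j)
    (ha : ∀ j : ℕ, ∫⁻ y in Metric.ball x (2 ^ j * ε), ‖f y - c‖ₑ ∂μ ≤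
      ENNReal.ofReal (a j * (v * (2 ^ j * ε) ^ Q)))
    (hs : Summable fun j => a (j + 2) * (1 / 2) ^ (j + 1)) :
    ∫⁻ x' in Metric.ball x ε, ‖F x' - ∫ y in {y | 2 * ε < dist x y}, k x y * f y ∂μ‖ₑ ∂μ ≤
      ENNReal.ofReal ((Γ * √(2 ^ Q * b) + B * v * 2 ^ Q * ∑' j, a (j + 2) * (1 / 2) ^ (j + 1)) *
        (v * ε ^ Q)) := by
  have hv := hμ.pos
  have hΓ := hF.pos
  have hB := hk.nonneg_smooth
  have h := hk.setLIntegral_sub_tail_le hμ hF.bound hf hf2 hF.memLp hsupp hF.tendsto (c := c) hε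
    (a := fun j => ENNReal.ofReal (a j)) (fun j => by
      rw [← ENNReal.ofReal_mul (ha0 j)]; exact ha j)
  refine h.trans ?_
  have hts : ∑' j : ℕ, ENNReal.ofReal (a (j + 2)) * ENNReal.ofReal ((1 / 2) ^ (j + 1)) =
      ENNReal.ofReal (∑' j, a (j + 2) * (1 / 2) ^ (j + 1)) := by
    rw [ENNReal.ofReal_tsum_of_nonneg (fun j => mul_nonneg (ha0 _) (by positivity)) hs]
    refine tsum_congr fun j => ?_
    rw [ENNReal.ofReal_mul (ha0 _)]
  have hts0 : 0 ≤ ∑' j, a (j + 2) * (1 / 2 : ℝ) ^ (j + 1) :=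
    tsum_nonneg fun j => mul_nonneg (ha0 _) (by positivity)
  rw [hts, hμ.ball x ε hε, add_mul, ENNReal.ofReal_add (by positivity) (by positivity),
    ENNReal.ofReal_mul (by positivity) (q := v * ε ^ Q),
    ENNReal.ofReal_mul (by positivity) (q := v * ε ^ Q),
    ENNReal.ofReal_mul (p := B * v * 2 ^ Q) (by positivity)]
  refine add_le_add ?_ le_rfl
  calc ENNReal.ofReal (v * ε ^ Q) ^ (1 / 2 : ℝ) * (ENNReal.ofReal Γ *
        (∫⁻ y in Metric.ball x (2 * ε), ‖f y - c‖ₑ ^ 2 ∂μ) ^ (1 / 2 : ℝ))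
      ≤ ENNReal.ofReal (v * ε ^ Q) ^ (1 / 2 : ℝ) * (ENNReal.ofReal Γ *
        (ENNReal.ofReal (b * (v * (2 * ε) ^ Q))) ^ (1 / 2 : ℝ)) := by gcongr
    _ = ENNReal.ofReal (√(v * ε ^ Q) * (Γ * √(b * (v * (2 * ε) ^ Q)))) := by
        rw [ENNReal.ofReal_rpow_of_nonneg (by positivity) (by positivity),
          ENNReal.ofReal_rpow_of_nonneg (by positivity) (by positivity),
          ← ENNReal.ofReal_mul (by positivity), ← ENNReal.ofReal_mul (by positivity),
          ← Real.sqrt_eq_rpow, ← Real.sqrt_eq_rpow]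
    _ = ENNReal.ofReal (Γ * √(2 ^ Q * b) * (v * ε ^ Q)) := by
        congr 1
        have e : b * (v * (2 * ε) ^ Q) = 2 ^ Q * b * (v * ε ^ Q) := by rw [mul_pow]; ring
        rw [e, Real.sqrt_mul (by positivity : 0 ≤ 2 ^ Q * b)]
        have := Real.mul_self_sqrt (by positivity : 0 ≤ v * ε ^ Q)
        linear_combination Γ * √(2 ^ Q * b) * this
    _ = ENNReal.ofReal (Γ * √(2 ^ Q * b)) * ENNReal.ofReal (v * ε ^ Q) :=
        ENNReal.ofReal_mul (by positivity)

/-- At almost every point the integrals over the complements of small balls converge to the `L²`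
limit: compare them with the means of the limit, subtracting the value of `f` at a point which is a
Lebesgue point of `f`, of `f ^ 2` and of the limit. -/
theorem ae_tendsto_tail (hk : StandardKernel μ Q k A B)
    (hμ : BallGrowth μ Q v) {Γ : ℝ}
    {f F : X → ℝ} (hF : IsL2Limit μ k Γ f F) (hf : Integrable f μ) (hf2 : MemLp f 2 μ)
    {z : X} {R : ℝ} (hsupp : ∀ᵐ y ∂μ, y ∉ Metric.ball z R → f y = 0) :
    ∀ᵐ x ∂μ, Tendsto (fun ε : ℝ => ∫ y in {y | ε < dist x y}, k x y * f y ∂μ) (𝓝[>] 0)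
      (𝓝 (F x)) := by
  have := hμ.isUnifLocDoublingMeasure
  have := hμ.isLocallyFiniteMeasure
  have hv := hμ.pos
  have hΓ := hF.pos
  have hB := hk.nonneg_smooth
  have hFl : LocallyIntegrable F μ := hF.memLp.locallyIntegrable one_le_two
  have hf2l : Integrable (fun x => f x ^ 2) μ := hf2.integrable_sq
  filter_upwards [IsUnifLocDoublingMeasure.ae_tendsto_average_norm_sub μ hFl 1,
    IsUnifLocDoublingMeasure.ae_tendsto_average_norm_sub μ hf.locallyIntegrable 1,
    IsUnifLocDoublingMeasure.ae_tendsto_average μ hf.locallyIntegrable 1,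
    IsUnifLocDoublingMeasure.ae_tendsto_average μ hf2l.locallyIntegrable 1] with x h1 h2 h3 h4
  have hin : ∀ᶠ δ : ℝ in 𝓝[>] 0, x ∈ Metric.closedBall x (1 * δ) := by
    filter_upwards [self_mem_nhdsWithin] with δ hδ
    have : 0 < δ := hδ
    exact Metric.mem_closedBall_self (by linarith)
  replace h1 := h1 (fun _ => x) id tendsto_id hin
  replace h2 := h2 (fun _ => x) id tendsto_id hin
  replace h3 := h3 (fun _ => x) id tendsto_id hin
  replace h4 := h4 (fun _ => x) id tendsto_id hin
  simp only [id] at h1 h2 h3 h4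
  have hcb : ∀ {δ : ℝ}, 0 < δ → μ.real (Metric.closedBall x δ) = v * δ ^ Q := by
    intro δ hδ
    rw [measureReal_def, hμ.closedBall x hδ.le, ENNReal.toReal_ofReal (by positivity)]
  set κ : ℝ → ℝ := fun δ => ⨍ y in Metric.closedBall x δ, ‖F y - F x‖ ∂μ with hκ
  set α : ℝ → ℝ := fun δ => ⨍ y in Metric.closedBall x δ, ‖f y - f x‖ ∂μ with hα
  set β : ℝ → ℝ := fun δ => ⨍ y in Metric.closedBall x δ, (f y - f x) ^ 2 ∂μ with hβ
  have hcbt : ∀ δ, IsFiniteMeasure (μ.restrict (Metric.closedBall x δ)) := by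
    intro δ
    refine ⟨?_⟩
    rw [Measure.restrict_apply_univ]
    exact (measure_mono (Metric.closedBall_subset_ball (lt_add_one δ))).trans_lt
      (hμ.ball_ne_top x _).lt_top
  -- the means over closed balls as bounds on open balls
  have havg : ∀ (g : X → ℝ) {δ : ℝ}, 0 < δ → (∀ y, 0 ≤ g y) →
      IntegrableOn g (Metric.closedBall x δ) μ →
      ∫⁻ y in Metric.ball x δ, ‖g y‖ₑ ∂μ ≤
        ENNReal.ofReal ((⨍ y in Metric.closedBall x δ, g y ∂μ) * (v * δ ^ Q)) := by
    intro g δ hδ hg hgi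
    refine (lintegral_mono_set Metric.ball_subset_closedBall).trans_eq ?_
    rw [setAverage_eq, hcb hδ, smul_eq_mul, mul_comm, mul_inv_cancel_left₀ (by positivity),
      ofReal_integral_eq_lintegral_ofReal hgi (Eventually.of_forall hg)]
    refine lintegral_congr fun y => ?_
    rw [Real.enorm_eq_ofReal (hg y)]
  have hfi : ∀ δ, IntegrableOn (fun y => ‖f y - f x‖) (Metric.closedBall x δ) μ := fun δ =>
    (hf.integrableOn.sub (integrable_const _)).norm
  have hfi2 : ∀ δ, IntegrableOn (fun y => (f y - f x) ^ 2) (Metric.closedBall x δ) μ := fun δ =>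
    ((hf2.restrict _).sub (memLp_const _)).integrable_sq
  have hFi : ∀ δ, IntegrableOn (fun y => ‖F y - F x‖) (Metric.closedBall x δ) μ := fun δ =>
    (((hF.memLp.restrict _).integrable one_le_two).sub (integrable_const _)).norm
  -- The square is expanded, since Lebesgue points are available for `f` and `f ^ 2` only.
  have hβeq : ∀ {δ : ℝ}, 0 < δ → β δ = (⨍ y in Metric.closedBall x δ, f y ^ 2 ∂μ) -
      2 * f x * (⨍ y in Metric.closedBall x δ, f y ∂μ) + f x ^ 2 := by
    intro δ hδ
    have hd : v * δ ^ Q ≠ 0 := by positivity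
    simp only [hβ, setAverage_eq, hcb hδ, smul_eq_mul]
    have e : ∫ y in Metric.closedBall x δ, (f y - f x) ^ 2 ∂μ =
        ∫ y in Metric.closedBall x δ, f y ^ 2 ∂μ -
          2 * f x * ∫ y in Metric.closedBall x δ, f y ∂μ + f x ^ 2 * (v * δ ^ Q) := by
      have : ∀ y, (f y - f x) ^ 2 = f y ^ 2 - 2 * f x * f y + f x ^ 2 := fun y => by ring
      simp_rw [this]
      have i1 : IntegrableOn (fun y => f y ^ 2 - 2 * f x * f y) (Metric.closedBall x δ) μ :=
        hf2l.integrableOn.sub (hf.integrableOn.const_mul _)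
      rw [integral_add i1 (integrable_const _),
        integral_sub hf2l.integrableOn (hf.integrableOn.const_mul _), integral_const_mul,
        integral_const, measureReal_restrict_apply_univ, hcb hδ, smul_eq_mul]
      ring
    rw [e]
    field_simp
  have hβlim : Tendsto β (𝓝[>] 0) (𝓝 0) := by
    have : Tendsto (fun δ : ℝ => (⨍ y in Metric.closedBall x δ, f y ^ 2 ∂μ) -
      2 * f x * (⨍ y in Metric.closedBall x δ, f y ∂μ) + f x ^ 2) (𝓝[>] 0)
        (𝓝 (f x ^ 2 - 2 * f x * f x + f x ^ 2)) := (h4.sub (h3.const_mul _)).add_const _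
    have e0 : f x ^ 2 - 2 * f x * f x + f x ^ 2 = 0 := by ring
    rw [e0] at this
    refine this.congr' ?_
    filter_upwards [self_mem_nhdsWithin] with δ hδ
    exact (hβeq hδ).symm
  have hα0 : ∀ δ, 0 ≤ α δ := fun δ => by
    simp only [hα, setAverage_eq, smul_eq_mul]
    exact mul_nonneg (inv_nonneg.2 measureReal_nonneg) (integral_nonneg fun y => norm_nonneg _)
  have hβ0 : ∀ δ, 0 ≤ β δ := fun δ => by
    simp only [hβ, setAverage_eq, smul_eq_mul]
    exact mul_nonneg (inv_nonneg.2 measureReal_nonneg) (integral_nonneg fun y => sq_nonneg _)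
  have hκ0 : ∀ δ, 0 ≤ κ δ := fun δ => by
    simp only [hκ, setAverage_eq, smul_eq_mul]
    exact mul_nonneg (inv_nonneg.2 measureReal_nonneg) (integral_nonneg fun y => norm_nonneg _)
  -- The means `α δ` are bounded: for small `δ` by convergence at the Lebesgue point, for large `δ`
  -- by the integrability of `f`.
  obtain ⟨M, hM⟩ : ∃ M, ∀ δ, 0 < δ → α δ ≤ M := by
    obtain ⟨δ₀, hδ₀, hsmall⟩ := mem_nhdsGT_iff_exists_Ioo_subset.1
      (h2.eventually_lt_const one_pos)
    have hδ₀ : 0 < δ₀ := hδ₀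
    refine ⟨max 1 ((∫ y, ‖f y‖ ∂μ) / (v * δ₀ ^ Q) + |f x|), fun δ hδ => ?_⟩
    rcases lt_or_ge δ δ₀ with h | h
    · exact (hsmall ⟨hδ, h⟩ : α δ < 1).le.trans (le_max_left _ _)
    · refine le_trans ?_ (le_max_right _ _)
      simp only [hα, setAverage_eq, hcb hδ, smul_eq_mul]
      have hle : ∫ y in Metric.closedBall x δ, ‖f y - f x‖ ∂μ ≤
          (∫ y, ‖f y‖ ∂μ) + |f x| * (v * δ ^ Q) := by
        calc ∫ y in Metric.closedBall x δ, ‖f y - f x‖ ∂μ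
            ≤ ∫ y in Metric.closedBall x δ, (‖f y‖ + |f x|) ∂μ := by
              refine integral_mono (hfi δ) (hf.integrableOn.norm.add (integrable_const _)) ?_
              exact fun y => norm_sub_le _ _
          _ = (∫ y in Metric.closedBall x δ, ‖f y‖ ∂μ) + |f x| * (v * δ ^ Q) := by
              rw [integral_add hf.integrableOn.norm (integrable_const _), integral_const,
                measureReal_restrict_apply_univ, hcb hδ, smul_eq_mul, mul_comm |f x|]
          _ ≤ _ := add_le_add (setIntegral_le_integral hf.norm
              (Eventually.of_forall fun _ => norm_nonneg _)) le_rfl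
      have hint : 0 ≤ ∫ y, ‖f y‖ ∂μ := integral_nonneg fun y => norm_nonneg _
      calc (v * δ ^ Q)⁻¹ * ∫ y in Metric.closedBall x δ, ‖f y - f x‖ ∂μ
          ≤ (v * δ ^ Q)⁻¹ * ((∫ y, ‖f y‖ ∂μ) + |f x| * (v * δ ^ Q)) := by gcongr
        _ = (∫ y, ‖f y‖ ∂μ) / (v * δ ^ Q) + |f x| := by field_simp
        _ ≤ (∫ y, ‖f y‖ ∂μ) / (v * δ₀ ^ Q) + |f x| := by gcongr
  have hgeo : Summable fun j : ℕ => M * (1 / 2 : ℝ) ^ (j + 1) :=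
    ((summable_nat_add_iff 1).2 (summable_geometric_of_lt_one (by norm_num)
      (by norm_num : (1 / 2 : ℝ) < 1))).mul_left M
  have hscale : ∀ j : ℕ, Tendsto (fun ε : ℝ => 2 ^ j * ε) (𝓝[>] 0) (𝓝[>] 0) := by
    intro j
    refine tendsto_nhdsWithin_iff.2 ⟨?_, ?_⟩
    · have : Continuous fun ε : ℝ => 2 ^ j * ε := by fun_prop
      simpa using (this.tendsto 0).mono_left nhdsWithin_le_nhds
    · filter_upwards [self_mem_nhdsWithin] with ε hε
      have : 0 < ε := hε
      exact (by positivity : 0 < 2 ^ j * ε)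
  set far : ℝ → ℝ := fun ε => ∑' j : ℕ, α (2 ^ (j + 2) * ε) * (1 / 2) ^ (j + 1) with hfar
  have hfarsum : ∀ ε, 0 < ε →
      Summable fun j : ℕ => α (2 ^ (j + 2) * ε) * (1 / 2 : ℝ) ^ (j + 1) := by
    intro ε hε
    refine Summable.of_nonneg_of_le (fun j => mul_nonneg (hα0 _) (by positivity)) (fun j => ?_) hgeo
    gcongr
    exact hM _ (by positivity)
  -- Each term of the series tends to zero with `ε`, and the series is dominated by a geometric one.
  have hfarlim : Tendsto far (𝓝[>] 0) (𝓝 0) := by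
    have := tendsto_tsum_of_dominated_convergence (𝓕 := 𝓝[>] (0 : ℝ))
      (f := fun (ε : ℝ) (j : ℕ) => α (2 ^ (j + 2) * ε) * (1 / 2 : ℝ) ^ (j + 1))
      (g := fun _ => 0) hgeo (fun j => by simpa using (h2.comp (hscale (j + 2))).mul_const ((1 / 2 : ℝ) ^ (j + 1))) (by
        filter_upwards [self_mem_nhdsWithin] with ε hε j
        have hε : 0 < ε := hε
        rw [Real.norm_of_nonneg (mul_nonneg (hα0 _) (by positivity))]
        gcongr
        exact hM _ (by positivity))
    rw [tsum_zero] at this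
    exact this
  -- the comparison at scale `ε`
  have hmain : ∀ ε, 0 < ε → ‖F x - ∫ y in {y | 2 * ε < dist x y}, k x y * f y ∂μ‖ ≤
      κ ε + (Γ * √(2 ^ Q * β (2 * ε)) + B * v * 2 ^ Q * far ε) := by
    intro ε hε
    set t := ∫ y in {y | 2 * ε < dist x y}, k x y * f y ∂μ with ht
    have hcmp := hk.setLIntegral_sub_tail_le_ofReal hμ hF hf hf2 hsupp (x := x) (c := f x) hε
      (hβ0 (2 * ε)) (by
        have := havg (fun y => (f y - f x) ^ 2) (δ := 2 * ε) (by positivity)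
          (fun y => sq_nonneg _) (hfi2 _)
        simpa [enorm_pow] using this) (a := fun j => α (2 ^ j * ε)) (fun j => hα0 _) (fun j => by
        have := havg (fun y => ‖f y - f x‖) (δ := 2 ^ j * ε) (by positivity)
          (fun y => norm_nonneg _) (hfi _)
        simp only [enorm_norm] at this
        exact this) (hfarsum ε hε)
    have hκe := havg (fun y => ‖F y - F x‖) hε (fun y => norm_nonneg _) (hFi ε)
    have hfar0 : 0 ≤ far ε := tsum_nonneg fun j => mul_nonneg (hα0 _) (by positivity)
    have hpos : 0 < v * ε ^ Q := by positivity
    have hFm : AEMeasurable (fun y => ‖F y - F x‖ₑ) (μ.restrict (Metric.ball x ε)) :=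
      (hF.memLp.1.sub aestronglyMeasurable_const).enorm.restrict
    have h5 : ENNReal.ofReal (‖F x - t‖ * (v * ε ^ Q)) ≤
        ENNReal.ofReal ((κ ε + (Γ * √(2 ^ Q * β (2 * ε)) + B * v * 2 ^ Q * far ε)) *
          (v * ε ^ Q)) := by
      rw [add_mul, ENNReal.ofReal_add (mul_nonneg (hκ0 ε) hpos.le) (by positivity),
        ENNReal.ofReal_mul (norm_nonneg _), ← hμ.ball x ε hε, ofReal_norm, ← setLIntegral_const]
      calc ∫⁻ _ in Metric.ball x ε, ‖F x - t‖ₑ ∂μ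
          ≤ ∫⁻ y in Metric.ball x ε, (‖F y - F x‖ₑ + ‖F y - t‖ₑ) ∂μ := by
            refine lintegral_mono fun y => ?_
            have : F x - t = -(F y - F x) + (F y - t) := by ring
            rw [this]
            refine (enorm_add_le _ _).trans ?_
            rw [enorm_neg]
        _ ≤ _ := by
            rw [lintegral_add_left' hFm]
            refine add_le_add ?_ hcmp
            simp only [enorm_norm] at hκe
            exact hκe
    rw [ENNReal.ofReal_le_ofReal_iff (by have := hκ0 ε; positivity)] at h5
    exact le_of_mul_le_mul_right h5 hpos
  have hlim : Tendsto (fun ε : ℝ => κ ε + (Γ * √(2 ^ Q * β (2 * ε)) + B * v * 2 ^ Q * far ε))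
      (𝓝[>] 0) (𝓝 0) := by
    have hb : Tendsto (fun ε : ℝ => √(2 ^ Q * β (2 * ε))) (𝓝[>] 0) (𝓝 0) := by
      have h6 : Tendsto (fun ε : ℝ => β (2 * ε)) (𝓝[>] 0) (𝓝 0) := by
        simpa [Function.comp_def] using hβlim.comp (hscale 1)
      have h7 := (Real.continuous_sqrt.tendsto _).comp (h6.const_mul (2 ^ Q : ℝ))
      rwa [mul_zero, Real.sqrt_zero] at h7
    simpa using h1.add ((hb.const_mul Γ).add (hfarlim.const_mul (B * v * 2 ^ Q)))
  have hhalf : Tendsto (fun ε : ℝ => ε / 2) (𝓝[>] 0) (𝓝[>] 0) := by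
    refine tendsto_nhdsWithin_iff.2 ⟨?_, ?_⟩
    · have : Continuous fun ε : ℝ => ε / 2 := by fun_prop
      simpa using (this.tendsto 0).mono_left nhdsWithin_le_nhds
    · filter_upwards [self_mem_nhdsWithin] with ε hε
      have : 0 < ε := hε
      exact (by positivity : 0 < ε / 2)
  rw [tendsto_iff_norm_sub_tendsto_zero]
  refine squeeze_zero' (Eventually.of_forall fun _ => norm_nonneg _) ?_ (hlim.comp hhalf)
  filter_upwards [self_mem_nhdsWithin] with ε hε
  have hε : 0 < ε := hε
  have := hmain (ε / 2) (by positivity)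
  rw [norm_sub_rev]
  simpa [mul_div_cancel₀] using this

end StandardKernel

end PrincipalValue

/-! ### Mean oscillation in `L¹` and in `L²` -/

section JohnNirenberg

open scoped ENNReal NNReal

variable {X : Type*} [MetricSpace X] [MeasurableSpace X] [BorelSpace X] [SecondCountableTopology X]
  {μ : Measure X} {Q : ℕ} {v : ℝ}

/-- The values of a locally integrable function at almost every point are bounded by `l` if the
point is the centre of balls of radius `2⁻ᵏ r` for all `k` on which the mean is at most `l`. -/
lemma BallGrowth.ae_enorm_le_of_mean_le (hμ : BallGrowth μ Q v) {g : X → ℝ}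
    (hg : LocallyIntegrable g μ) {r l : ℝ} (hr : 0 < r) (hl : 0 ≤ l) :
    ∀ᵐ x ∂μ, (∀ k : ℕ, ∫⁻ y in Metric.ball x ((1 / 2) ^ k * r), ‖g y‖ₑ ∂μ ≤
      ENNReal.ofReal (l * (v * ((1 / 2) ^ k * r) ^ Q))) → ‖g x‖ₑ ≤ ENNReal.ofReal l := by
  have := hμ.isUnifLocDoublingMeasure
  have := hμ.isLocallyFiniteMeasure
  have hv := hμ.pos
  have hδ : Tendsto (fun k : ℕ => (1 / 2 : ℝ) ^ k * r) atTop (𝓝[>] 0) := by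
    refine tendsto_nhdsWithin_iff.2 ⟨?_, Eventually.of_forall fun k => ?_⟩
    · simpa using (tendsto_pow_atTop_nhds_zero_of_lt_one (by norm_num : (0 : ℝ) ≤ 1 / 2)
        (by norm_num)).mul_const r
    · exact (by positivity : 0 < (1 / 2 : ℝ) ^ k * r)
  have hgn : LocallyIntegrable (fun y => ‖g y‖) μ :=
    hg.mono hg.aestronglyMeasurable.norm (Eventually.of_forall fun y => by simp)
  filter_upwards [IsUnifLocDoublingMeasure.ae_tendsto_average μ hgn 1] with x hx hk
  have h1 := hx (fun _ => x) _ hδ (Eventually.of_forall fun k =>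
    Metric.mem_closedBall_self (by positivity))
  rw [← ofReal_norm]
  refine ENNReal.ofReal_le_ofReal (le_of_tendsto h1 (Eventually.of_forall fun k => ?_))
  have hpos : 0 < (1 / 2 : ℝ) ^ k * r := by positivity
  set δ := (1 / 2 : ℝ) ^ k * r with hδdef
  have hae : Metric.closedBall x δ =ᵐ[μ] Metric.ball x δ := by
    refine (ae_eq_of_subset_of_measure_ge Metric.ball_subset_closedBall ?_
      measurableSet_ball.nullMeasurableSet ?_).symm
    · rw [hμ.closedBall x hpos.le, hμ.ball x δ hpos]
    · rw [hμ.closedBall x hpos.le]; exact ENNReal.ofReal_ne_top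
  have h2 := ENNReal.toReal_mono ENNReal.ofReal_ne_top (hk k)
  rw [ENNReal.toReal_ofReal (by positivity)] at h2
  have h3 : ∫ y in Metric.ball x δ, ‖g y‖ ∂μ =
      (∫⁻ y in Metric.ball x δ, ‖g y‖ₑ ∂μ).toReal := by
    rw [integral_norm_eq_lintegral_enorm hg.aestronglyMeasurable.restrict]
  rw [setAverage_eq, setIntegral_congr_set hae, measureReal_congr hae, hμ.real_ball x hpos,
    smul_eq_mul, h3, inv_mul_le_iff₀ (by positivity)]
  linarith

/-- The ratio of the stopping height to the mean oscillation. -/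
noncomputable def stopConst (Q : ℕ) : ℝ := 12 * 16 ^ Q

/-- One step of the passage from mean oscillation in `L¹` to `L²`.  The function is stopped at the
height `l = stopConst Q * m`; the points where the maximal mean exceeds `l` are covered by balls of
small total measure, on which the bound `A` that is assumed is used. -/
lemma BallGrowth.lintegral_sq_step (hμ : BallGrowth μ Q v) {f : X → ℝ}
    (hf : LocallyIntegrable f μ) {m A ρ₀ : ℝ} (hm : 0 < m) (hA : 0 ≤ A)
    (hAb : ∀ z ρ, 0 < ρ → 2 * ρ ≤ ρ₀ → ∃ c, ∫⁻ y in Metric.ball z ρ, ‖f y - c‖ₑ ^ 2 ∂μ ≤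
      ENNReal.ofReal (A * (v * ρ ^ Q)))
    {z : X} {r c : ℝ} (hr : 0 < r) (hrρ : 2 * r ≤ ρ₀)
    (hc : ∫⁻ y in Metric.ball z (2 * r), ‖f y - c‖ₑ ∂μ ≤ ENNReal.ofReal (m * (v * (2 * r) ^ Q))) :
    ∫⁻ y in Metric.ball z r, ‖f y - c‖ₑ ^ 2 ∂μ ≤
      ENNReal.ofReal ((A / 2 + 2 * (stopConst Q * m) ^ 2) * (v * r ^ Q)) := by
  classical
  have := hμ.isLocallyFiniteMeasure
  have hv := hμ.pos
  set l := stopConst Q * m with hl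
  have hS : 0 < stopConst Q := by unfold stopConst; positivity
  have hl0 : 0 < l := by positivity
  have hgl : LocallyIntegrable (fun y => f y - c) μ := hf.sub (locallyIntegrable_const c)
  have hgm : AEMeasurable (fun y => ‖f y - c‖ₑ) μ := hgl.aestronglyMeasurable.enorm
  let ρ : ℕ → ℝ := fun k => (1 / 2) ^ k * r
  have hρ0 : ∀ k, 0 < ρ k := fun k => by positivity
  have hρr : ∀ k, ρ k ≤ r := fun k => by
    have : (1 / 2 : ℝ) ^ k ≤ 1 := pow_le_one₀ (by norm_num) (by norm_num)
    exact mul_le_of_le_one_left hr.le this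
  let Good : X → ℕ → Prop := fun x k => ∫⁻ y in Metric.ball x (ρ k), ‖f y - c‖ₑ ∂μ ≤
    ENNReal.ofReal (l * (v * ρ k ^ Q))
  -- The points at which the stopping height is exceeded at some scale; `κ` is the first such scale.
  let E : Set X := {x | x ∈ Metric.ball z r ∧ ∃ k, ¬ Good x k}
  let κ : X → ℕ := fun x => if h : ∃ k, ¬ Good x k then Nat.find h else 0
  have hκbad : ∀ x ∈ E, ¬ Good x (κ x) := by
    intro x hx
    simp only [κ, dif_pos hx.2]
    exact Nat.find_spec hx.2
  have hκgood : ∀ x ∈ E, ∀ j < κ x, Good x j := by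
    intro x hx j hj
    simp only [κ, dif_pos hx.2] at hj
    exact not_not.1 (Nat.find_min hx.2 hj)
  have hsub : ∀ x ∈ Metric.ball z r, ∀ k, Metric.ball x (ρ k) ⊆ Metric.ball z (2 * r) := by
    intro x hx k
    refine Metric.ball_subset_ball' ?_
    have : dist x z < r := hx
    linarith [hρr k]
  -- The mean over `B(z, 2 r)` is so much smaller than `l` that no ball of radius at least `r / 4`
  -- can be bad. Hence the ball enlarged eight times is one of the good balls about the same centre.
  have hκ3 : ∀ x ∈ E, 3 ≤ κ x := by
    intro x hx
    by_contra! hlt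
    refine hκbad x hx ?_
    refine (lintegral_mono_set (hsub x hx.1 _)).trans (hc.trans (ENNReal.ofReal_le_ofReal ?_))
    set k := κ x with hk
    have h1 : (1 / 8 : ℝ) ≤ (1 / 2) ^ k * (1 / 2) := by
      have : (1 / 2 : ℝ) ^ 2 ≤ (1 / 2) ^ k :=
        pow_le_pow_of_le_one (by norm_num) (by norm_num) (by omega)
      linarith
    have h2 : (2 * r) ^ Q ≤ 16 ^ Q * ρ k ^ Q := by
      rw [← mul_pow]
      refine pow_le_pow_left₀ (by positivity) ?_ _
      change 2 * r ≤ 16 * ((1 / 2) ^ k * r)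
      nlinarith
    calc m * (v * (2 * r) ^ Q) ≤ m * (v * (16 ^ Q * ρ k ^ Q)) := by gcongr
      _ ≤ l * (v * ρ k ^ Q) := by
          rw [hl, stopConst]
          have : 0 ≤ m * (v * (16 ^ Q * ρ k ^ Q)) := by have := hρ0 k; positivity
          nlinarith
  obtain ⟨u, huE, hud, hucov⟩ :=
    Vitali.exists_disjoint_subfamily_covering_enlargement_closedBall E id (fun x => ρ (κ x)) r
      (fun x _ => hρr _) 5 (by norm_num)
  have hud' : u.PairwiseDisjoint fun x => Metric.ball x (ρ (κ x)) :=
    hud.mono fun x => Metric.ball_subset_closedBall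
  have huc : u.Countable := hud'.countable_of_isOpen (fun x _ => Metric.isOpen_ball)
    fun x _ => ⟨x, Metric.mem_ball_self (hρ0 _)⟩
  let W : Set X := ⋃ b ∈ u, Metric.ball b (8 * ρ (κ b))
  have hWm : MeasurableSet W := MeasurableSet.biUnion huc fun b _ => measurableSet_ball
  have hEW : E ⊆ W := by
    intro x hx
    obtain ⟨b, hb, hsubb⟩ := hucov x hx
    refine mem_biUnion hb ?_
    have : x ∈ Metric.closedBall b (5 * ρ (κ b)) :=
      hsubb (Metric.mem_closedBall_self (hρ0 _).le)
    exact Metric.closedBall_subset_ball (by linarith [hρ0 (κ b)]) this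
  -- the part where the function is at most `l`
  have hpart1 : ∫⁻ y in Metric.ball z r \ W, ‖f y - c‖ₑ ^ 2 ∂μ ≤
      ENNReal.ofReal (l ^ 2 * (v * r ^ Q)) := by
    calc ∫⁻ y in Metric.ball z r \ W, ‖f y - c‖ₑ ^ 2 ∂μ
        ≤ ∫⁻ _ in Metric.ball z r \ W, ENNReal.ofReal l ^ 2 ∂μ := by
          refine setLIntegral_mono_ae' (measurableSet_ball.diff hWm) ?_
          filter_upwards [hμ.ae_enorm_le_of_mean_le hgl hr hl0.le] with x hx hxs
          gcongr
          refine hx fun k => ?_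
          by_contra hbad
          exact hxs.2 (hEW ⟨hxs.1, k, hbad⟩)
      _ ≤ ENNReal.ofReal l ^ 2 * μ (Metric.ball z r) := by
          rw [setLIntegral_const]
          gcongr
          exact sdiff_subset
      _ = _ := by
          rw [hμ.ball z r hr, ← ENNReal.ofReal_pow hl0.le, ← ENNReal.ofReal_mul (by positivity)]
  -- one of the balls of the cover
  have hball : ∀ b ∈ u, ∫⁻ y in Metric.ball b (8 * ρ (κ b)), ‖f y - c‖ₑ ^ 2 ∂μ ≤
      ENNReal.ofReal ((6 * A + 4 * l ^ 2) * 8 ^ Q) * μ (Metric.ball b (ρ (κ b))) := by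
    intro b hb
    have hbE := huE hb
    have h3 := hκ3 b hbE
    set ρ' := 8 * ρ (κ b) with hρ'
    have hρ'0 : 0 < ρ' := by have := hρ0 (κ b); positivity
    have hρ'eq : ρ' = ρ (κ b - 3) := by
      obtain ⟨j, hj⟩ : ∃ j, κ b = j + 3 := ⟨κ b - 3, by omega⟩
      rw [hρ', hj, Nat.add_sub_cancel]
      simp only [ρ]
      ring
    have hρ'r : ρ' ≤ r := hρ'eq ▸ hρr _
    have hgood : ∫⁻ y in Metric.ball b ρ', ‖f y - c‖ₑ ∂μ ≤ ENNReal.ofReal (l * (v * ρ' ^ Q)) := by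
      rw [hρ'eq]; exact hκgood b hbE _ (by omega)
    obtain ⟨cb, hcb⟩ := hAb b ρ' hρ'0 (by linarith)
    set P := Metric.ball b ρ' with hP
    have hμP : μ P = ENNReal.ofReal (v * ρ' ^ Q) := hμ.ball b ρ' hρ'0
    have hpos : 0 < v * ρ' ^ Q := by positivity
    have hgbm : AEMeasurable (fun y => ‖f y - cb‖ₑ) (μ.restrict P) :=
      (hf.sub (locallyIntegrable_const cb)).aestronglyMeasurable.enorm.restrict
    have hL1 : ∫⁻ y in P, ‖f y - cb‖ₑ ∂μ ≤ ENNReal.ofReal (√A * (v * ρ' ^ Q)) := by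
      rw [← ENNReal.pow_le_pow_left_iff two_ne_zero]
      refine (lintegral_sq_le (μ.restrict P) hgbm).trans ?_
      rw [Measure.restrict_apply_univ, hμP, ← ENNReal.ofReal_pow (by positivity),
        mul_pow √A, Real.sq_sqrt hA]
      calc ENNReal.ofReal (v * ρ' ^ Q) * ∫⁻ y in P, ‖f y - cb‖ₑ ^ 2 ∂μ
          ≤ ENNReal.ofReal (v * ρ' ^ Q) * ENNReal.ofReal (A * (v * ρ' ^ Q)) := by gcongr
        _ = _ := by rw [← ENNReal.ofReal_mul hpos.le]; congr 1; ring
    -- The constants `cb` and `c` are compared through the mean over the good ball `P`.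
    have hcc : |cb - c| ≤ √A + l := by
      have h4 : ENNReal.ofReal (|cb - c| * (v * ρ' ^ Q)) ≤
          ENNReal.ofReal ((√A + l) * (v * ρ' ^ Q)) := by
        rw [add_mul, ENNReal.ofReal_add (by positivity) (by positivity),
          ENNReal.ofReal_mul (abs_nonneg _), ← hμP, ← Real.enorm_eq_ofReal_abs,
          ← setLIntegral_const]
        calc ∫⁻ _ in P, ‖cb - c‖ₑ ∂μ ≤ ∫⁻ y in P, (‖f y - cb‖ₑ + ‖f y - c‖ₑ) ∂μ := by
              refine lintegral_mono fun y => ?_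
              have : cb - c = (f y - c) - (f y - cb) := by ring
              rw [this, add_comm]
              exact enorm_sub_le
          _ ≤ _ := by
              rw [lintegral_add_left' hgbm]
              exact add_le_add hL1 hgood
      rw [ENNReal.ofReal_le_ofReal_iff (by positivity)] at h4
      exact le_of_mul_le_mul_right h4 hpos
    have hsq : ∀ y, ‖f y - c‖ₑ ^ 2 ≤ 2 * ‖f y - cb‖ₑ ^ 2 +
        ENNReal.ofReal (2 * (√A + l) ^ 2) := by
      intro y
      rw [Real.enorm_eq_ofReal_abs, Real.enorm_eq_ofReal_abs, ← ENNReal.ofReal_pow (abs_nonneg _),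
        ← ENNReal.ofReal_pow (abs_nonneg _), show (2 : ℝ≥0∞) = ENNReal.ofReal 2 by simp,
        ← ENNReal.ofReal_mul (by norm_num), ← ENNReal.ofReal_add (by positivity) (by positivity)]
      refine ENNReal.ofReal_le_ofReal ?_
      rw [sq_abs, sq_abs]
      have h5 : (cb - c) ^ 2 ≤ (√A + l) ^ 2 := sq_le_sq' (by linarith [neg_abs_le (cb - c)])
        ((le_abs_self _).trans hcc)
      nlinarith [sq_nonneg ((f y - cb) - (cb - c))]
    calc ∫⁻ y in P, ‖f y - c‖ₑ ^ 2 ∂μ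
        ≤ ∫⁻ y in P, (2 * ‖f y - cb‖ₑ ^ 2 + ENNReal.ofReal (2 * (√A + l) ^ 2)) ∂μ :=
          lintegral_mono hsq
      _ ≤ 2 * ENNReal.ofReal (A * (v * ρ' ^ Q)) +
          ENNReal.ofReal (2 * (√A + l) ^ 2) * ENNReal.ofReal (v * ρ' ^ Q) := by
          rw [lintegral_add_right' _ aemeasurable_const, lintegral_const_mul' _ _ (by norm_num),
            setLIntegral_const, hμP]
          gcongr
      _ ≤ ENNReal.ofReal ((6 * A + 4 * l ^ 2) * (v * ρ' ^ Q)) := by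
          rw [show (2 : ℝ≥0∞) = ENNReal.ofReal 2 by simp, ← ENNReal.ofReal_mul (by norm_num),
            ← ENNReal.ofReal_mul (by positivity), ← ENNReal.ofReal_add (by positivity)
              (by positivity)]
          refine ENNReal.ofReal_le_ofReal ?_
          have h6 : (√A + l) ^ 2 ≤ 2 * A + 2 * l ^ 2 := by
            nlinarith [Real.sq_sqrt hA, sq_nonneg (√A - l)]
          nlinarith
      _ = _ := by
          rw [hμ.ball b _ (hρ0 _), ← ENNReal.ofReal_mul (by positivity), hρ', mul_pow]
          congr 1
          ring
  -- the total measure of the cover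
  have htotal : ENNReal.ofReal l * ∑' b : u, μ (Metric.ball (b : X) (ρ (κ b))) ≤
      ENNReal.ofReal (m * (v * (2 * r) ^ Q)) := by
    have : Countable u := huc.to_subtype
    calc ENNReal.ofReal l * ∑' b : u, μ (Metric.ball (b : X) (ρ (κ b)))
        = ∑' b : u, ENNReal.ofReal l * μ (Metric.ball (b : X) (ρ (κ b))) :=
          ENNReal.tsum_mul_left.symm
      _ ≤ ∑' b : u, ∫⁻ y in Metric.ball (b : X) (ρ (κ b)), ‖f y - c‖ₑ ∂μ := by
          refine ENNReal.tsum_le_tsum fun b => ?_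
          rw [hμ.ball _ _ (hρ0 _), ← ENNReal.ofReal_mul hl0.le]
          exact (not_le.1 (hκbad b (huE b.2))).le
      _ = ∫⁻ y in ⋃ b ∈ u, Metric.ball b (ρ (κ b)), ‖f y - c‖ₑ ∂μ :=
          (lintegral_biUnion huc (fun b _ => measurableSet_ball) hud' _).symm
      _ ≤ ∫⁻ y in Metric.ball z (2 * r), ‖f y - c‖ₑ ∂μ :=
          lintegral_mono_set (iUnion₂_subset fun b hb => hsub b (huE hb).1 _)
      _ ≤ _ := hc
  have hpart2 : ∫⁻ y in W, ‖f y - c‖ₑ ^ 2 ∂μ ≤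
      ENNReal.ofReal ((A / 2 + l ^ 2 / 3) * (v * r ^ Q)) := by
    have : Countable u := huc.to_subtype
    have h7 : ∑' b : u, μ (Metric.ball (b : X) (ρ (κ b))) ≤
        ENNReal.ofReal (m / l * (v * (2 * r) ^ Q)) := by
      rw [div_mul_eq_mul_div, ENNReal.ofReal_div_of_pos hl0]
      rw [ENNReal.le_div_iff_mul_le (Or.inl (by simpa using hl0)) (Or.inl ENNReal.ofReal_ne_top),
        mul_comm]
      exact htotal
    calc ∫⁻ y in W, ‖f y - c‖ₑ ^ 2 ∂μ
        = ∫⁻ y in ⋃ b : u, Metric.ball (b : X) (8 * ρ (κ b)), ‖f y - c‖ₑ ^ 2 ∂μ := by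
          simp only [W, biUnion_eq_iUnion]
      _ ≤ ∑' b : u, ∫⁻ y in Metric.ball (b : X) (8 * ρ (κ b)), ‖f y - c‖ₑ ^ 2 ∂μ :=
          lintegral_iUnion_le _ _
      _ ≤ ∑' b : u, ENNReal.ofReal ((6 * A + 4 * l ^ 2) * 8 ^ Q) *
            μ (Metric.ball (b : X) (ρ (κ b))) :=
          ENNReal.tsum_le_tsum fun b => hball b b.2
      _ ≤ ENNReal.ofReal ((6 * A + 4 * l ^ 2) * 8 ^ Q) *
            ENNReal.ofReal (m / l * (v * (2 * r) ^ Q)) := by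
          rw [ENNReal.tsum_mul_left]; gcongr
      _ = _ := by
          rw [← ENNReal.ofReal_mul (by positivity)]
          congr 1
          -- The stopping height is chosen so that the enlargement of the balls is paid for: the
          -- coefficient of `A` becomes `6 / 12`.
          have : m / l = 1 / (12 * (8 ^ Q * 2 ^ Q)) := by
            rw [hl, stopConst, ← mul_pow]; norm_num; field_simp
          rw [this, mul_pow]
          field_simp
          ring
  calc ∫⁻ y in Metric.ball z r, ‖f y - c‖ₑ ^ 2 ∂μ
      ≤ ∫⁻ y in (Metric.ball z r \ W) ∪ W, ‖f y - c‖ₑ ^ 2 ∂μ := by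
        refine lintegral_mono_set ?_
        rw [sdiff_union_self]
        exact subset_union_left
    _ ≤ ENNReal.ofReal (l ^ 2 * (v * r ^ Q)) +
        ENNReal.ofReal ((A / 2 + l ^ 2 / 3) * (v * r ^ Q)) :=
        (lintegral_union_le _ _ _).trans (add_le_add hpart1 hpart2)
    _ ≤ _ := by
        rw [← ENNReal.ofReal_add (by positivity) (by positivity)]
        refine ENNReal.ofReal_le_ofReal ?_
        have h8 : 0 ≤ l ^ 2 * (v * r ^ Q) := by positivity
        nlinarith

/-- Bounded functions of bounded mean oscillation: the step is iterated, which halves the a priori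
bound each time. -/
lemma BallGrowth.lintegral_sq_le_of_bounded (hμ : BallGrowth μ Q v) {f : X → ℝ}
    (hf : LocallyIntegrable f μ) {m ρ₀ N : ℝ} (hm : 0 < m) (hN : ∀ y, |f y| ≤ N)
    (hosc : ∀ z ρ, 0 < ρ → ρ ≤ ρ₀ → ∃ c, ∫⁻ y in Metric.ball z ρ, ‖f y - c‖ₑ ∂μ ≤
      ENNReal.ofReal (m * (v * ρ ^ Q)))
    {z : X} {r c : ℝ} (hr : 0 < r) (hrρ : 2 * r ≤ ρ₀)
    (hc : ∫⁻ y in Metric.ball z (2 * r), ‖f y - c‖ₑ ∂μ ≤ ENNReal.ofReal (m * (v * (2 * r) ^ Q))) :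
    ∫⁻ y in Metric.ball z r, ‖f y - c‖ₑ ^ 2 ∂μ ≤
      ENNReal.ofReal (4 * (stopConst Q * m) ^ 2 * (v * r ^ Q)) := by
  have hv := hμ.pos
  set l := stopConst Q * m with hl
  let A : ℕ → ℝ := fun n => N ^ 2 * (1 / 2) ^ n + 4 * l ^ 2
  have hA0 : ∀ n, 0 ≤ A n := fun n => by positivity
  have hstep : ∀ n, A n / 2 + 2 * l ^ 2 = A (n + 1) := fun n => by simp only [A]; ring
  have hind : ∀ n z ρ, 0 < ρ → 2 * ρ ≤ ρ₀ → ∃ c, ∫⁻ y in Metric.ball z ρ, ‖f y - c‖ₑ ^ 2 ∂μ ≤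
      ENNReal.ofReal (A n * (v * ρ ^ Q)) := by
    intro n
    induction n with
    | zero =>
      intro z ρ hρ _
      refine ⟨0, ?_⟩
      calc ∫⁻ y in Metric.ball z ρ, ‖f y - 0‖ₑ ^ 2 ∂μ
          ≤ ∫⁻ _ in Metric.ball z ρ, ENNReal.ofReal (N ^ 2) ∂μ := by
            refine lintegral_mono fun y => ?_
            rw [sub_zero, Real.enorm_eq_ofReal_abs, ← ENNReal.ofReal_pow (abs_nonneg _)]
            have := hN y
            gcongr
        _ = ENNReal.ofReal (N ^ 2 * (v * ρ ^ Q)) := by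
            rw [setLIntegral_const, hμ.ball z ρ hρ, ← ENNReal.ofReal_mul (by positivity)]
        _ ≤ _ := by
            refine ENNReal.ofReal_le_ofReal ?_
            have : N ^ 2 ≤ A 0 := by simp only [A, pow_zero, mul_one]; nlinarith [sq_nonneg l]
            gcongr
    | succ n ih =>
      intro z ρ hρ hρ2
      obtain ⟨c, hc⟩ := hosc z (2 * ρ) (by positivity) hρ2
      refine ⟨c, ?_⟩
      rw [← hstep]
      exact hμ.lintegral_sq_step hf hm (hA0 n) ih hρ hρ2 hc
  have hlim : Tendsto (fun n => ENNReal.ofReal (A (n + 1) * (v * r ^ Q))) atTop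
      (𝓝 (ENNReal.ofReal (4 * l ^ 2 * (v * r ^ Q)))) := by
    refine ENNReal.tendsto_ofReal (Tendsto.mul_const _ ?_)
    have h1 := (tendsto_add_atTop_iff_nat 1).2 (tendsto_pow_atTop_nhds_zero_of_lt_one
      (by norm_num : (0 : ℝ) ≤ 1 / 2) (by norm_num))
    have h2 := (h1.const_mul (N ^ 2)).add_const (4 * l ^ 2)
    rw [mul_zero, zero_add] at h2
    exact h2
  refine ge_of_tendsto hlim (Eventually.of_forall fun n => ?_)
  rw [← hstep]
  exact hμ.lintegral_sq_step hf hm (hA0 n) (hind n) hr hrρ hc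

/-- **John–Nirenberg inequality**, in the `L²` form: bounds for the mean oscillation over all balls
up to a given radius imply bounds in `L²`. -/
theorem BallGrowth.lintegral_sq_le (hμ : BallGrowth μ Q v) {f : X → ℝ}
    (hf : LocallyIntegrable f μ) {m ρ₀ : ℝ} (hm : 0 < m)
    (hosc : ∀ z ρ, 0 < ρ → ρ ≤ ρ₀ → ∃ c, ∫⁻ y in Metric.ball z ρ, ‖f y - c‖ₑ ∂μ ≤
      ENNReal.ofReal (m * (v * ρ ^ Q)))
    {z : X} {r c : ℝ} (hr : 0 < r) (hrρ : 2 * r ≤ ρ₀)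
    (hc : ∫⁻ y in Metric.ball z (2 * r), ‖f y - c‖ₑ ∂μ ≤ ENNReal.ofReal (m * (v * (2 * r) ^ Q))) :
    ∫⁻ y in Metric.ball z r, ‖f y - c‖ₑ ^ 2 ∂μ ≤
      ENNReal.ofReal (4 * (stopConst Q * m) ^ 2 * (v * r ^ Q)) := by
  let φ : ℕ → ℝ → ℝ := fun n t => max (min t n) (-n)
  have hφc : ∀ n, Continuous (φ n) := fun n => by fun_prop
  have hφabs : ∀ n t, |φ n t| ≤ n := by
    intro n t
    have : (0 : ℝ) ≤ n := n.cast_nonneg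
    exact abs_le.2 ⟨le_max_right _ _, max_le (min_le_right _ _) (by linarith)⟩
  have hφlip : ∀ n s t, |φ n s - φ n t| ≤ |s - t| := fun n s t =>
    (abs_max_sub_max_le_abs _ _ _).trans (by
      have := abs_min_sub_min_le_max s n t n
      simpa using this)
  have hφev : ∀ t, ∀ᶠ n in atTop, φ n t = t := by
    intro t
    obtain ⟨n₀, hn₀⟩ := exists_nat_ge |t|
    filter_upwards [eventually_ge_atTop n₀] with n hn
    have h1 : |t| ≤ n := hn₀.trans (Nat.cast_le.2 hn)
    have h2 := abs_le.1 h1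
    simp only [φ]
    rw [min_eq_left h2.2, max_eq_left h2.1]
  have hφ0 : ∀ n, φ n 0 = 0 := fun n => by
    have : (0 : ℝ) ≤ n := n.cast_nonneg
    simp only [φ]
    rw [min_eq_left this, max_eq_left (by linarith)]
  have hφl : ∀ n, LocallyIntegrable (fun y => φ n (f y)) μ := fun n =>
    hf.mono ((hφc n).comp_aestronglyMeasurable hf.aestronglyMeasurable)
      (Eventually.of_forall fun y => by
        have := hφlip n (f y) 0
        rwa [hφ0, sub_zero, sub_zero] at this)
  have hmono : ∀ n (z : X) ρ c, ∫⁻ y in Metric.ball z ρ, ‖φ n (f y) - φ n c‖ₑ ∂μ ≤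
      ∫⁻ y in Metric.ball z ρ, ‖f y - c‖ₑ ∂μ := fun n z ρ c =>
    lintegral_mono fun y => by
      rw [Real.enorm_eq_ofReal_abs, Real.enorm_eq_ofReal_abs]
      exact ENNReal.ofReal_le_ofReal (hφlip n _ _)
  have hbd : ∀ n, ∫⁻ y in Metric.ball z r, ‖φ n (f y) - φ n c‖ₑ ^ 2 ∂μ ≤
      ENNReal.ofReal (4 * (stopConst Q * m) ^ 2 * (v * r ^ Q)) := fun n =>
    hμ.lintegral_sq_le_of_bounded (hφl n) hm (fun y => hφabs n _)
      (fun z ρ h1 h2 => by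
        obtain ⟨c, hc⟩ := hosc z ρ h1 h2
        exact ⟨φ n c, (hmono n z ρ c).trans hc⟩) hr hrρ ((hmono n z (2 * r) c).trans hc)
  have hev : ∀ y, liminf (fun n => ‖φ n (f y) - φ n c‖ₑ ^ 2) atTop = ‖f y - c‖ₑ ^ 2 := by
    intro y
    refine Tendsto.liminf_eq (tendsto_const_nhds.congr' ?_)
    filter_upwards [hφev (f y), hφev c] with n h1 h2
    rw [h1, h2]
  calc ∫⁻ y in Metric.ball z r, ‖f y - c‖ₑ ^ 2 ∂μ
      = ∫⁻ y in Metric.ball z r, liminf (fun n => ‖φ n (f y) - φ n c‖ₑ ^ 2) atTop ∂μ := by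
        simp_rw [hev]
    _ ≤ liminf (fun n => ∫⁻ y in Metric.ball z r, ‖φ n (f y) - φ n c‖ₑ ^ 2 ∂μ) atTop := by
        refine lintegral_liminf_le' fun n => AEMeasurable.pow_const ?_ 2
        exact (((hφl n).aestronglyMeasurable.sub aestronglyMeasurable_const).enorm).restrict
    _ ≤ _ := by
        refine liminf_le_of_frequently_le' (Frequently.of_forall hbd)

end JohnNirenberg

/-! ### Oscillation bounds for the limit operator -/

section Oscillation

open scoped ENNReal NNReal

variable {X : Type*} [MetricSpace X] [MeasurableSpace X] [BorelSpace X] [SecondCountableTopology X]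
  {μ : Measure X} {Q : ℕ} {v : ℝ}

/-- Oscillation bounds at all scales control the distance of `f` to its approximate mean on a
small ball over all larger concentric balls; the loss is geometric, and it is the ratio `7 / 4 < 2`
which makes the resulting series over dyadic scales converge. -/
lemma BallGrowth.lintegral_dyadic_le (hμ : BallGrowth μ Q v) {f : X → ℝ}
    (hf : LocallyIntegrable f μ) {M : ℝ} (hM : 0 < M) {ψ : ℝ → ℝ} (hψ0 : ∀ ρ, 0 < ρ → 0 < ψ ρ)
    (hψd : ∀ ρ, 0 < ρ → ψ (2 * ρ) ≤ 7 / 4 * ψ ρ)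
    (hosc : ∀ z ρ, 0 < ρ → ∃ c, ∫⁻ y in Metric.ball z ρ, ‖f y - c‖ₑ ∂μ ≤
      ENNReal.ofReal (M * ψ ρ * (v * ρ ^ Q))) (x : X) {r : ℝ} (hr : 0 < r) :
    ∃ c, ∀ j : ℕ, ∫⁻ y in Metric.ball x (2 ^ j * r), ‖f y - c‖ₑ ∂μ ≤
      ENNReal.ofReal ((7 / 3 * (1 + 2 ^ Q) + 1) * (7 / 4) ^ j * (M * ψ r) *
        (v * (2 ^ j * r) ^ Q)) := by
  have := hμ.isLocallyFiniteMeasure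
  have hv := hμ.pos
  have hρ0 : ∀ j : ℕ, 0 < 2 ^ j * r := fun j => by positivity
  choose c hc using fun j : ℕ => hosc x (2 ^ j * r) (hρ0 j)
  have hψr := hψ0 r hr
  have hψ : ∀ j : ℕ, ψ (2 ^ j * r) ≤ (7 / 4) ^ j * ψ r := by
    intro j
    induction j with
    | zero => simp
    | succ j ih =>
      calc ψ (2 ^ (j + 1) * r) = ψ (2 * (2 ^ j * r)) := by congr 1; ring
        _ ≤ 7 / 4 * ψ (2 ^ j * r) := hψd _ (hρ0 j)
        _ ≤ 7 / 4 * ((7 / 4) ^ j * ψ r) := by gcongr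
        _ = _ := by ring
  have hc' : ∀ j : ℕ, ∫⁻ y in Metric.ball x (2 ^ j * r), ‖f y - c j‖ₑ ∂μ ≤
      ENNReal.ofReal ((7 / 4) ^ j * (M * ψ r) * (v * (2 ^ j * r) ^ Q)) := by
    intro j
    refine (hc j).trans (ENNReal.ofReal_le_ofReal ?_)
    have h1 := hψ j
    have h2 : 0 ≤ v * (2 ^ j * r) ^ Q := by have := hρ0 j; positivity
    calc M * ψ (2 ^ j * r) * (v * (2 ^ j * r) ^ Q)
        ≤ M * ((7 / 4) ^ j * ψ r) * (v * (2 ^ j * r) ^ Q) := by gcongr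
      _ = _ := by ring
  have hmeas : ∀ (b : ℝ) (s : Set X), AEMeasurable (fun y => ‖f y - b‖ₑ) (μ.restrict s) :=
    fun b s => (hf.sub (locallyIntegrable_const b)).aestronglyMeasurable.enorm.restrict
  have hstep : ∀ j : ℕ, |c (j + 1) - c j| ≤ (1 + 2 ^ Q) * (7 / 4) ^ (j + 1) * (M * ψ r) := by
    intro j
    have hpos : 0 < v * (2 ^ j * r) ^ Q := by have := hρ0 j; positivity
    have hsub : Metric.ball x (2 ^ j * r) ⊆ Metric.ball x (2 ^ (j + 1) * r) :=
      Metric.ball_subset_ball (by rw [pow_succ]; nlinarith [hρ0 j])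
    have h1 : ENNReal.ofReal (|c (j + 1) - c j| * (v * (2 ^ j * r) ^ Q)) ≤
        ENNReal.ofReal ((1 + 2 ^ Q) * (7 / 4) ^ (j + 1) * (M * ψ r) * (v * (2 ^ j * r) ^ Q)) := by
      calc ENNReal.ofReal (|c (j + 1) - c j| * (v * (2 ^ j * r) ^ Q))
          = ∫⁻ _ in Metric.ball x (2 ^ j * r), ‖c (j + 1) - c j‖ₑ ∂μ := by
            rw [setLIntegral_const, hμ.ball x _ (hρ0 j), Real.enorm_eq_ofReal_abs,
              ← ENNReal.ofReal_mul (abs_nonneg _)]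
        _ ≤ ∫⁻ y in Metric.ball x (2 ^ j * r), (‖f y - c j‖ₑ + ‖f y - c (j + 1)‖ₑ) ∂μ := by
            refine lintegral_mono fun y => ?_
            have : c (j + 1) - c j = (f y - c j) - (f y - c (j + 1)) := by ring
            rw [this]
            exact enorm_sub_le
        _ = ∫⁻ y in Metric.ball x (2 ^ j * r), ‖f y - c j‖ₑ ∂μ +
              ∫⁻ y in Metric.ball x (2 ^ j * r), ‖f y - c (j + 1)‖ₑ ∂μ :=
            lintegral_add_left' (hmeas _ _) _
        _ ≤ ENNReal.ofReal ((7 / 4) ^ j * (M * ψ r) * (v * (2 ^ j * r) ^ Q)) +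
              ENNReal.ofReal ((7 / 4) ^ (j + 1) * (M * ψ r) * (v * (2 ^ (j + 1) * r) ^ Q)) :=
            add_le_add (hc' j) ((lintegral_mono_set hsub).trans (hc' (j + 1)))
        _ ≤ _ := by
            have := hρ0 (j + 1)
            rw [← ENNReal.ofReal_add (by positivity) (by positivity)]
            refine ENNReal.ofReal_le_ofReal ?_
            have h2 : (2 ^ (j + 1) * r) ^ Q = 2 ^ Q * (2 ^ j * r) ^ Q := by
              rw [← mul_pow]; ring
            have h3 : (7 / 4 : ℝ) ^ j ≤ (7 / 4) ^ (j + 1) :=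
              pow_le_pow_right₀ (by norm_num) (by omega)
            rw [h2]
            calc (7 / 4) ^ j * (M * ψ r) * (v * (2 ^ j * r) ^ Q) +
                  (7 / 4) ^ (j + 1) * (M * ψ r) * (v * (2 ^ Q * (2 ^ j * r) ^ Q))
                ≤ (7 / 4) ^ (j + 1) * (M * ψ r) * (v * (2 ^ j * r) ^ Q) +
                  (7 / 4) ^ (j + 1) * (M * ψ r) * (v * (2 ^ Q * (2 ^ j * r) ^ Q)) := by gcongr
              _ = _ := by ring
    rw [ENNReal.ofReal_le_ofReal_iff (by positivity)] at h1
    exact le_of_mul_le_mul_right h1 hpos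
  -- The constant `D = 7 / 3 * (1 + 2 ^ Q)` solves `D + 7 / 4 * (1 + 2 ^ Q) = 7 / 4 * D`, as the
  -- induction requires.
  have hdiff : ∀ j : ℕ, |c j - c 0| ≤ 7 / 3 * (1 + 2 ^ Q) * (7 / 4) ^ j * (M * ψ r) := by
    intro j
    induction j with
    | zero => rw [sub_self, abs_zero]; positivity
    | succ j ih =>
      have h1 := abs_sub_le (c (j + 1)) (c j) (c 0)
      have h2 := hstep j
      rw [pow_succ] at h2 ⊢
      linarith
  refine ⟨c 0, fun j => ?_⟩
  have hp := hρ0 j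
  calc ∫⁻ y in Metric.ball x (2 ^ j * r), ‖f y - c 0‖ₑ ∂μ
      ≤ ∫⁻ y in Metric.ball x (2 ^ j * r), (‖f y - c j‖ₑ + ‖c j - c 0‖ₑ) ∂μ := by
        refine lintegral_mono fun y => ?_
        have : f y - c 0 = (f y - c j) + (c j - c 0) := by ring
        rw [this]
        exact enorm_add_le _ _
    _ = ∫⁻ y in Metric.ball x (2 ^ j * r), ‖f y - c j‖ₑ ∂μ +
          ∫⁻ _ in Metric.ball x (2 ^ j * r), ‖c j - c 0‖ₑ ∂μ :=
        lintegral_add_left' (hmeas _ _) _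
    _ ≤ ENNReal.ofReal ((7 / 4) ^ j * (M * ψ r) * (v * (2 ^ j * r) ^ Q)) +
          ENNReal.ofReal (7 / 3 * (1 + 2 ^ Q) * (7 / 4) ^ j * (M * ψ r) *
            (v * (2 ^ j * r) ^ Q)) := by
        refine add_le_add (hc' j) ?_
        rw [setLIntegral_const, hμ.ball x _ hp, Real.enorm_eq_ofReal_abs,
          ← ENNReal.ofReal_mul (abs_nonneg _)]
        have := hdiff j
        gcongr
    _ = _ := by
        rw [← ENNReal.ofReal_add (by positivity) (by positivity)]
        congr 1
        ring

/-- A function vanishing off a ball whose oscillation is bounded on all balls is square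
integrable. -/
lemma BallGrowth.memLp_two_of_osc (hμ : BallGrowth μ Q v) {f : X → ℝ}
    (hf : LocallyIntegrable f μ) {m : ℝ} (hm : 0 < m) {z : X} {R : ℝ} (hR : 0 < R)
    (hsupp : ∀ᵐ y ∂μ, y ∉ Metric.ball z R → f y = 0)
    (hosc : ∀ x ρ, 0 < ρ → ρ ≤ 2 * R → ∃ c, ∫⁻ y in Metric.ball x ρ, ‖f y - c‖ₑ ∂μ ≤
      ENNReal.ofReal (m * (v * ρ ^ Q))) : MemLp f 2 μ := by
  have := hμ.isLocallyFiniteMeasure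
  obtain ⟨c, hc⟩ := hosc z (2 * R) (by positivity) le_rfl
  have h1 := hμ.lintegral_sq_le hf hm hosc hR le_rfl hc
  have hind : f =ᵐ[μ] (Metric.ball z R).indicator f := by
    filter_upwards [hsupp] with y hy
    by_cases h : y ∈ Metric.ball z R
    · rw [indicator_of_mem h]
    · rw [indicator_of_notMem h, hy h]
  rw [memLp_congr_ae hind, memLp_indicator_iff_restrict measurableSet_ball]
  have : Fact (μ (Metric.ball z R) < ⊤) := ⟨(hμ.ball_ne_top z R).lt_top⟩
  have h2 : MemLp (fun y => f y - c) 2 (μ.restrict (Metric.ball z R)) := by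
    refine ⟨(hf.sub (locallyIntegrable_const c)).aestronglyMeasurable.restrict, ?_⟩
    have h3 := eLpNorm_two_sq (μ := μ.restrict (Metric.ball z R)) (f := fun y => f y - c)
    have h4 : eLpNorm (fun y => f y - c) 2 (μ.restrict (Metric.ball z R)) ^ 2 < ⊤ := by
      rw [h3]; exact h1.trans_lt ENNReal.ofReal_lt_top
    exact (ENNReal.pow_lt_top_iff.1 h4).resolve_right two_ne_zero
  have h5 := h2.add (memLp_const c)
  refine (memLp_congr_ae (Eventually.of_forall fun y => ?_)).1 h5
  simp

/-- The operator defined by a standard kernel preserves bounds of the form `M ψ(ρ)` for the mean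
oscillation over all balls of radius `ρ`, with a constant which depends neither on the kernel, nor
on the function, nor on `ψ`. -/
theorem BallGrowth.exists_osc_bound [SFinite μ] (hμ : BallGrowth μ Q v) (A B : ℝ) :
    ∃ C : ℝ, 0 ≤ C ∧ ∀ k, StandardKernel μ Q k A B → ∀ f : X → ℝ, Integrable f μ →
      ∀ z R, 0 < R → (∀ᵐ y ∂μ, y ∉ Metric.ball z R → f y = 0) →
      ∀ (M : ℝ) (ψ : ℝ → ℝ), 0 < M → (∀ ρ, 0 < ρ → 0 < ψ ρ) →
      (∀ s t, 0 < s → s ≤ t → ψ s ≤ ψ t) → (∀ ρ, 0 < ρ → ψ (2 * ρ) ≤ 7 / 4 * ψ ρ) →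
      (∀ x ρ, 0 < ρ → ∃ c, ∫⁻ y in Metric.ball x ρ, ‖f y - c‖ₑ ∂μ ≤
        ENNReal.ofReal (M * ψ ρ * (v * ρ ^ Q))) →
      ∃ F : X → ℝ, MemLp F 2 μ ∧
        (∀ᵐ x ∂μ, Tendsto (fun ε : ℝ => ∫ y in {y | ε < dist x y}, k x y * f y ∂μ) (𝓝[>] 0)
          (𝓝 (F x))) ∧
        ∀ x ρ, 0 < ρ → ∃ c, ∫⁻ y in Metric.ball x ρ, ‖F y - c‖ₑ ∂μ ≤
          ENNReal.ofReal (C * M * ψ ρ * (v * ρ ^ Q)) := by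
  obtain ⟨Γ, hΓ, hk2⟩ := StandardKernel.exists_l2_limit hμ A B
  have := hμ.isLocallyFiniteMeasure
  have hv := hμ.pos
  set L : ℝ := 7 / 3 * (1 + 2 ^ Q) + 1 with hL
  have hL0 : 0 < L := by positivity
  -- `τ ψ(r)` bounds the oscillation on all balls of radius up to `4 r`.
  set τ : ℝ := L * (7 / 4) ^ 2 with hτ
  have hτ0 : 0 < τ := by positivity
  have hsc : 0 < stopConst Q := by rw [stopConst]; positivity
  set C₀ : ℝ := Γ * (√(2 ^ Q) * 2 * (stopConst Q * τ)) + |B| * v * 2 ^ Q * (4 * τ) with hC₀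
  refine ⟨C₀, by positivity, ?_⟩
  intro k hk f hf z R hR hsupp M ψ hM hψ0 hψm hψd hosc
  have hB := hk.nonneg_smooth
  have hfl : LocallyIntegrable f μ := hf.locallyIntegrable
  have hf2 : MemLp f 2 μ := by
    refine hμ.memLp_two_of_osc hfl (mul_pos hM (hψ0 (2 * R) (by positivity))) hR hsupp ?_
    intro x ρ hρ hρR
    obtain ⟨c, hc⟩ := hosc x ρ hρ
    refine ⟨c, hc.trans (ENNReal.ofReal_le_ofReal ?_)⟩
    have := hψm ρ (2 * R) hρ hρR
    gcongr
  obtain ⟨_, F, hF2, hFt⟩ := hk2 k hk f hf2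
  have hF : IsL2Limit μ k Γ f F := ⟨hΓ, fun g hg => (hk2 k hk g hg).1, hF2, hFt⟩
  refine ⟨F, hF2, hk.ae_tendsto_tail hμ hF hf hf2 hsupp, ?_⟩
  intro x r hr
  have hψr := hψ0 r hr
  obtain ⟨c, hc⟩ := hμ.lintegral_dyadic_le hfl hM hψ0 hψd hosc x hr
  refine ⟨_, (hk.setLIntegral_sub_tail_le_ofReal hμ hF hf hf2 hsupp hr (c := c)
    (b := 4 * (stopConst Q * (τ * (M * ψ r))) ^ 2) (by positivity) ?_
    (a := fun j => L * (7 / 4) ^ j * (M * ψ r)) (fun j => by positivity) hc ?_).trans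
    (ENNReal.ofReal_le_ofReal ?_)⟩
  · refine hμ.lintegral_sq_le hfl (by positivity) (ρ₀ := 4 * r) ?_ (by positivity) (by linarith) ?_
    · intro y ρ hρ hρr
      obtain ⟨c', hc'⟩ := hosc y ρ hρ
      refine ⟨c', hc'.trans (ENNReal.ofReal_le_ofReal ?_)⟩
      have h1 : ψ ρ ≤ (7 / 4) ^ 2 * ψ r := by
        have h2 := hψm ρ (2 * (2 * r)) hρ (by linarith)
        have h3 := hψd (2 * r) (by positivity)
        have h4 := hψd r hr
        linarith
      have hL1 : 1 ≤ L := by rw [hL]; linarith [show (0 : ℝ) < 7 / 3 * (1 + 2 ^ Q) by positivity]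
      calc M * ψ ρ * (v * ρ ^ Q) ≤ M * ((7 / 4) ^ 2 * ψ r) * (v * ρ ^ Q) := by gcongr
        _ = 1 * ((7 / 4) ^ 2 * (M * ψ r)) * (v * ρ ^ Q) := by ring
        _ ≤ L * ((7 / 4) ^ 2 * (M * ψ r)) * (v * ρ ^ Q) := by gcongr
        _ = _ := by rw [hτ]; ring
    · have h1 := hc 2
      have h2 : (2 : ℝ) * (2 * r) = 2 ^ 2 * r := by ring
      rw [h2, hτ, mul_assoc L, mul_assoc L]
      simpa only [mul_assoc] using h1
  · have h1 : Summable fun j : ℕ => (7 / 8 : ℝ) ^ j :=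
      summable_geometric_of_lt_one (by norm_num) (by norm_num)
    refine (h1.mul_left (τ / 2 * (M * ψ r))).congr fun j => ?_
    rw [show (7 / 8 : ℝ) = 7 / 4 * (1 / 2) by norm_num, mul_pow, hτ]
    ring
  · have h1 : ∑' j : ℕ, L * (7 / 4) ^ (j + 2) * (M * ψ r) * (1 / 2) ^ (j + 1) =
        4 * τ * (M * ψ r) := by
      have h2 : ∀ j : ℕ, L * (7 / 4) ^ (j + 2) * (M * ψ r) * (1 / 2) ^ (j + 1) =
          τ / 2 * (M * ψ r) * (7 / 8) ^ j := fun j => by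
        rw [show (7 / 8 : ℝ) = 7 / 4 * (1 / 2) by norm_num, mul_pow, hτ]
        ring
      simp only [h2]
      rw [tsum_mul_left, tsum_geometric_of_lt_one (by norm_num) (by norm_num)]
      ring
    have h3 : √(2 ^ Q * (4 * (stopConst Q * (τ * (M * ψ r))) ^ 2)) =
        √(2 ^ Q) * 2 * (stopConst Q * τ) * (M * ψ r) := by
      rw [show 2 ^ Q * (4 * (stopConst Q * (τ * (M * ψ r))) ^ 2) =
        2 ^ Q * (2 * (stopConst Q * τ) * (M * ψ r)) ^ 2 by ring, Real.sqrt_mul (by positivity),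
        Real.sqrt_sq (by positivity)]
      ring
    rw [h1, h3, hC₀, abs_of_nonneg hB]
    apply le_of_eq
    ring

end Oscillation

/-! ### Translations, dilations and Lebesgue measure on a Carnot group -/

namespace CarnotGroup

variable {N : ℕ} (G : CarnotGroup N)

lemma contDiff_op_left (x : EuclideanSpace ℝ (Fin N)) : ContDiff ℝ ∞ (G.op x) :=
  G.contDiff_op.comp (contDiff_const.prodMk contDiff_id)

lemma contDiff_op_right (y : EuclideanSpace ℝ (Fin N)) : ContDiff ℝ ∞ (fun x => G.op x y) :=
  G.contDiff_op.comp (contDiff_id.prodMk contDiff_const)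

lemma differentiable_op_left (x : EuclideanSpace ℝ (Fin N)) : Differentiable ℝ (G.op x) :=
  (G.contDiff_op_left x).differentiable (by simp)

lemma differentiable_op_right (y : EuclideanSpace ℝ (Fin N)) :
    Differentiable ℝ (fun x => G.op x y) :=
  (G.contDiff_op_right y).differentiable (by simp)

lemma neg_op_cancel (x y : EuclideanSpace ℝ (Fin N)) : G.op (-x) (G.op x y) = y := by
  rw [← G.op_assoc, G.neg_op, G.zero_op]

lemma op_neg_cancel (x y : EuclideanSpace ℝ (Fin N)) : G.op x (G.op (-x) y) = y := by
  rw [← G.op_assoc, G.op_neg, G.zero_op]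

/-- Left translation, as a homeomorphism. -/
def translation (x : EuclideanSpace ℝ (Fin N)) :
    EuclideanSpace ℝ (Fin N) ≃ₜ EuclideanSpace ℝ (Fin N) where
  toFun := G.op x
  invFun := G.op (-x)
  left_inv := G.neg_op_cancel x
  right_inv := G.op_neg_cancel x
  continuous_toFun := (G.contDiff_op_left x).continuous
  continuous_invFun := (G.contDiff_op_left (-x)).continuous

/-- The differential at the identity of the left translation by `x`; its values on a vector `u`
are those of the left invariant vector field which equals `u` at the identity. -/
noncomputable def leftMap (x : EuclideanSpace ℝ (Fin N)) :
    EuclideanSpace ℝ (Fin N) →L[ℝ] EuclideanSpace ℝ (Fin N) :=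
  fderiv ℝ (fun y => G.op x y) 0

lemma leftInvField_eq (i : Fin N) (x : EuclideanSpace ℝ (Fin N)) :
    leftInvField G.op i x = G.leftMap x (EuclideanSpace.single i 1) := rfl

lemma leftMap_eq (x : EuclideanSpace ℝ (Fin N)) : G.leftMap x =
    (fderiv ℝ (fun p : EuclideanSpace ℝ (Fin N) × EuclideanSpace ℝ (Fin N) => G.op p.1 p.2)
      (x, 0)).comp (ContinuousLinearMap.inr ℝ _ _) := by
  have h1 : HasFDerivAt (fun p : EuclideanSpace ℝ (Fin N) × EuclideanSpace ℝ (Fin N) =>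
      G.op p.1 p.2) _ (x, 0) :=
    ((G.contDiff_op.differentiable (by simp)) (x, 0)).hasFDerivAt
  have h2 : HasFDerivAt (fun y => G.op x y) _ 0 := h1.comp 0 (hasFDerivAt_prodMk_right x 0)
  exact h2.fderiv

lemma contDiff_leftMap : ContDiff ℝ ∞ G.leftMap := by
  have h1 : ContDiff ℝ ∞ (fderiv ℝ
      (fun p : EuclideanSpace ℝ (Fin N) × EuclideanSpace ℝ (Fin N) => G.op p.1 p.2)) :=
    G.contDiff_op.fderiv_right (m := ∞) (by simp)
  have h2 : G.leftMap = fun x => (fderiv ℝ (fun p : EuclideanSpace ℝ (Fin N) ×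
      EuclideanSpace ℝ (Fin N) => G.op p.1 p.2) (x, 0)).comp
        (ContinuousLinearMap.inr ℝ _ _) := funext G.leftMap_eq
  rw [h2]
  exact (h1.comp (contDiff_id.prodMk contDiff_const)).clm_comp contDiff_const

lemma leftMap_zero : G.leftMap 0 = ContinuousLinearMap.id ℝ _ := by
  have h : (fun y => G.op 0 y) = id := funext G.zero_op
  rw [leftMap, h, fderiv_id]

/-- Left invariance of the fields `x ↦ leftMap x u`. -/
lemma fderiv_op_comp_leftMap (x y : EuclideanSpace ℝ (Fin N)) :
    (fderiv ℝ (G.op x) y).comp (G.leftMap y) = G.leftMap (G.op x y) := by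
  have h1 : HasFDerivAt (G.op y) (G.leftMap y) 0 := (G.differentiable_op_left y 0).hasFDerivAt
  have h2 : HasFDerivAt (G.op x) (fderiv ℝ (G.op x) y) (G.op y 0) := by
    rw [G.op_zero]; exact (G.differentiable_op_left x y).hasFDerivAt
  have h3 := h2.comp (0 : EuclideanSpace ℝ (Fin N)) h1
  have h4 : G.op x ∘ G.op y = fun z => G.op (G.op x y) z := funext fun z => (G.op_assoc x y z).symm
  rw [h4] at h3
  exact h3.fderiv.symm

/-- The dilation with factor `l`, as a linear map. -/
noncomputable def dil (l : ℝ) : EuclideanSpace ℝ (Fin N) →L[ℝ] EuclideanSpace ℝ (Fin N) :=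
  LinearMap.toContinuousLinearMap
    { toFun := fun x => WithLp.toLp 2 fun i => l ^ G.weight i * x i
      map_add' := fun x y => by ext i; simp [mul_add]
      map_smul' := fun c x => by ext i; simp; ring }

lemma dil_apply (l : ℝ) (x : EuclideanSpace ℝ (Fin N)) :
    G.dil l x = WithLp.toLp 2 fun i => l ^ G.weight i * x i := rfl

lemma dil_op {l : ℝ} (hl : 0 < l) (x y : EuclideanSpace ℝ (Fin N)) :
    G.dil l (G.op x y) = G.op (G.dil l x) (G.dil l y) := G.dilation_op l hl x y

lemma dil_dil (l m : ℝ) (x : EuclideanSpace ℝ (Fin N)) : G.dil l (G.dil m x) = G.dil (l * m) x := by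
  ext i; simp [dil_apply, mul_pow, mul_assoc]

lemma dil_one (x : EuclideanSpace ℝ (Fin N)) : G.dil 1 x = x := by
  ext i; simp [dil_apply]

lemma dil_inv_dil {l : ℝ} (hl : l ≠ 0) (x : EuclideanSpace ℝ (Fin N)) :
    G.dil l⁻¹ (G.dil l x) = x := by
  rw [dil_dil, inv_mul_cancel₀ hl, dil_one]

lemma dil_dil_inv {l : ℝ} (hl : l ≠ 0) (x : EuclideanSpace ℝ (Fin N)) :
    G.dil l (G.dil l⁻¹ x) = x := by
  rw [dil_dil, mul_inv_cancel₀ hl, dil_one]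

lemma dil_single (l : ℝ) (i : Fin N) : G.dil l (EuclideanSpace.single i 1) =
    l ^ G.weight i • EuclideanSpace.single i (1 : ℝ) := by
  ext j
  rcases eq_or_ne j i with rfl | h
  · simp [dil_apply]
  · simp [dil_apply, h]

lemma det_dil (l : ℝ) : (G.dil l).det = l ^ G.homDim := by
  have h : LinearMap.toMatrix (EuclideanSpace.basisFun (Fin N) ℝ).toBasis
      (EuclideanSpace.basisFun (Fin N) ℝ).toBasis (G.dil l : EuclideanSpace ℝ (Fin N) →ₗ[ℝ] _) =
      Matrix.diagonal fun i => l ^ G.weight i := by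
    ext i j
    rw [LinearMap.toMatrix_apply]
    simp only [OrthonormalBasis.coe_toBasis, EuclideanSpace.basisFun_apply,
      ContinuousLinearMap.coe_coe, dil_single, Matrix.diagonal_apply]
    rcases eq_or_ne i j with rfl | h
    · simp
    · simp [h]
  rw [ContinuousLinearMap.det, ← LinearMap.det_toMatrix (EuclideanSpace.basisFun (Fin N) ℝ).toBasis,
    h, Matrix.det_diagonal, Finset.prod_pow_eq_pow_sum]
  rfl

lemma dil_tendsto_zero (x : EuclideanSpace ℝ (Fin N)) :
    Tendsto (fun l => G.dil l x) (𝓝[>] 0) (𝓝 0) := by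
  have h : Continuous fun l => G.dil l x := by
    have : (fun l => G.dil l x) = fun l => WithLp.toLp 2 fun i => l ^ G.weight i * x i := rfl
    rw [this]
    fun_prop
  have h0 : G.dil 0 x = 0 := by
    ext i
    have : G.weight i ≠ 0 := by have := G.one_le_weight i; omega
    simp [dil_apply, this]
  have := h.tendsto 0
  rw [h0] at this
  exact this.mono_left nhdsWithin_le_nhds

/-- Dilations are automorphisms, hence they intertwine the differentials of the translations. -/
lemma dil_comp_leftMap {l : ℝ} (hl : 0 < l) (x : EuclideanSpace ℝ (Fin N)) :
    (G.dil l).comp (G.leftMap x) = (G.leftMap (G.dil l x)).comp (G.dil l) := by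
  have h1 : HasFDerivAt (fun y => G.op x y) (G.leftMap x) 0 :=
    (G.differentiable_op_left x 0).hasFDerivAt
  have h2 := (G.dil l).hasFDerivAt.comp (0 : EuclideanSpace ℝ (Fin N)) h1
  have h3 : HasFDerivAt (fun y => G.op (G.dil l x) y) (G.leftMap (G.dil l x)) (G.dil l 0) := by
    rw [map_zero]; exact (G.differentiable_op_left _ 0).hasFDerivAt
  have h4 := h3.comp (0 : EuclideanSpace ℝ (Fin N)) (G.dil l).hasFDerivAt
  have h5 : (⇑(G.dil l) ∘ fun y => G.op x y) =
      (fun y => G.op (G.dil l x) y) ∘ ⇑(G.dil l) := funext fun y => G.dil_op hl x y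
  rw [h5] at h2
  exact h2.unique h4

/-- Left translations are unimodular at the origin: the determinant is continuous, it is `1` at
the identity, and it is invariant under dilations. -/
lemma det_leftMap (x : EuclideanSpace ℝ (Fin N)) : (G.leftMap x).det = 1 := by
  have h1 : ∀ l : ℝ, 0 < l → (G.leftMap (G.dil l x)).det = (G.leftMap x).det := by
    intro l hl
    have h := congrArg ContinuousLinearMap.det (G.dil_comp_leftMap hl x)
    have hmul : ∀ S T : EuclideanSpace ℝ (Fin N) →L[ℝ] EuclideanSpace ℝ (Fin N),
        (S.comp T).det = S.det * T.det := fun S T => by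
      simp only [ContinuousLinearMap.det]
      exact LinearMap.det_comp _ _
    rw [hmul, hmul, mul_comm, det_dil] at h
    exact (mul_right_cancel₀ (pow_pos hl _).ne' h).symm
  have h2 : Continuous fun y => (G.leftMap y).det :=
    ContinuousLinearMap.continuous_det.comp G.contDiff_leftMap.continuous
  have h3 := (h2.tendsto 0).comp (G.dil_tendsto_zero x)
  have h4 : Tendsto (fun _ : ℝ => (G.leftMap x).det) (𝓝[>] 0) (𝓝 (G.leftMap 0).det) := by
    refine h3.congr' ?_
    filter_upwards [self_mem_nhdsWithin] with l hl
    exact h1 l hl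
  have h5 := tendsto_nhds_unique h4 tendsto_const_nhds
  rw [← h5, leftMap_zero]
  simp [ContinuousLinearMap.det]

lemma det_fderiv_op (x y : EuclideanSpace ℝ (Fin N)) : (fderiv ℝ (G.op x) y).det = 1 := by
  have h := congrArg ContinuousLinearMap.det (G.fderiv_op_comp_leftMap x y)
  have hmul : ((fderiv ℝ (G.op x) y).comp (G.leftMap y)).det =
      (fderiv ℝ (G.op x) y).det * (G.leftMap y).det := by
    simp only [ContinuousLinearMap.det]
    exact LinearMap.det_comp _ _
  rwa [hmul, det_leftMap, det_leftMap, mul_one] at h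

/-- Lebesgue measure is left invariant. -/
lemma volume_image_op (x : EuclideanSpace ℝ (Fin N)) {s : Set (EuclideanSpace ℝ (Fin N))}
    (hs : MeasurableSet s) : volume (G.op x '' s) = volume s := by
  rw [← lintegral_abs_det_fderiv_eq_addHaar_image volume hs (f' := fderiv ℝ (G.op x))
    (fun y _ => (G.differentiable_op_left x y).hasFDerivAt.hasFDerivWithinAt)
    (G.translation x).injective.injOn]
  simp [det_fderiv_op]

lemma volume_image_dil {l : ℝ} (hl : 0 < l) (s : Set (EuclideanSpace ℝ (Fin N))) :
    volume (G.dil l '' s) = ENNReal.ofReal (l ^ G.homDim) * volume s := by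
  have h := Measure.addHaar_image_linearMap volume
    (G.dil l : EuclideanSpace ℝ (Fin N) →ₗ[ℝ] _) s
  have h2 := G.det_dil l
  rw [ContinuousLinearMap.det] at h2
  rw [h2, abs_of_pos (by positivity)] at h
  exact h

end CarnotGroup

/-! ### Horizontal curves -/

section AbsolutelyContinuous

variable {E : Type*} [NormedAddCommGroup E] [InnerProductSpace ℝ E]

lemma AbsolutelyContinuousOnInterval.inner_left {φ : ℝ → E} {a b : ℝ}
    (hφ : AbsolutelyContinuousOnInterval φ a b) (u : E) :
    AbsolutelyContinuousOnInterval (fun t => inner ℝ u (φ t)) a b := by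
  have h := Tendsto.const_mul ‖u‖ hφ
  rw [mul_zero] at h
  refine squeeze_zero (fun t => Finset.sum_nonneg fun i _ => dist_nonneg) (fun t => ?_) h
  rw [Finset.mul_sum]
  refine Finset.sum_le_sum fun i _ => ?_
  rw [Real.dist_eq, ← inner_sub_right, dist_eq_norm]
  exact abs_real_inner_le_norm _ _

/-- The mean value inequality for absolutely continuous curves. -/
lemma AbsolutelyContinuousOnInterval.norm_sub_le {φ : ℝ → E} {a b M : ℝ} (hab : a ≤ b)
    (hφ : AbsolutelyContinuousOnInterval φ a b)
    (hM : ∀ᵐ t ∂(volume.restrict (Ioo a b)), ∃ w, HasDerivAt φ w t ∧ ‖w‖ ≤ M) :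
    ‖φ b - φ a‖ ≤ M * (b - a) := by
  set u := φ b - φ a with hu
  have h1 := (hφ.inner_left u).integral_deriv_eq_sub
  rw [← inner_sub_right, ← hu, real_inner_self_eq_norm_sq] at h1
  have h2 : ‖∫ t in a..b, deriv (fun t => inner ℝ u (φ t)) t‖ ≤ ‖u‖ * M * |b - a| := by
    refine intervalIntegral.norm_integral_le_of_norm_le_const_ae ?_
    rw [ae_restrict_iff' measurableSet_Ioo] at hM
    have hne : ∀ᵐ t : ℝ, t ≠ b := by simp [ae_iff]
    filter_upwards [hM, hne] with t ht htb htab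
    rw [uIoc_of_le hab] at htab
    obtain ⟨w, hw, hwM⟩ := ht ⟨htab.1, lt_of_le_of_ne htab.2 htb⟩
    have h3 : HasDerivAt (fun t => inner ℝ u (φ t)) (inner ℝ u w) t :=
      ((innerSL ℝ u).hasFDerivAt.comp_hasDerivAt t hw)
    rw [h3.deriv]
    refine (norm_inner_le_norm u w).trans ?_
    gcongr
  rw [h1, abs_of_nonneg (sub_nonneg.2 hab), Real.norm_of_nonneg (by positivity)] at h2
  rcases (norm_nonneg u).eq_or_lt with h0 | h0
  · rw [← h0]
    rcases hab.eq_or_lt with rfl | hlt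
    · simp
    · have : (ae (volume.restrict (Ioo a b))).NeBot := by
        rw [ae_neBot, Ne, Measure.restrict_eq_zero, Real.volume_Ioo]
        simpa using hlt
      obtain ⟨t, w, _, hw⟩ := hM.exists
      have := (norm_nonneg w).trans hw
      exact mul_nonneg this (sub_nonneg.2 hab)
  · nlinarith

end AbsolutelyContinuous

lemma ae_comp_mul_add {p : ℝ → Prop} (h : ∀ᵐ t, p t) {s : ℝ} (hs : s ≠ 0) (c : ℝ) :
    ∀ᵐ t, p (s * t + c) := by
  have h1 : ∀ᵐ t, p (t + c) :=
    (measurePreserving_add_right volume c).quasiMeasurePreserving.ae h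
  have h2 : Measure.QuasiMeasurePreserving (fun t : ℝ => s * t) volume volume := by
    refine ⟨measurable_const_mul s, ?_⟩
    rw [Real.map_volume_mul_left hs]
    exact Measure.smul_absolutelyContinuous
  exact h2.ae h1

namespace CarnotGroup

variable {N : ℕ} (G : CarnotGroup N)

/-- The horizontal vector with given components of weight one. -/
noncomputable def horizontal (b : Fin N → ℝ) : EuclideanSpace ℝ (Fin N) :=
  ∑ i with G.weight i = 1, b i • EuclideanSpace.single i 1

lemma leftMap_horizontal (b : Fin N → ℝ) (x : EuclideanSpace ℝ (Fin N)) :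
    G.leftMap x (G.horizontal b) = ∑ i with G.weight i = 1, b i • leftInvField G.op i x := by
  simp only [horizontal, map_sum, map_smul, leftInvField_eq]

lemma horizontal_smul (c : ℝ) (b : Fin N → ℝ) :
    G.horizontal (fun i => c * b i) = c • G.horizontal b := by
  simp only [horizontal, Finset.smul_sum, smul_smul]

lemma norm_horizontal_le {b : Fin N → ℝ} {δ : ℝ} (hb : ∀ i, |b i| ≤ δ) :
    ‖G.horizontal b‖ ≤ N * δ := by
  refine (norm_sum_le _ _).trans ?_
  calc ∑ i with G.weight i = 1, ‖b i • EuclideanSpace.single i (1 : ℝ)‖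
      ≤ ∑ i : Fin N, ‖b i • EuclideanSpace.single i (1 : ℝ)‖ :=
        Finset.sum_le_sum_of_subset_of_nonneg (Finset.filter_subset _ _) fun _ _ _ => norm_nonneg _
    _ ≤ ∑ i : Fin N, δ := by
        refine Finset.sum_le_sum fun i _ => ?_
        rw [norm_smul]
        simpa using hb i
    _ = N * δ := by simp

lemma dil_horizontal (l : ℝ) (b : Fin N → ℝ) :
    G.dil l (G.horizontal b) = G.horizontal fun i => l * b i := by
  simp only [horizontal, map_sum, map_smul, dil_single, smul_smul]
  refine Finset.sum_congr rfl fun i hi => ?_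
  rw [(Finset.mem_filter.1 hi).2, pow_one, mul_comm]

/-- There is a Lipschitz horizontal curve, parametrised by `[0, T]`, from `x` to `y` with controls
at most `δ`. -/
def HPath (T δ : ℝ) (x y : EuclideanSpace ℝ (Fin N)) : Prop :=
  ∃ (φ : ℝ → EuclideanSpace ℝ (Fin N)) (a : ℝ → Fin N → ℝ) (K : NNReal),
    LipschitzOnWith K φ (Icc 0 T) ∧ φ 0 = x ∧ φ T = y ∧ (∀ t i, |a t i| ≤ δ) ∧
    ∀ᵐ t, t ∈ Ioo 0 T → HasDerivAt φ (G.leftMap (φ t) (G.horizontal (a t))) t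

variable {G}

lemma HPath.joins {δ : ℝ} {x y : EuclideanSpace ℝ (Fin N)} (h : G.HPath 1 δ x y) :
    G.Joins δ x y := by
  obtain ⟨φ, a, K, hφ, h0, h1, ha, hd⟩ := h
  refine ⟨φ, a, ?_, h0, h1, ha, ?_⟩
  · rw [← uIcc_of_le zero_le_one] at hφ
    exact hφ.absolutelyContinuousOnInterval
  · rw [ae_restrict_iff' measurableSet_Ioo]
    filter_upwards [hd] with t ht ht'
    rw [← leftMap_horizontal]
    exact ht ht'

/-- The derivative of an admissible curve is bounded, since the curve stays in a compact set, so
that an absolutely continuous admissible curve is Lipschitz. -/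
lemma Joins.hPath {δ : ℝ} {x y : EuclideanSpace ℝ (Fin N)} (h : G.Joins δ x y) :
    G.HPath 1 δ x y := by
  obtain ⟨φ, a, hφ, h0, h1, ha, hd⟩ := h
  have hcont := hφ.continuousOn
  rw [uIcc_of_le zero_le_one] at hcont
  obtain ⟨M, hM⟩ := isCompact_Icc.exists_bound_of_continuousOn
    (G.contDiff_leftMap.continuous.comp_continuousOn hcont)
  have hM0 : 0 ≤ M := (norm_nonneg _).trans (hM 0 (by simp))
  have hbd : ∀ s t, 0 ≤ s → s ≤ t → t ≤ 1 → ‖φ t - φ s‖ ≤ (M * (N * δ)) * (t - s) := by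
    intro s t hs hst ht
    refine (hφ.mono ?_).norm_sub_le hst ?_
    · rw [uIcc_of_le hst, uIcc_of_le zero_le_one]; exact Icc_subset_Icc hs ht
    · have hd' := ae_restrict_of_ae_restrict_of_subset (Ioo_subset_Ioo hs ht) hd
      filter_upwards [hd', ae_restrict_mem measurableSet_Ioo] with τ hτ hτm
      refine ⟨_, hτ, ?_⟩
      rw [← leftMap_horizontal]
      refine ((G.leftMap (φ τ)).le_opNorm _).trans ?_
      have h2 := hM τ ⟨hs.trans hτm.1.le, hτm.2.le.trans ht⟩
      have h3 := G.norm_horizontal_le (ha τ)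
      simp only [Function.comp_apply] at h2
      gcongr
  refine ⟨φ, a, (M * (N * δ)).toNNReal, LipschitzOnWith.of_dist_le_mul fun t ht s hs => ?_, h0, h1,
    ha, ?_⟩
  · have hle : M * (N * δ) ≤ ((M * (N * δ)).toNNReal : ℝ) := Real.le_coe_toNNReal _
    rcases le_total s t with hst | hst
    · rw [dist_eq_norm, Real.dist_eq, abs_of_nonneg (sub_nonneg.2 hst)]
      exact (hbd s t hs.1 hst ht.2).trans
        (mul_le_mul_of_nonneg_right hle (sub_nonneg.2 hst))
    · rw [dist_comm, dist_comm t, dist_eq_norm, Real.dist_eq, abs_of_nonneg (sub_nonneg.2 hst)]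
      exact (hbd t s ht.1 hst hs.2).trans
        (mul_le_mul_of_nonneg_right hle (sub_nonneg.2 hst))
  · rw [ae_restrict_iff' measurableSet_Ioo] at hd
    filter_upwards [hd] with t ht ht'
    rw [leftMap_horizontal]
    exact ht ht'

/-- A change of the speed of a curve changes the controls by the same factor. -/
lemma HPath.rescale {T δ s : ℝ} {x y : EuclideanSpace ℝ (Fin N)} (h : G.HPath T δ x y)
    (hs : 0 < s) : G.HPath (T / s) (s * δ) x y := by
  obtain ⟨φ, a, K, hφ, h0, h1, ha, hd⟩ := h
  refine ⟨fun t => φ (s * t), fun t i => s * a (s * t) i, K * s.toNNReal, ?_, by simpa using h0, ?_,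
    fun t i => ?_, ?_⟩
  · have h2 : LipschitzWith s.toNNReal fun t : ℝ => s * t :=
      LipschitzWith.of_dist_le_mul fun t t' => by
        rw [Real.dist_eq, Real.dist_eq, ← mul_sub, abs_mul, abs_of_pos hs,
          Real.coe_toNNReal _ hs.le]
    refine hφ.comp (h2.lipschitzOnWith (s := Icc 0 (T / s))) fun t ht => ?_
    exact ⟨mul_nonneg hs.le ht.1, by rw [mul_comm]; exact (le_div_iff₀ hs).1 ht.2⟩
  · simp only
    rw [mul_div_cancel₀ _ hs.ne', h1]
  · rw [abs_mul, abs_of_pos hs]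
    exact mul_le_mul_of_nonneg_left (ha _ _) hs.le
  · have h2 := ae_comp_mul_add hd hs.ne' 0
    filter_upwards [h2] with t ht htm
    rw [add_zero] at ht
    have h3 := ht ⟨mul_pos hs htm.1, by rw [mul_comm]; exact (lt_div_iff₀ hs).1 htm.2⟩
    have h4 : HasDerivAt (fun t : ℝ => s * t) s t := by
      simpa using (hasDerivAt_id t).const_mul s
    have h5 := h3.scomp t h4
    rw [horizontal_smul, map_smul]
    exact h5

lemma HPath.reverse {T δ : ℝ} {x y : EuclideanSpace ℝ (Fin N)} (h : G.HPath T δ x y) :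
    G.HPath T δ y x := by
  obtain ⟨φ, a, K, hφ, h0, h1, ha, hd⟩ := h
  refine ⟨fun t => φ (-1 * t + T), fun t i => (-1) * a (-1 * t + T) i, K * 1, ?_, by simpa using h1,
    by simpa using h0, fun t i => by simpa using ha _ _, ?_⟩
  · have h2 : LipschitzWith 1 fun t : ℝ => -1 * t + T :=
      LipschitzWith.of_dist_le_mul fun t t' => by
        rw [Real.dist_eq, Real.dist_eq, abs_sub_comm, NNReal.coe_one, one_mul]
        exact le_of_eq (by congr 1; ring)
    refine hφ.comp (h2.lipschitzOnWith (s := Icc 0 T)) fun t ht => ?_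
    exact ⟨by linarith [ht.2], by linarith [ht.1]⟩
  · filter_upwards [ae_comp_mul_add hd (by norm_num : (-1 : ℝ) ≠ 0) T] with t ht htm
    have h3 := ht ⟨by linarith [htm.2], by linarith [htm.1]⟩
    have h4 : HasDerivAt (fun t : ℝ => -1 * t + T) (-1) t := by
      simpa using ((hasDerivAt_id t).const_mul (-1)).add_const T
    have h5 := h3.scomp t h4
    rw [horizontal_smul, map_smul]
    exact h5

lemma HPath.trans {T₁ T₂ δ : ℝ} (hT₁ : 0 ≤ T₁) (hT₂ : 0 ≤ T₂) {x y z : EuclideanSpace ℝ (Fin N)}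
    (h₁ : G.HPath T₁ δ x y) (h₂ : G.HPath T₂ δ y z) : G.HPath (T₁ + T₂) δ x z := by
  obtain ⟨φ, a, K, hφ, hφ0, hφ1, ha, hd⟩ := h₁
  obtain ⟨ψ, b, L, hψ, hψ0, hψ1, hb, he⟩ := h₂
  let χ : ℝ → EuclideanSpace ℝ (Fin N) := fun t => if t ≤ T₁ then φ t else ψ (t - T₁)
  have hχ1 : ∀ t, t ≤ T₁ → χ t = φ t := fun t ht => if_pos ht
  have hχ2 : ∀ t, T₁ ≤ t → χ t = ψ (t - T₁) := by
    intro t ht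
    rcases ht.eq_or_lt with rfl | h
    · rw [hχ1 _ le_rfl, hφ1, sub_self, hψ0]
    · exact if_neg (not_le.2 h)
  have hlip : ∀ s t, 0 ≤ s → s ≤ t → t ≤ T₁ + T₂ → 
      Dist.dist (χ s) (χ t) ≤ (max K L : NNReal) * (t - s) := by
    intro s t hs hst ht
    have hK : (K : ℝ) ≤ (max K L : NNReal) := NNReal.coe_le_coe.2 (le_max_left _ _)
    have hL : (L : ℝ) ≤ (max K L : NNReal) := NNReal.coe_le_coe.2 (le_max_right _ _)
    have hA : ∀ s t, 0 ≤ s → s ≤ t → t ≤ T₁ →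
        Dist.dist (χ s) (χ t) ≤ (max K L : NNReal) * (t - s) := by
      intro s t hs hst ht
      rw [hχ1 s (hst.trans ht), hχ1 t ht]
      have := hφ.dist_le_mul s ⟨hs, hst.trans ht⟩ t ⟨hs.trans hst, ht⟩
      rw [dist_comm s, Real.dist_eq, abs_of_nonneg (sub_nonneg.2 hst)] at this
      exact this.trans (mul_le_mul_of_nonneg_right hK (sub_nonneg.2 hst))
    have hB : ∀ s t, T₁ ≤ s → s ≤ t → t ≤ T₁ + T₂ →
        Dist.dist (χ s) (χ t) ≤ (max K L : NNReal) * (t - s) := by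
      intro s t hs hst ht
      rw [hχ2 s hs, hχ2 t (hs.trans hst)]
      have := hψ.dist_le_mul (s - T₁) ⟨by linarith, by linarith⟩ (t - T₁)
        ⟨by linarith, by linarith⟩
      rw [dist_comm (s - T₁), Real.dist_eq, sub_sub_sub_cancel_right,
        abs_of_nonneg (sub_nonneg.2 hst)] at this
      exact this.trans (mul_le_mul_of_nonneg_right hL (sub_nonneg.2 hst))
    rcases le_total t T₁ with h | h
    · exact hA s t hs hst h
    rcases le_total T₁ s with h' | h'
    · exact hB s t h' hst ht
    calc Dist.dist (χ s) (χ t)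
        ≤ Dist.dist (χ s) (χ T₁) + Dist.dist (χ T₁) (χ t) := dist_triangle _ _ _
      _ ≤ (max K L : NNReal) * (T₁ - s) + (max K L : NNReal) * (t - T₁) :=
        add_le_add (hA s T₁ hs h' le_rfl) (hB T₁ t le_rfl h ht)
      _ = _ := by ring
  refine ⟨χ, fun t => if t ≤ T₁ then a t else b (t - T₁), max K L,
    LipschitzOnWith.of_dist_le_mul fun s hs t ht => ?_, by rw [hχ1 0 hT₁, hφ0],
    by rw [hχ2 _ (by linarith), add_sub_cancel_left, hψ1], fun t i => ?_, ?_⟩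
  · rcases le_total s t with h | h
    · rw [dist_comm s t, Real.dist_eq, abs_of_nonneg (sub_nonneg.2 h)]
      exact hlip s t hs.1 h ht.2
    · rw [dist_comm, Real.dist_eq, abs_of_nonneg (sub_nonneg.2 h)]
      exact hlip t s ht.1 h hs.2
  · simp only
    split_ifs
    · exact ha t i
    · exact hb _ i
  · have hne : ∀ᵐ t : ℝ, t ≠ T₁ := by simp [ae_iff]
    filter_upwards [hd, ae_comp_mul_add he one_ne_zero (-T₁), hne] with t ht1 ht2 htne htm
    rcases lt_or_gt_of_ne htne with h | h
    · have h1 := ht1 ⟨htm.1, h⟩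
      rw [hχ1 t h.le, if_pos h.le]
      refine h1.congr_of_eventuallyEq ?_
      filter_upwards [Iio_mem_nhds h] with s hs
      exact hχ1 s (le_of_lt hs)
    · rw [one_mul, ← sub_eq_add_neg] at ht2
      have h1 := ht2 ⟨by linarith, by linarith [htm.2]⟩
      rw [hχ2 t h.le, if_neg (not_le.2 h)]
      refine (h1.comp_sub_const t T₁).congr_of_eventuallyEq ?_
      filter_upwards [Ioi_mem_nhds h] with s hs
      exact hχ2 s (le_of_lt hs)

lemma HPath.op_left {T δ : ℝ} {x y : EuclideanSpace ℝ (Fin N)} (h : G.HPath T δ x y)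
    (z : EuclideanSpace ℝ (Fin N)) : G.HPath T δ (G.op z x) (G.op z y) := by
  obtain ⟨φ, a, K, hφ, h0, h1, ha, hd⟩ := h
  obtain ⟨M, hM⟩ := isCompact_Icc.exists_bound_of_continuousOn hφ.continuousOn
  obtain ⟨L, hL⟩ := ((G.contDiff_op_left z).contDiffOn (s := Metric.closedBall 0 M)
    ).exists_lipschitzOnWith (by simp) (convex_closedBall _ _) (isCompact_closedBall _ _)
  refine ⟨fun t => G.op z (φ t), a, L * K, hL.comp hφ fun t ht => by simpa using hM t ht,
    by simp only [h0], by simp only [h1], ha, ?_⟩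
  filter_upwards [hd] with t ht htm
  have h2 := (G.differentiable_op_left z (φ t)).hasFDerivAt.comp_hasDerivAt t (ht htm)
  rw [← fderiv_op_comp_leftMap]
  exact h2

lemma HPath.dil {T δ : ℝ} {x y : EuclideanSpace ℝ (Fin N)} (h : G.HPath T δ x y) {l : ℝ}
    (hl : 0 < l) : G.HPath T (l * δ) (G.dil l x) (G.dil l y) := by
  obtain ⟨φ, a, K, hφ, h0, h1, ha, hd⟩ := h
  refine ⟨fun t => G.dil l (φ t), fun t i => l * a t i, ‖G.dil l‖₊ * K,
    (G.dil l).lipschitz.comp_lipschitzOnWith hφ, by simp only [h0], by simp only [h1],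
    fun t i => ?_, ?_⟩
  · rw [abs_mul, abs_of_pos hl]
    exact mul_le_mul_of_nonneg_left (ha t i) hl.le
  · filter_upwards [hd] with t ht htm
    have h2 := (G.dil l).hasFDerivAt.comp_hasDerivAt t (ht htm)
    have h3 := DFunLike.congr_fun (G.dil_comp_leftMap hl (φ t)) (G.horizontal (a t))
    simp only [ContinuousLinearMap.comp_apply, dil_horizontal] at h3
    rw [← h3]
    exact h2

/-- A curve with controls at most `δ` which starts at the identity moves by at most a multiple of
`δ`, as long as it stays in the unit ball. -/
lemma Joins.norm_le {M : ℝ} (hM : ∀ x ∈ Metric.closedBall (0 : EuclideanSpace ℝ (Fin N)) 1,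
    ‖G.leftMap x‖ ≤ M) {δ : ℝ} (hδ : M * (N * δ) < 1) {y : EuclideanSpace ℝ (Fin N)}
    (h : G.Joins δ 0 y) : ‖y‖ ≤ M * (N * δ) := by
  obtain ⟨φ, a, hφ, h0, h1, ha, hd⟩ := h
  have hcont := hφ.continuousOn
  rw [uIcc_of_le zero_le_one] at hcont
  have hM0 : 0 ≤ M := (norm_nonneg _).trans (hM 0 (by simp))
  have hbd : ∀ τ, 0 ≤ τ → τ ≤ 1 → (∀ s, 0 ≤ s → s < τ → ‖φ s‖ ≤ 1) →
      ‖φ τ‖ ≤ M * (N * δ) * τ := by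
    intro τ hτ0 hτ1 hs
    have h2 := (hφ.mono (c := 0) (d := τ) (by
      rw [uIcc_of_le hτ0, uIcc_of_le zero_le_one]
      exact Icc_subset_Icc_right hτ1)).norm_sub_le (M := M * (N * δ)) hτ0 ?_
    · rwa [h0, sub_zero, sub_zero] at h2
    · have hd' := ae_restrict_of_ae_restrict_of_subset (Ioo_subset_Ioo_right hτ1) hd
      filter_upwards [hd', ae_restrict_mem measurableSet_Ioo] with s hs' hsm
      refine ⟨_, hs', ?_⟩
      rw [← leftMap_horizontal]
      refine ((G.leftMap (φ s)).le_opNorm _).trans ?_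
      have h2 := hM (φ s) (by simpa using hs s hsm.1.le hsm.2)
      have h3 := G.norm_horizontal_le (ha s)
      gcongr
  have hδ0 : 0 ≤ M * (N * δ) := by
    rcases N.eq_zero_or_pos with h | h
    · simp [h]
    · have := (abs_nonneg _).trans (ha 0 ⟨0, h⟩)
      positivity
  have hall : ∀ s, 0 ≤ s → s < 1 → ‖φ s‖ ≤ 1 := by
    by_contra! hcon
    obtain ⟨s, hs0, hs1, hs⟩ := hcon
    -- the first time at which the curve reaches the unit sphere
    set S : Set ℝ := {t ∈ Icc 0 1 | 1 ≤ ‖φ t‖} with hS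
    have hSc : IsCompact S := by
      have : S = Icc 0 1 ∩ (fun t => ‖φ t‖) ⁻¹' Ici 1 := rfl
      rw [this]
      exact isCompact_Icc.of_isClosed_subset
        (hcont.norm.preimage_isClosed_of_isClosed isClosed_Icc isClosed_Ici) inter_subset_left
    obtain ⟨τ, hτ, hτmin⟩ := hSc.exists_isLeast ⟨s, ⟨hs0, hs1.le⟩, hs.le⟩
    have h2 := hbd τ hτ.1.1 hτ.1.2 fun s hs0 hsτ => by
      by_contra! hlt
      exact absurd (hτmin ⟨⟨hs0, hsτ.le.trans hτ.1.2⟩, hlt.le⟩) (not_le.2 hsτ)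
    have h3 := hτ.2
    have h4 := hτ.1.2
    nlinarith
  have := hbd 1 zero_le_one le_rfl hall
  rwa [mul_one, h1] at this

lemma joins_self {δ : ℝ} (hδ : 0 ≤ δ) (x : EuclideanSpace ℝ (Fin N)) : G.Joins δ x x := by
  refine HPath.joins ⟨fun _ => x, fun _ _ => 0, 0, LipschitzWith.const x |>.lipschitzOnWith, rfl,
    rfl, fun _ _ => by simpa using hδ, Eventually.of_forall fun t _ => ?_⟩
  have : G.horizontal (fun _ => 0) = 0 := by simp [horizontal]
  rw [this, map_zero]
  exact hasDerivAt_const t x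

lemma Joins.symm {δ : ℝ} {x y : EuclideanSpace ℝ (Fin N)} (h : G.Joins δ x y) : G.Joins δ y x :=
  h.hPath.reverse.joins

/-- Both curves are traversed with unit control, in the times `δ₁` and `δ₂`. -/
lemma Joins.trans {δ₁ δ₂ : ℝ} (h₁ : 0 < δ₁) (h₂ : 0 < δ₂) {x y z : EuclideanSpace ℝ (Fin N)}
    (h : G.Joins δ₁ x y) (h' : G.Joins δ₂ y z) : G.Joins (δ₁ + δ₂) x z := by
  have e : ∀ {δ : ℝ} {x y}, 0 < δ → G.HPath 1 δ x y → G.HPath δ 1 x y := by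
    intro δ x y hδ h
    have := h.rescale (inv_pos.2 hδ)
    rwa [one_div, inv_inv, inv_mul_cancel₀ hδ.ne'] at this
  have h3 := (e h₁ h.hPath).trans h₁.le h₂.le (e h₂ h'.hPath)
  have h4 := h3.rescale (add_pos h₁ h₂)
  rw [div_self (add_pos h₁ h₂).ne', mul_one] at h4
  exact h4.joins

lemma Joins.mono {δ₁ δ₂ : ℝ} (hle : δ₁ ≤ δ₂) {x y : EuclideanSpace ℝ (Fin N)}
    (h : G.Joins δ₁ x y) : G.Joins δ₂ x y := by
  obtain ⟨φ, a, hφ, h0, h1, ha, hd⟩ := h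
  exact ⟨φ, a, hφ, h0, h1, fun t i => (ha t i).trans hle, hd⟩

lemma Joins.op_left {δ : ℝ} {x y : EuclideanSpace ℝ (Fin N)} (h : G.Joins δ x y)
    (z : EuclideanSpace ℝ (Fin N)) : G.Joins δ (G.op z x) (G.op z y) :=
  (h.hPath.op_left z).joins

lemma Joins.dil {δ : ℝ} {x y : EuclideanSpace ℝ (Fin N)} (h : G.Joins δ x y) {l : ℝ}
    (hl : 0 < l) : G.Joins (l * δ) (G.dil l x) (G.dil l y) :=
  (h.hPath.dil hl).joins

end CarnotGroup

/-! ### Connectivity by horizontal curves -/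

namespace CarnotGroup

variable {N : ℕ} (G : CarnotGroup N)

/-- The differential at the identity of the right translation by `y`. -/
noncomputable def rightMap (y : EuclideanSpace ℝ (Fin N)) :
    EuclideanSpace ℝ (Fin N) →L[ℝ] EuclideanSpace ℝ (Fin N) :=
  fderiv ℝ (fun x => G.op x y) 0

lemma rightMap_eq (y : EuclideanSpace ℝ (Fin N)) : G.rightMap y =
    (fderiv ℝ (fun p : EuclideanSpace ℝ (Fin N) × EuclideanSpace ℝ (Fin N) => G.op p.1 p.2)
      (0, y)).comp (ContinuousLinearMap.inl ℝ _ _) := by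
  have h1 : HasFDerivAt (fun p : EuclideanSpace ℝ (Fin N) × EuclideanSpace ℝ (Fin N) =>
      G.op p.1 p.2) _ (0, y) :=
    ((G.contDiff_op.differentiable (by simp)) (0, y)).hasFDerivAt
  have h2 : HasFDerivAt (fun x => G.op x y) _ 0 :=
    HasFDerivAt.comp (f := fun x => (x, y)) (0 : EuclideanSpace ℝ (Fin N)) h1
      (hasFDerivAt_prodMk_left (0 : EuclideanSpace ℝ (Fin N)) y)
  exact h2.fderiv

lemma rightMap_zero : G.rightMap 0 = ContinuousLinearMap.id ℝ _ := by
  have h : (fun x => G.op x 0) = id := funext G.op_zero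
  rw [rightMap, h, fderiv_id]

lemma hasStrictFDerivAt_op : HasStrictFDerivAt
    (fun p : EuclideanSpace ℝ (Fin N) × EuclideanSpace ℝ (Fin N) => G.op p.1 p.2)
    (ContinuousLinearMap.fst ℝ _ _ + ContinuousLinearMap.snd ℝ _ _) (0, 0) := by
  have h := G.contDiff_op.contDiffAt.hasStrictFDerivAt (x := (0, 0)) (by simp)
  have h1 := G.leftMap_eq 0
  have h2 := G.rightMap_eq 0
  rw [leftMap_zero] at h1
  rw [rightMap_zero] at h2
  have h3 : fderiv ℝ (fun p : EuclideanSpace ℝ (Fin N) × EuclideanSpace ℝ (Fin N) =>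
      G.op p.1 p.2) (0, 0) = ContinuousLinearMap.fst ℝ _ _ + ContinuousLinearMap.snd ℝ _ _ := by
    refine ContinuousLinearMap.ext fun p => ?_
    have h3 := DFunLike.congr_fun h1 p.2
    have h4 := DFunLike.congr_fun h2 p.1
    simp only [ContinuousLinearMap.id_apply, ContinuousLinearMap.comp_apply,
      ContinuousLinearMap.inl_apply, ContinuousLinearMap.inr_apply] at h3 h4
    change _ = p.1 + p.2
    conv_rhs => rw [h4, h3]
    rw [← map_add]
    simp
  rwa [h3] at h

variable {G} in
lemma Joins.op {S T : ℝ} (hS : 0 < S) (hT : 0 < T) {x y : EuclideanSpace ℝ (Fin N)}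
    (hx : G.Joins S 0 x) (hy : G.Joins T 0 y) : G.Joins (S + T) 0 (G.op x y) := by
  have h := hy.op_left x
  rw [G.op_zero] at h
  exact hx.trans hS hT h

variable {G} in
lemma Joins.neg {T : ℝ} {x : EuclideanSpace ℝ (Fin N)} (hx : G.Joins T 0 x) :
    G.Joins T 0 (-x) := by
  have h := hx.op_left (-x)
  rw [G.op_zero, G.neg_op] at h
  exact h.symm

/-- The velocities at the identity of curves, differentiable there, whose points can be joined to
the identity by horizontal curves with a common bound for the controls.  They form a linear space,
since a product of curves has as velocity the sum of the velocities. -/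
noncomputable def attainable : Submodule ℝ (EuclideanSpace ℝ (Fin N)) where
  carrier := {w | ∃ (c : ℝ → EuclideanSpace ℝ (Fin N)) (T : ℝ), c 0 = 0 ∧
    HasStrictDerivAt c w 0 ∧ 0 < T ∧ ∀ᶠ t in 𝓝 0, G.Joins T 0 (c t)}
  zero_mem' := ⟨fun _ => 0, 1, rfl, hasStrictDerivAt_const 0 0, one_pos,
    Eventually.of_forall fun _ => joins_self zero_le_one 0⟩
  add_mem' := by
    rintro w z ⟨c, T, hc0, hc, hT, hcT⟩ ⟨d, S, hd0, hd, hS, hdS⟩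
    refine ⟨fun t => G.op (c t) (d t), T + S, ?_, ?_, add_pos hT hS, ?_⟩
    · simp only [hc0, hd0, G.op_zero]
    · have h1 := G.hasStrictFDerivAt_op
      have h2 : (fun t => (c t, d t)) 0 = (0, 0) := by simp only [hc0, hd0]
      rw [← h2] at h1
      have h3 := h1.comp_hasStrictDerivAt 0 (hc.prodMk hd)
      exact h3
    · filter_upwards [hcT, hdS] with t h1 h2
      exact h1.op hT hS h2
  smul_mem' := by
    rintro a w ⟨c, T, hc0, hc, hT, hcT⟩
    refine ⟨fun t => c (a * t), T, ?_, ?_, hT, ?_⟩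
    · simp only [mul_zero, hc0]
    · have h1 : HasStrictDerivAt (fun t : ℝ => a * t) a 0 := by
        simpa using (hasStrictDerivAt_id (0 : ℝ)).const_mul a
      have h2 : HasStrictDerivAt c w ((fun t : ℝ => a * t) 0) := by
        simpa using hc
      exact h2.scomp 0 h1
    · have h1 : Tendsto (fun t : ℝ => a * t) (𝓝 0) (𝓝 0) := by
        simpa using (continuous_const_mul a).tendsto (0 : ℝ)
      exact h1.eventually hcT

/-- The adjoint action: the differential at the identity of the conjugation by `h`. -/
noncomputable def adjointMap (h : EuclideanSpace ℝ (Fin N)) :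
    EuclideanSpace ℝ (Fin N) →L[ℝ] EuclideanSpace ℝ (Fin N) :=
  fderiv ℝ (fun y => G.op (G.op h y) (-h)) 0

lemma contDiff_conj : ContDiff ℝ ∞ (Function.uncurry fun h y => G.op (G.op h y) (-h)) :=
  G.contDiff_op.comp (G.contDiff_op.prodMk contDiff_fst.neg)

lemma contDiff_conj_right (h : EuclideanSpace ℝ (Fin N)) :
    ContDiff ℝ ∞ (fun y => G.op (G.op h y) (-h)) :=
  G.contDiff_conj.comp (contDiff_const.prodMk contDiff_id)

lemma contDiff_adjointMap : ContDiff ℝ 1 G.adjointMap :=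
  G.contDiff_conj.fderiv (contDiff_const (c := (0 : EuclideanSpace ℝ (Fin N))))
    (by
      rw [one_add_one_eq_two]; exact WithTop.coe_le_coe.2 (le_top : (2 : ℕ∞) ≤ ⊤))

lemma adjointMap_zero : G.adjointMap 0 = ContinuousLinearMap.id ℝ _ := by
  have h : (fun y => G.op (G.op 0 y) (-0)) = id := by
    funext y
    rw [neg_zero, G.op_zero, G.zero_op, id]
  rw [adjointMap, h, fderiv_id]

/-- The identity `h y = (h y h⁻¹) h`, differentiated at `y = 0`. -/
lemma rightMap_adjointMap (h w : EuclideanSpace ℝ (Fin N)) :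
    G.rightMap h (G.adjointMap h w) = G.leftMap h w := by
  have h1 : HasFDerivAt (fun y => G.op (G.op h y) (-h)) (G.adjointMap h) 0 :=
    ((G.contDiff_conj_right h).differentiable (by simp) 0).hasFDerivAt
  have h0 : G.op (G.op h 0) (-h) = 0 := by rw [G.op_zero, G.op_neg]
  have h2 : HasFDerivAt (fun x => G.op x h) (G.rightMap h) (G.op (G.op h 0) (-h)) := by
    rw [h0]; exact (G.differentiable_op_right h 0).hasFDerivAt
  have h3 := h2.comp (0 : EuclideanSpace ℝ (Fin N)) h1
  have h4 : (fun x => G.op x h) ∘ (fun y => G.op (G.op h y) (-h)) = fun y => G.op h y := by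
    funext y
    simp only [Function.comp_apply]
    rw [G.op_assoc, G.neg_op, G.op_zero]
  rw [h4] at h3
  exact (DFunLike.congr_fun h3.fderiv w).symm

/-- A point reached by a horizontal curve may be used to conjugate curves of attainable points. -/
lemma adjointMap_mem_attainable {T : ℝ} (hT : 0 < T) {h w : EuclideanSpace ℝ (Fin N)}
    (hh : G.Joins T 0 h) (hw : w ∈ G.attainable) : G.adjointMap h w ∈ G.attainable := by
  obtain ⟨c, S, hc0, hc, hS, hcS⟩ := hw
  refine ⟨fun t => G.op (G.op h (c t)) (-h), T + S + T, ?_, ?_, by positivity, ?_⟩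
  · simp only [hc0, G.op_zero, G.op_neg]
  · have h1 : HasStrictFDerivAt (fun y => G.op (G.op h y) (-h)) (G.adjointMap h) (c 0) := by
      rw [hc0]
      exact (G.contDiff_conj_right h).contDiffAt.hasStrictFDerivAt (by simp)
    exact h1.comp_hasStrictDerivAt 0 hc
  · filter_upwards [hcS] with t ht
    exact (hh.op hT hS ht).op (add_pos hT hS) hT hh.neg

/-- The bracket of the left invariant fields with values `u` and `w` at the identity, evaluated at
the identity. -/
noncomputable def bracket (u w : EuclideanSpace ℝ (Fin N)) : EuclideanSpace ℝ (Fin N) :=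
  fderiv ℝ G.leftMap 0 u w - fderiv ℝ G.leftMap 0 w u

lemma lieBracket_leftMap (u w : EuclideanSpace ℝ (Fin N)) :
    VectorField.lieBracket ℝ (fun x => G.leftMap x u) (fun x => G.leftMap x w) 0 =
      G.bracket u w := by
  have h : ∀ v : EuclideanSpace ℝ (Fin N), HasFDerivAt (fun x => G.leftMap x v)
      ((fderiv ℝ G.leftMap 0).flip v) 0 := by
    intro v
    have h1 : HasFDerivAt G.leftMap (fderiv ℝ G.leftMap 0) 0 :=
      (G.contDiff_leftMap.differentiable (by simp) 0).hasFDerivAt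
    have h2 := h1.clm_apply (hasFDerivAt_const v (0 : EuclideanSpace ℝ (Fin N)))
    have h3 : (G.leftMap 0).comp (0 : EuclideanSpace ℝ (Fin N) →L[ℝ] EuclideanSpace ℝ (Fin N)) +
        (fderiv ℝ G.leftMap 0).flip v = (fderiv ℝ G.leftMap 0).flip v := by
      rw [ContinuousLinearMap.comp_zero, zero_add]
    rwa [h3] at h2
  rw [VectorField.lieBracket, (h u).fderiv, (h w).fderiv, leftMap_zero]
  rfl

/-- The derivative of the adjoint action along a curve starting at the identity is the bracket.
This rests on the symmetry of the second derivative of the group law. -/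
lemma hasDerivAt_adjointMap {γ : ℝ → EuclideanSpace ℝ (Fin N)} (hγ0 : γ 0 = 0)
    {u : EuclideanSpace ℝ (Fin N)} (hγ : HasDerivAt γ u 0) (w : EuclideanSpace ℝ (Fin N)) :
    HasDerivAt (fun t => G.adjointMap (γ t) w) (G.bracket u w) 0 := by
  set m := fun p : EuclideanSpace ℝ (Fin N) × EuclideanSpace ℝ (Fin N) => G.op p.1 p.2 with hm
  have hm' : ContDiff ℝ ∞ m := G.contDiff_op
  have hD : HasFDerivAt (fderiv ℝ m) (fderiv ℝ (fderiv ℝ m) (0, 0)) (0, 0) :=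
    ((hm'.fderiv_right (m := ∞) (by simp)).differentiable (by simp) (0, 0)).hasFDerivAt
  have hsymm : IsSymmSndFDerivAt ℝ m (0, 0) :=
    hm'.contDiffAt.isSymmSndFDerivAt (by
      rw [minSmoothness_of_isRCLikeNormedField]
      exact WithTop.coe_le_coe.2 (le_top : (2 : ℕ∞) ≤ ⊤))
  have hA0 : DifferentiableAt ℝ (fun t => G.adjointMap (γ t)) 0 := by
    have h1 : DifferentiableAt ℝ G.adjointMap (γ 0) :=
      G.contDiff_adjointMap.differentiable (by simp) _
    exact h1.comp 0 hγ.differentiableAt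
  have hA := (hA0.hasDerivAt).clm_apply (hasDerivAt_const (0 : ℝ) w)
  set A' := deriv (fun t => G.adjointMap (γ t)) 0 w with hA'
  have hA2 : HasDerivAt (fun t => G.adjointMap (γ t) w) A' 0 := by
    simpa using hA
  -- the derivative of the right translations along the curve
  have hR : HasDerivAt (fun t => G.rightMap (γ t))
      ((fderiv ℝ (fderiv ℝ m) (0, 0) (0, u)).comp (ContinuousLinearMap.inl ℝ _ _)) 0 := by
    have h1 : HasFDerivAt (fderiv ℝ m) (fderiv ℝ (fderiv ℝ m) (0, 0))
        ((fun t => ((0 : EuclideanSpace ℝ (Fin N)), γ t)) 0) := by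
      simp only [hγ0]; exact hD
    have h2 := h1.comp_hasDerivAt (0 : ℝ)
      ((hasDerivAt_const (0 : ℝ) (0 : EuclideanSpace ℝ (Fin N))).prodMk hγ)
    have h3 := h2.clm_comp (hasDerivAt_const (0 : ℝ)
      (ContinuousLinearMap.inl ℝ (EuclideanSpace ℝ (Fin N)) (EuclideanSpace ℝ (Fin N))))
    have h4 : (fun t => G.rightMap (γ t)) = fun t => (fderiv ℝ m (0, γ t)).comp
        (ContinuousLinearMap.inl ℝ _ _) := funext fun t => G.rightMap_eq (γ t)
    rw [h4]
    simpa using h3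
  have hL' : ∀ v, fderiv ℝ G.leftMap 0 v =
      (fderiv ℝ (fderiv ℝ m) (0, 0) (v, 0)).comp (ContinuousLinearMap.inr ℝ _ _) := by
    intro v
    have h1 : HasFDerivAt (fun x : EuclideanSpace ℝ (Fin N) =>
        fderiv ℝ m (x, (0 : EuclideanSpace ℝ (Fin N)))) _ 0 :=
      HasFDerivAt.comp (g := fderiv ℝ m) (0 : EuclideanSpace ℝ (Fin N)) hD
        (hasFDerivAt_prodMk_left (0 : EuclideanSpace ℝ (Fin N)) (0 : EuclideanSpace ℝ (Fin N)))
    have h3 := h1.clm_comp (hasFDerivAt_const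
      (ContinuousLinearMap.inr ℝ (EuclideanSpace ℝ (Fin N)) (EuclideanSpace ℝ (Fin N)))
      (0 : EuclideanSpace ℝ (Fin N)))
    have h4 : G.leftMap = fun x => (fderiv ℝ m (x, 0)).comp
        (ContinuousLinearMap.inr ℝ _ _) := funext fun x => G.leftMap_eq x
    rw [h4, h3.fderiv]
    ext1 z
    simp
  have hL : HasDerivAt (fun t => G.leftMap (γ t) w) (fderiv ℝ G.leftMap 0 u w) 0 := by
    have h1 : HasFDerivAt G.leftMap (fderiv ℝ G.leftMap 0) (γ 0) := by
      rw [hγ0]; exact (G.contDiff_leftMap.differentiable (by simp) 0).hasFDerivAt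
    have h2 := (h1.comp_hasDerivAt (0 : ℝ) hγ).clm_apply (hasDerivAt_const (0 : ℝ) w)
    simpa using h2
  have h5 := hR.clm_apply hA2
  simp only [rightMap_adjointMap, hγ0, rightMap_zero, adjointMap_zero] at h5
  have h6 := h5.unique hL
  have h7 : fderiv ℝ G.leftMap 0 w u = fderiv ℝ (fderiv ℝ m) (0, 0) (0, u) (w, 0) := by
    rw [hL', ContinuousLinearMap.comp_apply, ContinuousLinearMap.inr_apply]
    exact hsymm (w, 0) (0, u)
  have h8 : A' = G.bracket u w := by
    rw [bracket, ← h6, h7]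
    simp
  rw [← h8]
  exact hA2

/-- The integral curve of a weight-one field through the identity. -/
lemma exists_integral_curve {i : Fin N} (hi : G.weight i = 1) :
    ∃ (γ : ℝ → EuclideanSpace ℝ (Fin N)) (ε : ℝ), 0 < ε ∧ γ 0 = 0 ∧
      HasStrictDerivAt γ (EuclideanSpace.single i 1) 0 ∧
      ∀ t, |t| < ε → G.Joins |t| 0 (γ t) := by
  have hX : ContDiff ℝ ∞ fun x => G.leftMap x (EuclideanSpace.single i 1) :=
    G.contDiff_leftMap.clm_apply contDiff_const
  obtain ⟨γ, hγ0, ε, hε, hγ⟩ := (hX.of_le (m := 1) (by exact mod_cast le_top)).contDiffAt (x := 0)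
    |>.exists_forall_mem_closedBall_exists_eq_forall_mem_Ioo_hasDerivAt₀ 0
  simp only [zero_sub, zero_add] at hγ
  have hcont : ∀ t ∈ Ioo (-ε) ε, ContinuousAt γ t := fun t ht => (hγ t ht).continuousAt
  refine ⟨γ, ε, hε, hγ0, ?_, ?_⟩
  · have h1 : ∀ᶠ t in 𝓝 (0 : ℝ), HasDerivAt γ (G.leftMap (γ t) (EuclideanSpace.single i 1)) t := by
      filter_upwards [Ioo_mem_nhds (neg_lt_zero.2 hε) hε] with t ht using hγ t ht
    have h2 : ContinuousAt (fun t => G.leftMap (γ t) (EuclideanSpace.single i 1)) 0 :=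
      hX.continuous.continuousAt.comp (hcont 0 ⟨neg_lt_zero.2 hε, hε⟩)
    have h3 := hasStrictDerivAt_of_hasDerivAt_of_continuousAt h1 h2
    simp only [hγ0, leftMap_zero] at h3
    exact h3
  · intro t ht
    have hmem : ∀ s ∈ Icc (0 : ℝ) 1, s * t ∈ Ioo (-ε) ε := by
      intro s hs
      rw [mem_Ioo, ← abs_lt, abs_mul, abs_of_nonneg hs.1]
      exact (mul_le_of_le_one_left (abs_nonneg t) hs.2).trans_lt ht
    have hd : ∀ s ∈ Icc (0 : ℝ) 1, HasDerivAt (fun s => γ (s * t))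
        (t • G.leftMap (γ (s * t)) (EuclideanSpace.single i 1)) s := by
      intro s hs
      have h4 : HasDerivAt (fun s : ℝ => s * t) t s := by
        simpa using (hasDerivAt_id s).mul_const t
      exact (hγ _ (hmem s hs)).scomp s h4
    have hcd : ContinuousOn (fun s => t • G.leftMap (γ (s * t)) (EuclideanSpace.single i 1))
        (Icc 0 1) := by
      refine ContinuousOn.const_smul (hX.continuous.comp_continuousOn fun s hs =>
        (hd s hs).continuousAt.continuousWithinAt) t
    obtain ⟨M, hM⟩ := isCompact_Icc.exists_bound_of_continuousOn hcd
    refine HPath.joins ⟨fun s => γ (s * t), fun _ j => if j = i then t else 0, M.toNNReal, ?_,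
      by simp [hγ0], by simp, fun _ j => ?_, ?_⟩
    · refine (convex_Icc 0 1).lipschitzOnWith_of_nnnorm_hasDerivWithin_le
        (fun s hs => (hd s hs).hasDerivWithinAt) fun s hs => ?_
      rw [← NNReal.coe_le_coe, coe_nnnorm]
      exact (hM s hs).trans (Real.le_coe_toNNReal M)
    · dsimp only
      split_ifs <;> simp
    · have hu : G.horizontal (fun j => if j = i then t else 0) =
          t • EuclideanSpace.single i (1 : ℝ) := by
        rw [horizontal, Finset.sum_eq_single i]
        · simp
        · intro j _ hj
          simp [hj]
        · intro h
          exact absurd (Finset.mem_filter.2 ⟨Finset.mem_univ i, hi⟩) h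
      refine Eventually.of_forall fun s hs => ?_
      rw [hu, map_smul]
      exact hd s (Ioo_subset_Icc_self hs)

lemma single_mem_attainable {i : Fin N} (hi : G.weight i = 1) :
    EuclideanSpace.single i 1 ∈ G.attainable := by
  obtain ⟨γ, ε, hε, hγ0, hγ, hJ⟩ := G.exists_integral_curve hi
  refine ⟨γ, ε, hγ0, hγ, hε, ?_⟩
  filter_upwards [Metric.ball_mem_nhds (0 : ℝ) hε] with t ht
  have ht : |t| < ε := by simpa using ht
  exact (hJ t ht).mono ht.le

/-- The bracket is a limit of difference quotients of the adjoint action, and the attainable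
velocities form a closed subspace because the dimension is finite. -/
lemma bracket_mem_attainable {i : Fin N} (hi : G.weight i = 1) {w : EuclideanSpace ℝ (Fin N)}
    (hw : w ∈ G.attainable) : G.bracket (EuclideanSpace.single i 1) w ∈ G.attainable := by
  obtain ⟨γ, ε, hε, hγ0, hγ, hJ⟩ := G.exists_integral_curve hi
  have h1 := (G.hasDerivAt_adjointMap hγ0 hγ.hasDerivAt w).tendsto_slope
  have hcl : IsClosed (G.attainable : Set (EuclideanSpace ℝ (Fin N))) :=
    G.attainable.closed_of_finiteDimensional
  refine hcl.mem_of_tendsto h1 ?_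
  filter_upwards [self_mem_nhdsWithin,
    nhdsWithin_le_nhds (Metric.ball_mem_nhds (0 : ℝ) hε)] with t ht0 ht
  have ht : |t| < ε := by simpa using ht
  have h2 := G.adjointMap_mem_attainable (abs_pos.2 ht0) (hJ t ht) hw
  refine G.attainable.smul_mem _ (G.attainable.sub_mem h2 ?_)
  simp only [hγ0, adjointMap_zero]
  exact hw

/-- The value at the identity of a field in a layer lies in the span of the corresponding basis
vectors, and determines the field. -/
lemma exists_of_mem_layerOf {j : ℕ}
    {Z : EuclideanSpace ℝ (Fin N) → EuclideanSpace ℝ (Fin N)} (hZ : Z ∈ layerOf G.op G.weight j) :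
    ∃ z ∈ Submodule.span ℝ {e | ∃ i, G.weight i = j ∧ e = EuclideanSpace.single i (1 : ℝ)},
      Z = fun x => G.leftMap x z := by
  induction hZ using Submodule.span_induction with
  | mem Z hZ =>
    obtain ⟨i, hi, rfl⟩ := hZ
    exact ⟨_, Submodule.subset_span ⟨i, hi, rfl⟩, rfl⟩
  | zero => exact ⟨0, Submodule.zero_mem _, by funext x; simp⟩
  | add Y Z _ _ hY hZ =>
    obtain ⟨y, hy, rfl⟩ := hY
    obtain ⟨z, hz, rfl⟩ := hZ
    exact ⟨y + z, Submodule.add_mem _ hy hz, by funext x; simp⟩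
  | smul a Z _ hZ =>
    obtain ⟨z, hz, rfl⟩ := hZ
    exact ⟨a • z, Submodule.smul_mem _ a hz, by funext x; simp⟩

/-- By the stratification the attainable velocities are all vectors. -/
lemma attainable_eq_top : G.attainable = ⊤ := by
  have h1 : ∀ j : ℕ, Submodule.span ℝ
      {e | ∃ i, G.weight i = j + 1 ∧ e = EuclideanSpace.single i (1 : ℝ)} ≤ G.attainable := by
    intro j
    induction j with
    | zero =>
      rw [Submodule.span_le]
      rintro _ ⟨i, hi, rfl⟩
      exact G.single_mem_attainable hi
    | succ j ih =>
      rw [Submodule.span_le]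
      rintro _ ⟨i, hi, rfl⟩
      have h2 : leftInvField G.op i ∈ layerOf G.op G.weight (j + 1 + 1) :=
        Submodule.subset_span ⟨i, hi, rfl⟩
      rw [← G.stratified (j + 1) (by omega)] at h2
      have h3 : leftInvField G.op i 0 = EuclideanSpace.single i 1 := by
        rw [leftInvField_eq, leftMap_zero]; rfl
      rw [← h3]
      generalize leftInvField G.op i = X at h2
      induction h2 using Submodule.span_induction with
      | mem W hW =>
        obtain ⟨Y, hY, Z, hZ, rfl⟩ := hW
        obtain ⟨y, hy, rfl⟩ := G.exists_of_mem_layerOf hY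
        obtain ⟨z, hz, rfl⟩ := G.exists_of_mem_layerOf hZ
        rw [lieBracket_leftMap]
        clear hY
        induction hy using Submodule.span_induction with
        | mem y hy =>
          obtain ⟨k, hk, rfl⟩ := hy
          exact G.bracket_mem_attainable hk (ih hz)
        | zero => simp [bracket]
        | add y y' _ _ hy hy' =>
          have : G.bracket (y + y') z = G.bracket y z + G.bracket y' z := by
            simp only [bracket, map_add, add_apply]; abel
          rw [this]
          exact G.attainable.add_mem hy hy'
        | smul a y _ hy =>
          have : G.bracket (a • y) z = a • G.bracket y z := by
            simp only [bracket, map_smul, smul_apply, smul_sub]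
          rw [this]
          exact G.attainable.smul_mem a hy
      | zero => exact G.attainable.zero_mem
      | add Y Z _ _ hY hZ => exact G.attainable.add_mem hY hZ
      | smul a Z _ hZ => exact G.attainable.smul_mem a hZ
  refine eq_top_iff.2 fun x _ => ?_
  have h2 : x = ∑ i, x i • EuclideanSpace.single i (1 : ℝ) := by
    have := (EuclideanSpace.basisFun (Fin N) ℝ).sum_repr x
    simpa using this.symm
  rw [h2]
  refine Submodule.sum_mem _ fun i _ => Submodule.smul_mem _ _ (h1 (G.weight i - 1) ?_)
  have := G.one_le_weight i
  exact Submodule.subset_span ⟨i, by omega, rfl⟩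

/-- **Chow's theorem**, locally: a neighbourhood of the identity is reached by horizontal curves
with bounded controls. -/
theorem exists_eventually_joins : ∃ T : ℝ, 0 < T ∧ ∀ᶠ x in 𝓝 0, G.Joins T 0 x := by
  have h1 : ∀ i : Fin N, EuclideanSpace.single i (1 : ℝ) ∈ G.attainable := fun i => by
    rw [attainable_eq_top]; trivial
  choose c T hc0 hc hT hcT using h1
  -- The product of the curves for the basis vectors is a map from `ℝᴺ` whose differential at the
  -- origin is the identity, hence open there.
  have h2 : ∀ s : Finset (Fin N), ∃ Φ : (Fin N → ℝ) → EuclideanSpace ℝ (Fin N), Φ 0 = 0 ∧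
      HasStrictFDerivAt Φ (∑ i ∈ s, (ContinuousLinearMap.proj (R := ℝ) i :
        (Fin N → ℝ) →L[ℝ] ℝ).smulRight (EuclideanSpace.single i (1 : ℝ))) 0 ∧
      ∃ S : ℝ, 0 < S ∧ ∀ᶠ t in 𝓝 0, G.Joins S 0 (Φ t) := by
    intro s
    induction s using Finset.induction_on with
    | empty =>
      refine ⟨fun _ => 0, rfl, ?_, 1, one_pos, Eventually.of_forall fun _ =>
        joins_self zero_le_one 0⟩
      rw [Finset.sum_empty]
      exact hasStrictFDerivAt_const 0 0
    | insert i s hi ih =>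
      obtain ⟨Φ, hΦ0, hΦ, S, hS, hΦS⟩ := ih
      refine ⟨fun t => G.op (c i (t i)) (Φ t), ?_, ?_, T i + S, add_pos (hT i) hS, ?_⟩
      · simp only [Pi.zero_apply, hc0, hΦ0, G.op_zero]
      · have h3 : HasStrictDerivAt (c i) (EuclideanSpace.single i (1 : ℝ))
            ((ContinuousLinearMap.proj (R := ℝ) i : (Fin N → ℝ) →L[ℝ] ℝ) 0) := hc i
        have h4 := h3.hasStrictFDerivAt.comp (0 : Fin N → ℝ)
          (ContinuousLinearMap.proj (R := ℝ) i : (Fin N → ℝ) →L[ℝ] ℝ).hasStrictFDerivAt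
        have h5 := G.hasStrictFDerivAt_op
        have h6 : (fun t : Fin N → ℝ => (c i (t i), Φ t)) 0 = (0, 0) := by
          simp only [Pi.zero_apply, hc0, hΦ0]
        rw [← h6] at h5
        have h7 := h5.comp (0 : Fin N → ℝ) (h4.prodMk hΦ)
        have h8 : (ContinuousLinearMap.fst ℝ (EuclideanSpace ℝ (Fin N)) (EuclideanSpace ℝ (Fin N)) +
            ContinuousLinearMap.snd ℝ _ _).comp
            (((ContinuousLinearMap.toSpanSingleton ℝ (EuclideanSpace.single i (1 : ℝ))).comp
              (ContinuousLinearMap.proj (R := ℝ) i : (Fin N → ℝ) →L[ℝ] ℝ)).prod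
              (∑ i ∈ s, (ContinuousLinearMap.proj (R := ℝ) i :
                (Fin N → ℝ) →L[ℝ] ℝ).smulRight (EuclideanSpace.single i (1 : ℝ)))) =
            ∑ j ∈ insert i s, (ContinuousLinearMap.proj (R := ℝ) j :
              (Fin N → ℝ) →L[ℝ] ℝ).smulRight (EuclideanSpace.single j (1 : ℝ)) := by
          rw [Finset.sum_insert hi]
          refine ContinuousLinearMap.ext fun t => ?_
          simp
        rw [← h8]
        exact h7
      · have h3 : Tendsto (fun t : Fin N → ℝ => t i) (𝓝 0) (𝓝 0) :=
          (continuous_apply i).tendsto 0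
        filter_upwards [hΦS, h3.eventually (hcT i)] with t h4 h5
        exact h5.op (hT i) hS h4
  obtain ⟨Φ, hΦ0, hΦ, S, hS, hΦS⟩ := h2 Finset.univ
  refine ⟨S, hS, ?_⟩
  have h3 := hΦ.map_nhds_eq_of_surj (LinearMap.range_eq_top.2 fun x => ⟨fun i => x i, by
    have := (EuclideanSpace.basisFun (Fin N) ℝ).sum_repr x
    simpa using this⟩)
  rw [hΦ0] at h3
  rw [← h3]
  exact hΦS

end CarnotGroup

/-! ### The control distance as a metric -/

namespace CarnotGroup

variable {N : ℕ} (G : CarnotGroup N)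

/-- **Chow's theorem**: any two points can be joined by a horizontal curve. -/
lemma exists_joins (x y : EuclideanSpace ℝ (Fin N)) : ∃ δ : ℝ, 0 < δ ∧ G.Joins δ x y := by
  obtain ⟨T, hT, hTn⟩ := G.exists_eventually_joins
  have h1 : ∀ z : EuclideanSpace ℝ (Fin N), ∃ δ : ℝ, 0 < δ ∧ G.Joins δ 0 z := by
    intro z
    obtain ⟨l, hl, hl0⟩ := (((G.dil_tendsto_zero z).eventually hTn).and self_mem_nhdsWithin).exists
    have hl0 : 0 < l := hl0
    refine ⟨l⁻¹ * T, by positivity, ?_⟩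
    have := hl.dil (inv_pos.2 hl0)
    rwa [map_zero, dil_inv_dil _ hl0.ne'] at this
  obtain ⟨δ, hδ, h⟩ := h1 (G.op (-x) y)
  refine ⟨δ, hδ, ?_⟩
  have := h.op_left x
  rwa [G.op_zero, op_neg_cancel] at this

lemma dist_lt_iff {x y : EuclideanSpace ℝ (Fin N)} {r : ℝ} :
    G.dist x y < r ↔ ∃ δ, 0 < δ ∧ δ < r ∧ G.Joins δ x y := by
  have h := csInf_lt_iff (s := {δ : ℝ | 0 < δ ∧ G.Joins δ x y}) (a := r)
    ⟨0, fun δ hδ => hδ.1.le⟩ (G.exists_joins x y)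
  refine h.trans ⟨fun ⟨δ, h, hr⟩ => ⟨δ, h.1, hr, h.2⟩, fun ⟨δ, h, hr, hJ⟩ => ⟨δ, ⟨h, hJ⟩, hr⟩⟩

lemma dist_nonneg (x y : EuclideanSpace ℝ (Fin N)) : 0 ≤ G.dist x y :=
  Real.sInf_nonneg fun _ hδ => hδ.1.le

lemma dist_self (x : EuclideanSpace ℝ (Fin N)) : G.dist x x = 0 := by
  refine le_antisymm (le_of_forall_pos_lt_add fun ε hε => ?_) (G.dist_nonneg x x)
  rw [zero_add, dist_lt_iff]
  exact ⟨ε / 2, by positivity, by linarith, joins_self (by positivity) x⟩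

lemma dist_comm (x y : EuclideanSpace ℝ (Fin N)) : G.dist x y = G.dist y x := by
  rw [CarnotGroup.dist, CarnotGroup.dist]
  congr 1
  ext δ
  exact ⟨fun h => ⟨h.1, h.2.symm⟩, fun h => ⟨h.1, h.2.symm⟩⟩

lemma dist_triangle (x y z : EuclideanSpace ℝ (Fin N)) :
    G.dist x z ≤ G.dist x y + G.dist y z := by
  refine le_of_forall_pos_lt_add fun ε hε => ?_
  obtain ⟨δ, hδ, hδ', h⟩ := G.dist_lt_iff.1 (lt_add_of_pos_right (G.dist x y) (half_pos hε))
  obtain ⟨η, hη, hη', h'⟩ := G.dist_lt_iff.1 (lt_add_of_pos_right (G.dist y z) (half_pos hε))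
  exact G.dist_lt_iff.2 ⟨δ + η, by positivity, by linarith, h.trans hδ hη h'⟩

lemma dist_op_left (z x y : EuclideanSpace ℝ (Fin N)) :
    G.dist (G.op z x) (G.op z y) = G.dist x y := by
  rw [CarnotGroup.dist, CarnotGroup.dist]
  congr 1
  ext δ
  refine ⟨fun h => ⟨h.1, ?_⟩, fun h => ⟨h.1, h.2.op_left z⟩⟩
  have := h.2.op_left (-z)
  rwa [neg_op_cancel, neg_op_cancel] at this

lemma dist_dil_lt {l : ℝ} (hl : 0 < l) {x y : EuclideanSpace ℝ (Fin N)} {r : ℝ}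
    (h : G.dist x y < r) : G.dist (G.dil l x) (G.dil l y) < l * r := by
  obtain ⟨δ, hδ, hr, hJ⟩ := G.dist_lt_iff.1 h
  exact G.dist_lt_iff.2 ⟨l * δ, by positivity, by gcongr, hJ.dil hl⟩

/-- Balls are obtained from the unit ball at the identity by dilation and translation. -/
lemma ball_eq_image (x : EuclideanSpace ℝ (Fin N)) {r : ℝ} (hr : 0 < r) :
    G.ball x r = G.op x '' (G.dil r '' G.ball 0 1) := by
  ext y
  constructor
  · intro hy
    have hy : G.dist x y < r := hy
    refine ⟨G.op (-x) y, ⟨G.dil r⁻¹ (G.op (-x) y), ?_, G.dil_dil_inv hr.ne' _⟩,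
      G.op_neg_cancel x y⟩
    rw [← G.dist_op_left (-x), G.neg_op] at hy
    have := G.dist_dil_lt (inv_pos.2 hr) hy
    rwa [map_zero, inv_mul_cancel₀ hr.ne'] at this
  · rintro ⟨_, ⟨z, hz, rfl⟩, rfl⟩
    have h1 := G.dist_dil_lt hr (show G.dist 0 z < 1 from hz)
    rw [map_zero, mul_one, ← G.dist_op_left x, G.op_zero] at h1
    exact h1

lemma ball_mem_nhds (x : EuclideanSpace ℝ (Fin N)) {r : ℝ} (hr : 0 < r) :
    G.ball x r ∈ 𝓝 x := by
  obtain ⟨T, hT, hTn⟩ := G.exists_eventually_joins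
  set l := r / (2 * T) with hl
  have hl0 : 0 < l := by positivity
  have h1 : Tendsto (fun y => G.dil l⁻¹ (G.op (-x) y)) (𝓝 x) (𝓝 0) := by
    have h2 : Continuous fun y => G.dil l⁻¹ (G.op (-x) y) :=
      (G.dil l⁻¹).continuous.comp (G.contDiff_op_left (-x)).continuous
    have := h2.tendsto x
    rwa [G.neg_op, map_zero] at this
  filter_upwards [h1.eventually hTn] with y hy
  have h2 := (hy.dil hl0).op_left x
  rw [dil_dil_inv _ hl0.ne', op_neg_cancel, map_zero, G.op_zero] at h2
  refine G.dist_lt_iff.2 ⟨l * T, by positivity, ?_, h2⟩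
  rw [hl, div_mul_eq_mul_div, div_lt_iff₀ (by positivity)]
  nlinarith

/-- Small balls around the identity lie in small Euclidean balls. -/
lemma exists_norm_lt {ε : ℝ} (hε : 0 < ε) : ∃ r : ℝ, 0 < r ∧ ∀ y, G.dist 0 y < r → ‖y‖ < ε := by
  obtain ⟨M, hM⟩ := (isCompact_closedBall (0 : EuclideanSpace ℝ (Fin N)) 1
    ).exists_bound_of_continuousOn G.contDiff_leftMap.continuous.continuousOn
  have hM0 : 0 ≤ M := (norm_nonneg _).trans (hM 0 (by simp))
  refine ⟨min 1 ε / (M * N + 1), by positivity, fun y hy => ?_⟩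
  obtain ⟨δ, hδ, hr, hJ⟩ := G.dist_lt_iff.1 hy
  rw [lt_div_iff₀ (by positivity)] at hr
  have h1 : M * (N * δ) < min 1 ε := by
    calc M * (N * δ) = δ * (M * N) := by ring
      _ ≤ δ * (M * N + 1) := by gcongr; linarith
      _ < _ := hr
  exact (hJ.norm_le hM (h1.trans_le (min_le_left _ _))).trans_lt (h1.trans_le (min_le_right _ _))

lemma exists_ball_subset {x : EuclideanSpace ℝ (Fin N)} {U : Set (EuclideanSpace ℝ (Fin N))}
    (hU : U ∈ 𝓝 x) : ∃ r : ℝ, 0 < r ∧ G.ball x r ⊆ U := by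
  have h1 : G.op x ⁻¹' U ∈ 𝓝 0 := by
    refine (G.contDiff_op_left x).continuous.continuousAt.preimage_mem_nhds ?_
    rwa [G.op_zero]
  obtain ⟨ε, hε, hεU⟩ := Metric.mem_nhds_iff.1 h1
  obtain ⟨r, hr, hrε⟩ := G.exists_norm_lt hε
  refine ⟨r, hr, fun y hy => ?_⟩
  have hy : G.dist x y < r := hy
  rw [← G.dist_op_left (-x), G.neg_op] at hy
  have h2 : G.op x (G.op (-x) y) ∈ U := hεU (by simpa using hrε _ hy)
  rwa [op_neg_cancel] at h2

lemma eq_of_dist_eq_zero {x y : EuclideanSpace ℝ (Fin N)} (h : G.dist x y = 0) : x = y := by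
  by_contra hne
  obtain ⟨r, hr, hU⟩ := G.exists_ball_subset (isOpen_ne.mem_nhds hne)
  exact hU (show G.dist x y < r by rwa [h]) rfl

/-- The underlying space of the group, to be endowed with the control distance. -/
def Carrier (_ : CarnotGroup N) : Type := EuclideanSpace ℝ (Fin N)

instance : TopologicalSpace G.Carrier :=
  inferInstanceAs (TopologicalSpace (EuclideanSpace ℝ (Fin N)))

instance : MeasurableSpace G.Carrier := inferInstanceAs (MeasurableSpace (EuclideanSpace ℝ (Fin N)))

/-- The control distance, with the topology it defines. -/
@[reducible] noncomputable def controlMetric : MetricSpace G.Carrier where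
  dist := G.dist
  dist_self := G.dist_self
  dist_comm := G.dist_comm
  dist_triangle := G.dist_triangle
  eq_of_dist_eq_zero := G.eq_of_dist_eq_zero

/-- The control distance induces the Euclidean topology. -/
lemma topology_eq : (inferInstance : TopologicalSpace G.Carrier) =
    G.controlMetric.toPseudoMetricSpace.toUniformSpace.toTopologicalSpace := by
  refine TopologicalSpace.ext_nhds fun x => ?_
  refine Filter.ext fun U => ?_
  have hb : ∀ r, @Metric.ball _ G.controlMetric.toPseudoMetricSpace x r = G.ball x r := by
    intro r
    ext y
    exact iff_of_eq (congrArg (· < r) (G.dist_comm y x))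
  rw [(@Metric.nhds_basis_ball _ G.controlMetric.toPseudoMetricSpace x).mem_iff]
  simp only [hb]
  exact ⟨fun h => G.exists_ball_subset h,
    fun ⟨r, hr, h⟩ => mem_of_superset (G.ball_mem_nhds x hr) h⟩

noncomputable instance : MetricSpace G.Carrier := G.controlMetric.replaceTopology G.topology_eq

instance : BorelSpace G.Carrier := inferInstanceAs (BorelSpace (EuclideanSpace ℝ (Fin N)))

instance : SecondCountableTopology G.Carrier :=
  inferInstanceAs (SecondCountableTopology (EuclideanSpace ℝ (Fin N)))

/-- Lebesgue measure, on the space with the control distance. -/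
noncomputable def vol : Measure G.Carrier := (volume : Measure (EuclideanSpace ℝ (Fin N)))

instance : SFinite G.vol :=
  inferInstanceAs (SFinite (volume : Measure (EuclideanSpace ℝ (Fin N))))

lemma metric_ball (x : G.Carrier) (r : ℝ) : Metric.ball x r = G.ball x r := by
  ext y
  exact iff_of_eq (congrArg (· < r) (G.dist_comm y x))

lemma isOpen_ball (x : EuclideanSpace ℝ (Fin N)) (r : ℝ) : IsOpen (G.ball x r) := by
  have h : IsOpen (Metric.ball (α := G.Carrier) x r) := Metric.isOpen_ball
  exact G.metric_ball x r ▸ h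

lemma measurableSet_ball (x : EuclideanSpace ℝ (Fin N)) (r : ℝ) : MeasurableSet (G.ball x r) :=
  (G.isOpen_ball x r).measurableSet

lemma volume_ball (x : EuclideanSpace ℝ (Fin N)) {r : ℝ} (hr : 0 < r) :
    volume (G.ball x r) = ENNReal.ofReal (r ^ G.homDim) * volume (G.ball 0 1) := by
  have h1 : G.dil r '' G.ball 0 1 = G.ball 0 r := by
    rw [G.ball_eq_image 0 hr]
    have : G.op 0 = id := funext G.zero_op
    rw [this, image_id]
  rw [G.ball_eq_image x hr, G.volume_image_op x (by rw [h1]; exact G.measurableSet_ball 0 r),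
    G.volume_image_dil hr]

lemma volume_unitBall_pos : 0 < volume (G.ball 0 1) :=
  (G.isOpen_ball 0 1).measure_pos _ ⟨0, by
    change G.dist 0 0 < 1
    rw [G.dist_self]; exact one_pos⟩

lemma volume_unitBall_lt_top : volume (G.ball 0 1) < ⊤ := by
  obtain ⟨r, hr, h⟩ := G.exists_norm_lt one_pos
  have h1 : volume (G.ball 0 r) < ⊤ := by
    refine (measure_mono fun y hy => ?_).trans_lt
      (measure_ball_lt_top (x := (0 : EuclideanSpace ℝ (Fin N))) (r := 1))
    simpa using h y hy
  rw [G.volume_ball 0 hr] at h1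
  by_contra hcon
  rw [not_lt_top_iff.1 hcon, ENNReal.mul_top] at h1
  · exact lt_irrefl _ h1
  · rw [Ne, ENNReal.ofReal_eq_zero, not_le]; positivity

lemma one_le_homDim (hN : 0 < N) : 1 ≤ G.homDim :=
  (G.one_le_weight ⟨0, hN⟩).trans
    (Finset.single_le_sum (f := G.weight) (fun _ _ => Nat.zero_le _) (Finset.mem_univ _))

lemma ballGrowth (hN : 0 < N) : BallGrowth G.vol G.homDim (volume (G.ball 0 1)).toReal where
  one_le := G.one_le_homDim hN
  pos := ENNReal.toReal_pos G.volume_unitBall_pos.ne' G.volume_unitBall_lt_top.ne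
  ball x r hr := by
    rw [metric_ball]
    refine (G.volume_ball x hr).trans ?_
    rw [mul_comm, ENNReal.ofReal_mul ENNReal.toReal_nonneg,
      ENNReal.ofReal_toReal G.volume_unitBall_lt_top.ne]

lemma IsSingularKernel.standardKernel {G : CarnotGroup N} (hN : 0 < N)
    {k : EuclideanSpace ℝ (Fin N) → EuclideanSpace ℝ (Fin N) → ℝ} {A B : ℝ}
    (hk : G.IsSingularKernel k A B) :
    StandardKernel (X := G.Carrier) G.vol G.homDim k A B := by
  set e : EuclideanSpace ℝ (Fin N) := EuclideanSpace.single ⟨0, hN⟩ 1 with he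
  have he0 : (0 : EuclideanSpace ℝ (Fin N)) ≠ e := by
    intro h
    have := congrArg (fun x : EuclideanSpace ℝ (Fin N) => x ⟨0, hN⟩) h
    simp [he] at this
  have hpos : ∀ z : EuclideanSpace ℝ (Fin N), 0 ≠ z → 0 < G.dist 0 z := fun z hz =>
    (G.dist_nonneg 0 z).lt_of_ne fun h => hz (G.eq_of_dist_eq_zero h.symm)
  have hsm1 : ∀ x₀ x y, 2 * G.dist x₀ x ≤ G.dist x₀ y →
      |k x y - k x₀ y| ≤ B * (G.dist x₀ x / G.dist x₀ y ^ (G.homDim + 1)) := fun x₀ x y h =>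
    (le_add_of_nonneg_right (abs_nonneg _)).trans (hk.smooth x₀ x y h)
  refine ⟨?_, ?_, hk.size, hsm1, fun x₀ x y h =>
    (le_add_of_nonneg_left (abs_nonneg _)).trans (hk.smooth x₀ x y h),
    fun x r₁ r₂ h₁ h₂ => (hk.cancel x r₁ r₂ h₁ h₂).1,
    fun x r₁ r₂ h₁ h₂ => (hk.cancel x r₁ r₂ h₁ h₂).2⟩
  · have h1 := (abs_nonneg _).trans (hk.size 0 e he0)
    have h2 : 0 < G.dist 0 e ^ G.homDim := pow_pos (hpos e he0) _
    have h3 := mul_nonneg h1 h2.le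
    rwa [div_mul_cancel₀ _ h2.ne'] at h3
  · set z := G.dil (1 / 2) e with hz
    have hz0 : (0 : EuclideanSpace ℝ (Fin N)) ≠ z := by
      intro h
      have := G.dil_inv_dil (by norm_num : (1 / 2 : ℝ) ≠ 0) e
      rw [← hz, ← h, map_zero] at this
      exact he0 this
    have hle : 2 * G.dist 0 z ≤ G.dist 0 e := by
      refine le_of_forall_gt_imp_ge_of_dense fun r hr => ?_
      have h1 := G.dist_dil_lt (by norm_num : (0 : ℝ) < 1 / 2) hr
      rw [map_zero] at h1
      linarith
    have h1 := (abs_nonneg _).trans (hsm1 0 z e hle)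
    have h2 : 0 < G.dist 0 z / G.dist 0 e ^ (G.homDim + 1) :=
      div_pos (hpos z hz0) (pow_pos (hpos e he0) _)
    exact nonneg_of_mul_nonneg_left h1 h2

end CarnotGroup

/-! ### Functions supported in a ball -/

section Localisation

open scoped ENNReal NNReal

variable {X : Type*} [MetricSpace X] [MeasurableSpace X] [BorelSpace X] [SecondCountableTopology X]
  {μ : Measure X} {Q : ℕ} {v : ℝ}

lemma StandardKernel.integrableOn_tail {k : X → X → ℝ} {A B : ℝ} (hk : StandardKernel μ Q k A B)
    {f : X → ℝ} (hf : Integrable f μ) (x : X) {ε : ℝ} (hε : 0 < ε) :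
    IntegrableOn (fun y => k x y * f y) {y | ε < dist x y} μ := by
  have hA := hk.nonneg_size
  have hms : MeasurableSet {y | ε < dist x y} :=
    (isOpen_lt continuous_const (continuous_const.dist continuous_id)).measurableSet
  have hne : ∀ y ∈ {y | ε < dist x y}, x ≠ y := by
    rintro y hy rfl
    have hy : ε < dist x x := hy
    rw [dist_self] at hy
    exact absurd hy (not_lt.2 hε.le)
  have hc : ContinuousOn (k x) {y | ε < dist x y} :=
    hk.continuousOn.comp (f := fun y => (x, y)) (by fun_prop) fun y hy => hne y hy
  refine Integrable.bdd_mul (c := A / ε ^ Q) hf.integrableOn (hc.aestronglyMeasurable hms) ?_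
  refine (ae_restrict_iff' hms).2 (Eventually.of_forall fun y hy => ?_)
  have hy' : ε < dist x y := hy
  rw [Real.norm_eq_abs]
  refine (hk.size x y (hne y hy)).trans ?_
  gcongr

/-- A function that vanishes off `B(z, R)` and has small mean on `B(z, 2 R) \ B(z, R)`, as it does
when its oscillation on `B(z, 2 R)` is small, has small integral. -/
lemma BallGrowth.lintegral_le_of_osc (hμ : BallGrowth μ Q v) {f : X → ℝ}
    (hf : AEStronglyMeasurable f μ) {z : X} {R a c : ℝ} (hR : 0 < R) (ha : 0 ≤ a)
    (hsupp : ∀ᵐ y ∂μ, y ∉ Metric.ball z R → f y = 0)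
    (hc : ∫⁻ y in Metric.ball z (2 * R), ‖f y - c‖ₑ ∂μ ≤ ENNReal.ofReal a) :
    ∫⁻ y, ‖f y‖ₑ ∂μ ≤ ENNReal.ofReal (2 * a) := by
  have hv := hμ.pos
  have hsub : Metric.ball z R ⊆ Metric.ball z (2 * R) := Metric.ball_subset_ball (by linarith)
  have h1 : |c| * (v * R ^ Q) ≤ a := by
    have h2 : μ (Metric.ball z (2 * R) \ Metric.ball z R) =
        ENNReal.ofReal (v * (2 * R) ^ Q - v * R ^ Q) := by
      rw [measure_sdiff hsub measurableSet_ball.nullMeasurableSet (hμ.ball_ne_top z R),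
        hμ.ball z _ (by positivity), hμ.ball z R hR, ENNReal.ofReal_sub _ (by positivity)]
    have h3 : ENNReal.ofReal (|c| * (v * (2 * R) ^ Q - v * R ^ Q)) ≤ ENNReal.ofReal a := by
      calc ENNReal.ofReal (|c| * (v * (2 * R) ^ Q - v * R ^ Q))
          = ∫⁻ _ in Metric.ball z (2 * R) \ Metric.ball z R, ‖c‖ₑ ∂μ := by
            rw [setLIntegral_const, h2, Real.enorm_eq_ofReal_abs,
              ← ENNReal.ofReal_mul (abs_nonneg _)]
        _ = ∫⁻ y in Metric.ball z (2 * R) \ Metric.ball z R, ‖f y - c‖ₑ ∂μ := by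
            refine setLIntegral_congr_fun_ae (measurableSet_ball.diff measurableSet_ball) ?_
            filter_upwards [hsupp] with y hy hy'
            rw [hy hy'.2, zero_sub, enorm_neg]
        _ ≤ _ := (lintegral_mono_set sdiff_subset).trans hc
    rw [ENNReal.ofReal_le_ofReal_iff ha] at h3
    refine le_trans ?_ h3
    have h4 : (2 : ℝ) ≤ 2 ^ Q := by
      calc (2 : ℝ) = 2 ^ 1 := by norm_num
        _ ≤ 2 ^ Q := pow_le_pow_right₀ one_le_two hμ.one_le
    have h5 : 0 < v * R ^ Q := by positivity
    rw [mul_pow]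
    refine mul_le_mul_of_nonneg_left ?_ (abs_nonneg c)
    nlinarith
  calc ∫⁻ y, ‖f y‖ₑ ∂μ = ∫⁻ y in Metric.ball z R, ‖f y‖ₑ ∂μ := by
        rw [← lintegral_indicator measurableSet_ball]
        refine lintegral_congr_ae ?_
        filter_upwards [hsupp] with y hy
        by_cases h : y ∈ Metric.ball z R
        · rw [indicator_of_mem h]
        · rw [indicator_of_notMem h, hy h, enorm_zero]
    _ ≤ ∫⁻ y in Metric.ball z R, (‖f y - c‖ₑ + ‖c‖ₑ) ∂μ := by
        refine lintegral_mono fun y => ?_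
        calc ‖f y‖ₑ = ‖(f y - c) + c‖ₑ := by rw [sub_add_cancel]
          _ ≤ _ := enorm_add_le _ _
    _ = ∫⁻ y in Metric.ball z R, ‖f y - c‖ₑ ∂μ + ∫⁻ _ in Metric.ball z R, ‖c‖ₑ ∂μ :=
        lintegral_add_left' ((hf.sub aestronglyMeasurable_const).enorm.restrict) _
    _ ≤ ENNReal.ofReal a + ENNReal.ofReal a := by
        refine add_le_add ((lintegral_mono_set hsub).trans hc) ?_
        rw [setLIntegral_const, hμ.ball z R hR, Real.enorm_eq_ofReal_abs,
          ← ENNReal.ofReal_mul (abs_nonneg _)]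
        exact ENNReal.ofReal_le_ofReal h1
    _ = _ := by rw [← ENNReal.ofReal_add ha ha, two_mul]

/-- For functions supported in `B(z, R)`, oscillation bounds on the balls with centre in `B(z, R)`
and radius at most `3 R` imply oscillation bounds on all balls. -/
lemma BallGrowth.exists_osc_of_local (hμ : BallGrowth μ Q v) {f : X → ℝ}
    (hf : AEStronglyMeasurable f μ) {z : X} {R : ℝ} (hR : 0 < R)
    (hsupp : ∀ᵐ y ∂μ, y ∉ Metric.ball z R → f y = 0) {M : ℝ} {ψ : ℝ → ℝ} (hM : 0 < M)
    (hψ0 : ∀ ρ, 0 < ρ → 0 < ψ ρ) (hψm : ∀ s t, 0 < s → s ≤ t → ψ s ≤ ψ t)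
    (hψd : ∀ ρ, 0 < ρ → ψ (2 * ρ) ≤ 7 / 4 * ψ ρ)
    (hosc : ∀ x ∈ Metric.ball z R, ∀ ρ, 0 < ρ → ρ ≤ 3 * R →
      ∃ c, ∫⁻ y in Metric.ball x ρ, ‖f y - c‖ₑ ∂μ ≤ ENNReal.ofReal (M * ψ ρ * (v * ρ ^ Q))) :
    Integrable f μ ∧ ∀ x ρ, 0 < ρ → ∃ c, ∫⁻ y in Metric.ball x ρ, ‖f y - c‖ₑ ∂μ ≤
      ENNReal.ofReal (4 * 2 ^ Q * M * ψ ρ * (v * ρ ^ Q)) := by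
  have hv := hμ.pos
  obtain ⟨c₀, hc₀⟩ := hosc z (Metric.mem_ball_self hR) (2 * R) (by positivity) (by linarith)
  have hψ2R := hψ0 (2 * R) (by positivity)
  have hI := hμ.lintegral_le_of_osc hf hR (by positivity) hsupp hc₀
  refine ⟨⟨hf, hI.trans_lt ENNReal.ofReal_lt_top⟩, fun x ρ hρ => ?_⟩
  have hψρ := hψ0 ρ hρ
  -- A small ball either misses `B(z, R)`, where the oscillation is zero, or lies in a ball of twice
  -- the radius centred in `B(z, R)`. On a large ball the integral of `|f|` is a sufficient bound.
  rcases le_total (2 * ρ) (3 * R) with hsmall | hlarge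
  · by_cases hdisj : ∃ x', x' ∈ Metric.ball x ρ ∧ x' ∈ Metric.ball z R
    · obtain ⟨x', hx', hx'z⟩ := hdisj
      obtain ⟨c, hc⟩ := hosc x' hx'z (2 * ρ) (by positivity) hsmall
      refine ⟨c, (lintegral_mono_set ?_).trans (hc.trans (ENNReal.ofReal_le_ofReal ?_))⟩
      · refine Metric.ball_subset_ball' ?_
        rw [Metric.mem_ball, dist_comm] at hx'
        linarith
      · calc M * ψ (2 * ρ) * (v * (2 * ρ) ^ Q) ≤ M * (7 / 4 * ψ ρ) * (v * (2 * ρ) ^ Q) := by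
              have := hψd ρ hρ
              gcongr
          _ = 7 / 4 * (2 ^ Q * M * ψ ρ * (v * ρ ^ Q)) := by rw [mul_pow]; ring
          _ ≤ 4 * (2 ^ Q * M * ψ ρ * (v * ρ ^ Q)) := by gcongr; norm_num
          _ = _ := by ring
    · refine ⟨0, ?_⟩
      have h0 : ∫⁻ y in Metric.ball x ρ, ‖f y - 0‖ₑ ∂μ = ∫⁻ y in Metric.ball x ρ, 0 ∂μ := by
        refine setLIntegral_congr_fun_ae measurableSet_ball ?_
        filter_upwards [hsupp] with y hy hy'
        rw [hy fun h => hdisj ⟨y, hy', h⟩]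
        simp
      rw [h0, lintegral_zero]
      exact zero_le
  · refine ⟨0, ?_⟩
    simp only [sub_zero]
    refine (setLIntegral_le_lintegral _ _).trans (hI.trans (ENNReal.ofReal_le_ofReal ?_))
    have hRρ : R ≤ ρ := by linarith
    calc 2 * (M * ψ (2 * R) * (v * (2 * R) ^ Q))
        ≤ 2 * (M * (7 / 4 * ψ ρ) * (v * (2 * ρ) ^ Q)) := by
          have h1 := hψd R hR
          have h2 := hψm R ρ hR hRρ
          have h3 : ψ (2 * R) ≤ 7 / 4 * ψ ρ := by linarith
          gcongr
      _ = 7 / 2 * (2 ^ Q * M * ψ ρ * (v * ρ ^ Q)) := by rw [mul_pow]; ring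
      _ ≤ 4 * (2 ^ Q * M * ψ ρ * (v * ρ ^ Q)) := by gcongr; norm_num
      _ = _ := by ring

end Localisation

/-! ### The weight of the logarithmic oscillation -/

section LogWeight

open Real

/-- The bound `1 / (1 + log⁺ (R / ρ))` for the oscillation at scale `ρ`. -/
noncomputable def logWeight (R ρ : ℝ) : ℝ := (1 + log⁺ (R / ρ))⁻¹

lemma logWeight_pos (R ρ : ℝ) : 0 < logWeight R ρ := by
  have := posLog_nonneg (x := R / ρ)
  unfold logWeight
  positivity

lemma logWeight_mono {R s t : ℝ} (hR : 0 ≤ R) (hs : 0 < s) (hst : s ≤ t) :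
    logWeight R s ≤ logWeight R t := by
  have h0 := posLog_nonneg (x := R / t)
  have h1 : log⁺ (R / t) ≤ log⁺ (R / s) :=
    posLog_le_posLog (div_nonneg hR (hs.le.trans hst)) (by gcongr)
  unfold logWeight
  gcongr

/-- The weight is slowly varying: `log⁺ (R / ρ) ≤ log 2 + log⁺ (R / (2 ρ))` and `log 2 < 3 / 4`. -/
lemma logWeight_two_mul_le {R ρ : ℝ} (hρ : 0 < ρ) :
    logWeight R (2 * ρ) ≤ 7 / 4 * logWeight R ρ := by
  have h0 := posLog_nonneg (x := R / (2 * ρ))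
  have h1 := posLog_nonneg (x := R / ρ)
  have h2 : log⁺ (R / ρ) ≤ log⁺ 2 + log⁺ (R / (2 * ρ)) := by
    refine le_trans (le_of_eq ?_) posLog_mul
    congr 1
    field_simp
  have h3 : log⁺ (2 : ℝ) = log 2 := posLog_eq_log (by norm_num)
  have h4 := Real.log_two_lt_d9
  unfold logWeight
  rw [← div_eq_mul_inv, inv_eq_one_div, div_le_div_iff₀ (by positivity) (by positivity)]
  linarith

/-- From the oscillation at scale `r` to the weight in the logarithmic oscillation over a ball of
diameter `D ≤ 6 R`. For `D = 0` the logarithm has the junk value `log 0 = 0`. -/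
lemma one_add_log_div_mul_logWeight_le {D R r : ℝ} (hD : 0 ≤ D) (hDR : D ≤ 6 * R) (hR : 0 < R)
    (hr : 0 < r) (hrR : r ≤ 6 * R) : (1 + log (D / r)) * logWeight R r ≤ 6 := by
  have h1 := posLog_nonneg (x := R / r)
  have h2 : log (D / r) ≤ log (6 * R / r) := by
    rcases hD.eq_or_lt with h | h
    · rw [← h, zero_div, log_zero]
      exact log_nonneg ((one_le_div hr).2 hrR)
    · exact log_le_log (by positivity) (by gcongr)
  have h3 : log (6 * R / r) = log 6 + log (R / r) := by
    rw [mul_div_assoc, log_mul (by norm_num) (by positivity)]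
  have h4 : log (R / r) ≤ log⁺ (R / r) := by
    rw [posLog_apply]; exact le_max_right _ _
  have h5 := Real.log_le_sub_one_of_pos (by norm_num : (0 : ℝ) < 6)
  unfold logWeight
  rw [← div_eq_mul_inv, div_le_iff₀ (by positivity)]
  linarith

lemma inv_logWeight_le {D R r : ℝ} (hR : 0 < R) (hr : 0 < r) (hD : 4 * R ≤ D) (hrR : r ≤ 3 * R) :
    (logWeight R r)⁻¹ ≤ 1 + log (D / r) := by
  have h1 : 1 ≤ D / r := (one_le_div hr).2 (by linarith)
  have h2 : log⁺ (R / r) ≤ log⁺ (D / r) := posLog_le_posLog (by positivity) (by gcongr; linarith)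
  have h3 : log⁺ (D / r) = log (D / r) := posLog_eq_log (h1.trans (le_abs_self _))
  unfold logWeight
  rw [inv_inv]
  linarith

end LogWeight

/-! ### Singular integrals on Carnot groups -/

namespace CarnotGroup

variable {N : ℕ} (G : CarnotGroup N)

lemma meanOsc_congr {f g : EuclideanSpace ℝ (Fin N) → ℝ} (h : f =ᵐ[volume] g)
    (S : Set (EuclideanSpace ℝ (Fin N))) : meanOsc f S = meanOsc g S := by
  have h' := ae_restrict_of_ae (s := S) h
  have h1 : ⨍ z in S, f z = ⨍ z in S, g z := average_congr h'
  rw [meanOsc, meanOsc, h1]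
  congr 1
  refine lintegral_congr_ae ?_
  filter_upwards [h'] with y hy
  rw [hy]

/-- The mean oscillation is at most twice the mean distance to any constant. -/
lemma meanOsc_le_of_lintegral_le {f : EuclideanSpace ℝ (Fin N) → ℝ}
    {S : Set (EuclideanSpace ℝ (Fin N))} (hS0 : volume S ≠ 0) (hS : volume S ≠ ⊤)
    (hf : IntegrableOn f S) {c m : ℝ} (hm : 0 ≤ m)
    (hc : ∫⁻ y in S, ‖f y - c‖ₑ ≤ ENNReal.ofReal m * volume S) :
    meanOsc f S ≤ ENNReal.ofReal (2 * m) := by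
  have hfin : IsFiniteMeasure (volume.restrict S) := ⟨by simpa using hS.lt_top⟩
  have hreal : 0 < volume.real S := ENNReal.toReal_pos hS0 hS
  have h1 : ‖c - ⨍ z in S, f z‖ₑ ≤ ENNReal.ofReal m := by
    have h2 : c - ⨍ z in S, f z = -((volume.real S)⁻¹ * ∫ y in S, (f y - c)) := by
      rw [integral_sub hf (integrable_const c), setAverage_eq, integral_const, smul_eq_mul,
        smul_eq_mul, measureReal_restrict_apply_univ]
      field_simp
      ring
    rw [h2, enorm_neg, enorm_mul, Real.enorm_eq_ofReal (by positivity)]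
    calc ENNReal.ofReal (volume.real S)⁻¹ * ‖∫ y in S, (f y - c)‖ₑ
        ≤ ENNReal.ofReal (volume.real S)⁻¹ * (ENNReal.ofReal m * volume S) := by
          gcongr
          exact (enorm_integral_le_lintegral_enorm _).trans hc
      _ = ENNReal.ofReal m := by
          rw [ENNReal.ofReal_inv_of_pos hreal, Measure.real, ENNReal.ofReal_toReal hS, mul_comm,
            mul_assoc, ENNReal.mul_inv_cancel hS0 hS, mul_one]
  calc meanOsc f S ≤ (volume S)⁻¹ * ∫⁻ y in S, (‖f y - c‖ₑ + ‖c - ⨍ z in S, f z‖ₑ) := by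
        rw [meanOsc]
        gcongr with y
        rw [← sub_add_sub_cancel (f y) c]
        exact enorm_add_le _ _
    _ ≤ (volume S)⁻¹ * (ENNReal.ofReal m * volume S + ENNReal.ofReal m * volume S) := by
        rw [lintegral_add_right _ measurable_const, setLIntegral_const]
        gcongr
    _ = ENNReal.ofReal (2 * m) := by
        rw [← add_mul, ← ENNReal.ofReal_add hm hm, ← two_mul, mul_comm, mul_assoc,
          ENNReal.mul_inv_cancel hS0 hS, mul_one]

lemma volume_ball_eq (x : EuclideanSpace ℝ (Fin N)) {r : ℝ} (hr : 0 < r) :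
    volume (G.ball x r) =
      ENNReal.ofReal ((volume (G.ball 0 1)).toReal * r ^ G.homDim) := by
  rw [G.volume_ball x hr, mul_comm, ENNReal.ofReal_mul ENNReal.toReal_nonneg,
    ENNReal.ofReal_toReal G.volume_unitBall_lt_top.ne]

lemma ball_subset_ball {x y : EuclideanSpace ℝ (Fin N)} {r s : ℝ} (h : r + G.dist x y ≤ s) :
    G.ball x r ⊆ G.ball y s := by
  intro z hz
  have hz : G.dist x z < r := hz
  have := G.dist_triangle y x z
  rw [G.dist_comm y x] at this
  exact (by linarith : G.dist y z < s)

/-- The volume of a ball determines its radius. -/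
lemma radius_le_of_ball_subset (hN : 0 < N) {x y : EuclideanSpace ℝ (Fin N)} {r s : ℝ}
    (hr : 0 < r) (hs : 0 < s) (h : G.ball x r ⊆ {z | G.dist y z ≤ s}) : r ≤ s := by
  by_contra! hlt
  have hv := (G.ballGrowth hN).pos
  obtain ⟨t, ht1, ht2⟩ := exists_between hlt
  have h1 : G.ball x r ⊆ G.ball y t := fun z hz => (h hz).trans_lt ht1
  have h2 := measure_mono (μ := volume) h1
  have ht0 := hs.trans ht1
  rw [G.volume_ball_eq x hr, G.volume_ball_eq y ht0,
    ENNReal.ofReal_le_ofReal_iff (by positivity)] at h2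
  have h3 := le_of_mul_le_mul_left h2 hv
  exact absurd (le_of_pow_le_pow_left₀ (by have := G.one_le_homDim hN; omega) ht0.le h3)
    (not_le.2 ht2)

lemma dist_le_of_mem_ball {x y z : EuclideanSpace ℝ (Fin N)} {r : ℝ} (hy : y ∈ G.ball x r)
    (hz : z ∈ G.ball x r) : G.dist y z ≤ 2 * r := by
  have hy : G.dist x y < r := hy
  have hz : G.dist x z < r := hz
  have := G.dist_triangle y x z
  rw [G.dist_comm y x] at this
  linarith

lemma diam_ball_le (x : EuclideanSpace ℝ (Fin N)) {r : ℝ} (hr : 0 < r) :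
    G.diam (G.ball x r) ≤ 2 * r := by
  refine Real.sSup_le ?_ (by positivity)
  rintro t ⟨y, hy, z, hz, rfl⟩
  exact G.dist_le_of_mem_ball hy hz

lemma diam_nonneg (S : Set (EuclideanSpace ℝ (Fin N))) : 0 ≤ G.diam S := by
  refine Real.sSup_nonneg ?_
  rintro t ⟨y, _, z, _, rfl⟩
  exact G.dist_nonneg y z

lemma le_diam_ball (hN : 0 < N) (x : EuclideanSpace ℝ (Fin N)) {r : ℝ} (hr : 0 < r) :
    r ≤ G.diam (G.ball x r) := by
  refine le_of_forall_pos_le_add fun ε hε => ?_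
  have h0 := G.diam_nonneg (G.ball x r)
  refine G.radius_le_of_ball_subset hN hr (by positivity) (x := x) (y := x) fun z hz => ?_
  have hx : x ∈ G.ball x r := by
    change G.dist x x < r
    rwa [G.dist_self]
  have hb : BddAbove {t : ℝ | ∃ y ∈ G.ball x r, ∃ z ∈ G.ball x r, t = G.dist y z} := by
    refine ⟨2 * r, ?_⟩
    rintro t ⟨y, hy, z, hz, rfl⟩
    exact G.dist_le_of_mem_ball hy hz
  exact (le_csSup hb ⟨x, hx, z, hz, rfl⟩).trans (le_add_of_nonneg_right hε.le)

lemma lintegral_metric_ball (h : EuclideanSpace ℝ (Fin N) → ENNReal) (x : EuclideanSpace ℝ (Fin N))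
    (r : ℝ) : ∫⁻ y in Metric.ball (α := G.Carrier) x r, h y ∂G.vol = ∫⁻ y in G.ball x r, h y :=
  congrArg (fun S : Set G.Carrier => ∫⁻ y in S, h y ∂G.vol) (G.metric_ball x r)

lemma mem_metric_ball {x y : EuclideanSpace ℝ (Fin N)} {r : ℝ} :
    y ∈ Metric.ball (α := G.Carrier) x r ↔ y ∈ G.ball x r :=
  Set.ext_iff.1 (G.metric_ball x r) y

/-- Singular integrals of functions supported in a ball of radius `R`: bounds `M ψ(r)` for the mean
oscillation over balls of radius `r ≤ 3 R` with centres in the support are inherited by the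
singular integral, over all balls. -/
theorem exists_meanOsc_singularIntegral_le (hN : 0 < N) (A B : ℝ) :
    ∃ C : ℝ, 0 ≤ C ∧ ∀ k, G.IsSingularKernel k A B →
      ∀ (z : EuclideanSpace ℝ (Fin N)) (R : ℝ), 0 < R → ∀ f : EuclideanSpace ℝ (Fin N) → ℝ,
      (∀ᵐ y, y ∉ G.ball z R → f y = 0) → LocallyIntegrableOn f (G.ball z (4 * R)) →
      ∀ (M : ℝ) (ψ : ℝ → ℝ), 0 < M → (∀ ρ, 0 < ρ → 0 < ψ ρ) →
      (∀ s t, 0 < s → s ≤ t → ψ s ≤ ψ t) → (∀ ρ, 0 < ρ → ψ (2 * ρ) ≤ 7 / 4 * ψ ρ) →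
      (∀ x ∈ G.ball z R, ∀ ρ, 0 < ρ → ρ ≤ 3 * R →
        meanOsc f (G.ball x ρ) ≤ ENNReal.ofReal (M * ψ ρ)) →
      (∀ᵐ x, G.HasPV k f x (G.singularIntegral k f x)) ∧
      LocallyIntegrable (G.singularIntegral k f) ∧
      ∀ x ρ, 0 < ρ → meanOsc (G.singularIntegral k f) (G.ball x ρ) ≤
        ENNReal.ofReal (C * M * ψ ρ) := by
  have hμ := G.ballGrowth hN
  obtain ⟨C, hC, H⟩ := hμ.exists_osc_bound A B
  refine ⟨2 * (C * (4 * 2 ^ G.homDim)), by positivity, ?_⟩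
  intro k hk z R hR f hsupp hfl M ψ hM hψ0 hψm hψd hosc
  have hks := hk.standardKernel hN
  have hvol0 : ∀ x ρ, 0 < ρ → volume (G.ball x ρ) ≠ 0 := by
    intro x ρ hρ
    have := hμ.pos
    rw [G.volume_ball_eq x hρ, Ne, ENNReal.ofReal_eq_zero, not_le]
    positivity
  have hvolt : ∀ x ρ, 0 < ρ → volume (G.ball x ρ) ≠ ⊤ := fun x ρ hρ => by
    rw [G.volume_ball_eq x hρ]; exact ENNReal.ofReal_ne_top
  have hfm : AEStronglyMeasurable f volume := by
    have h1 := hfl.aestronglyMeasurable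
    have h2 : (G.ball z (4 * R)).indicator f =ᵐ[volume] f := by
      filter_upwards [hsupp] with y hy
      by_cases h : y ∈ G.ball z (4 * R)
      · rw [indicator_of_mem h]
      · rw [indicator_of_notMem h, hy fun h' => h (G.ball_subset_ball ?_ h')]
        rw [G.dist_self]
        linarith
    exact ((aestronglyMeasurable_indicator_iff (G.measurableSet_ball _ _)).2 h1).congr h2
  have hosc' : ∀ x ∈ Metric.ball (α := G.Carrier) z R, ∀ ρ, 0 < ρ → ρ ≤ 3 * R →
      ∃ c, ∫⁻ y in Metric.ball (α := G.Carrier) x ρ, ‖f y - c‖ₑ ∂G.vol ≤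
        ENNReal.ofReal (M * ψ ρ * ((volume (G.ball 0 1)).toReal * ρ ^ G.homDim)) := by
    intro x hx ρ hρ hρR
    have h1 := hosc x (G.mem_metric_ball.1 hx) ρ hρ hρR
    have hψρ := hψ0 ρ hρ
    refine ⟨⨍ w in G.ball x ρ, f w, (G.lintegral_metric_ball _ x ρ).le.trans ?_⟩
    rw [ENNReal.ofReal_mul (by positivity), ← G.volume_ball_eq x hρ]
    calc ∫⁻ y in G.ball x ρ, ‖f y - ⨍ w in G.ball x ρ, f w‖ₑ
        = meanOsc f (G.ball x ρ) * volume (G.ball x ρ) := by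
          rw [meanOsc, mul_comm, ← mul_assoc, ENNReal.mul_inv_cancel (hvol0 x ρ hρ) (hvolt x ρ hρ),
            one_mul]
      _ ≤ _ := by gcongr
  have hsupp' : ∀ᵐ y ∂G.vol, y ∉ Metric.ball (α := G.Carrier) z R → f y = 0 :=
    hsupp.mono fun y hy hy' => hy fun h => hy' (G.mem_metric_ball.2 h)
  obtain ⟨hfi, hglob⟩ := hμ.exists_osc_of_local (μ := G.vol) (f := f) hfm hR hsupp' hM hψ0 hψm hψd
    hosc'
  obtain ⟨F, hF2, hFt, hFosc⟩ := H k hks f hfi z R hR hsupp' (4 * 2 ^ G.homDim * M) ψ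
    (by positivity) hψ0 hψm hψd hglob
  have hPV : ∀ᵐ x, G.singularIntegral k f x = F x ∧ G.HasPV k f x (G.singularIntegral k f x) := by
    have hFt' : ∀ᵐ x : EuclideanSpace ℝ (Fin N), Tendsto (fun ε : ℝ =>
        ∫ y in {y | ε < G.dist x y}, k x y * f y) (𝓝[>] 0) (𝓝 (F x)) := hFt
    filter_upwards [hFt'] with x hx
    have h1 : G.singularIntegral k f x = F x := hx.limUnder_eq
    refine ⟨h1, fun ε hε => hks.integrableOn_tail hfi x hε, ?_⟩
    rw [h1]
    exact hx
  have hae : G.singularIntegral k f =ᵐ[volume] F := hPV.mono fun x hx => hx.1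
  have hFl : LocallyIntegrable (X := EuclideanSpace ℝ (Fin N)) F volume :=
    MemLp.locallyIntegrable (X := EuclideanSpace ℝ (Fin N)) (μ := volume) hF2 one_le_two
  refine ⟨hPV.mono fun x hx => hx.2, fun x => ?_, fun x ρ hρ => ?_⟩
  · obtain ⟨s, hs, hFs⟩ := hFl x
    exact ⟨s, hs, hFs.congr (ae_restrict_of_ae hae.symm)⟩
  · rw [meanOsc_congr hae]
    obtain ⟨c, hc⟩ := hFosc x ρ hρ
    replace hc := (G.lintegral_metric_ball (fun y => ‖F y - c‖ₑ) x ρ).ge.trans hc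
    have hψρ := hψ0 ρ hρ
    have hfin : IsFiniteMeasure (volume.restrict (G.ball x ρ)) :=
      ⟨by simpa using (hvolt x ρ hρ).lt_top⟩
    have hFi : IntegrableOn (α := EuclideanSpace ℝ (Fin N)) F (G.ball x ρ) volume :=
      (MemLp.restrict (G.ball x ρ) (μ := (volume : Measure (EuclideanSpace ℝ (Fin N)))) hF2
        ).integrable one_le_two
    refine (meanOsc_le_of_lintegral_le (hvol0 x ρ hρ) (hvolt x ρ hρ) hFi
      (m := C * (4 * 2 ^ G.homDim * M) * ψ ρ) (by positivity) (c := c) ?_).trans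
      (ENNReal.ofReal_le_ofReal (le_of_eq (by ring)))
    rw [G.volume_ball_eq x hρ, ← ENNReal.ofReal_mul (by positivity)]
    exact hc

end CarnotGroup

/-- A bound with every real majorant of `a` is a bound with `a` itself. -/
lemma ENNReal.le_mul_of_forall_ofReal {a b : ENNReal} (ha : a ≠ ⊤) {C : ℝ} (hC : 0 ≤ C)
    (h : ∀ M : ℝ, 0 < M → a ≤ ENNReal.ofReal M → b ≤ ENNReal.ofReal (C * M)) :
    b ≤ ENNReal.ofReal C * a := by
  have h1 : Tendsto (fun ε : ℝ => ENNReal.ofReal (C * (a.toReal + ε))) (𝓝[>] 0)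
      (𝓝 (ENNReal.ofReal (C * (a.toReal + 0)))) := by
    refine (ENNReal.continuous_ofReal.comp ?_).continuousWithinAt
    fun_prop
  rw [add_zero, ENNReal.ofReal_mul hC, ENNReal.ofReal_toReal ha] at h1
  refine ge_of_tendsto h1 ?_
  filter_upwards [self_mem_nhdsWithin] with ε hε
  have hε : 0 < ε := hε
  refine h _ (by positivity) ?_
  rw [← ENNReal.ofReal_toReal ha]
  refine ENNReal.ofReal_le_ofReal ?_
  rw [ENNReal.toReal_ofReal ENNReal.toReal_nonneg]
  linarith

namespace CarnotGroup

variable {N : ℕ} (G : CarnotGroup N)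

/-- On the trivial group every singular integral is an integral over the empty set. -/
lemma singularIntegral_of_subsingleton [Subsingleton (EuclideanSpace ℝ (Fin N))]
    (k : EuclideanSpace ℝ (Fin N) → EuclideanSpace ℝ (Fin N) → ℝ)
    (f : EuclideanSpace ℝ (Fin N) → ℝ) :
    G.singularIntegral k f = 0 ∧ ∀ x, G.HasPV k f x (G.singularIntegral k f x) := by
  have h0 : ∀ (x : EuclideanSpace ℝ (Fin N)) (ε : ℝ), 0 < ε → {y | ε < G.dist x y} = ∅ := by
    intro x ε hε
    ext y
    simp only [mem_ofPred_eq, mem_empty_iff_false, iff_false, not_lt]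
    rw [Subsingleton.elim y x, G.dist_self]
    exact hε.le
  have h1 : ∀ x, Tendsto (fun ε : ℝ => ∫ y in {y | ε < G.dist x y}, k x y * f y) (𝓝[>] 0)
      (𝓝 0) := by
    intro x
    refine tendsto_const_nhds.congr' ?_
    filter_upwards [self_mem_nhdsWithin] with ε hε
    rw [h0 x ε hε, setIntegral_empty]
  have h2 : G.singularIntegral k f = 0 := funext fun x => (h1 x).limUnder_eq
  refine ⟨h2, fun x => ⟨fun ε hε => ?_, ?_⟩⟩
  · rw [h0 x ε hε]
    exact integrableOn_empty
  · rw [h2]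
    exact h1 x

lemma meanOsc_zero (S : Set (EuclideanSpace ℝ (Fin N))) :
    meanOsc (0 : EuclideanSpace ℝ (Fin N) → ℝ) S = 0 := by
  simp [meanOsc]

lemma meanOsc_le_bmoLoc {f : EuclideanSpace ℝ (Fin N) → ℝ}
    {Ω₁ Ω₂ : Set (EuclideanSpace ℝ (Fin N))} {x : EuclideanSpace ℝ (Fin N)} {r : ℝ} (hx : x ∈ Ω₁)
    (hr : 0 < r) (h : G.ball x r ⊆ Ω₂) : meanOsc f (G.ball x r) ≤ G.bmoLoc f Ω₁ Ω₂ :=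
  le_iSup₂_of_le x hx (le_iSup₂_of_le r hr (le_iSup_of_le h le_rfl))

lemma meanOsc_le_lmoLoc {f : EuclideanSpace ℝ (Fin N) → ℝ}
    {Ω₁ Ω₂ : Set (EuclideanSpace ℝ (Fin N))} {x : EuclideanSpace ℝ (Fin N)} {r : ℝ} (hx : x ∈ Ω₁)
    (hr : 0 < r) (h : G.ball x r ⊆ Ω₂) :
    ENNReal.ofReal (1 + Real.log (G.diam Ω₂ / r)) * meanOsc f (G.ball x r) ≤
      G.lmoLoc f Ω₁ Ω₂ :=
  le_iSup₂_of_le x hx (le_iSup₂_of_le r hr (le_iSup_of_le h le_rfl))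

lemma bmoLoc_le {f : EuclideanSpace ℝ (Fin N) → ℝ} {Ω₁ Ω₂ : Set (EuclideanSpace ℝ (Fin N))}
    {b : ENNReal} (h : ∀ x ∈ Ω₁, ∀ r, 0 < r → G.ball x r ⊆ Ω₂ → meanOsc f (G.ball x r) ≤ b) :
    G.bmoLoc f Ω₁ Ω₂ ≤ b :=
  iSup₂_le fun x hx => iSup₂_le fun r hr => iSup_le fun hsub => h x hx r hr hsub

lemma lmoLoc_le {f : EuclideanSpace ℝ (Fin N) → ℝ} {Ω₁ Ω₂ : Set (EuclideanSpace ℝ (Fin N))}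
    {b : ENNReal} (h : ∀ x ∈ Ω₁, ∀ r, 0 < r → G.ball x r ⊆ Ω₂ →
      ENNReal.ofReal (1 + Real.log (G.diam Ω₂ / r)) * meanOsc f (G.ball x r) ≤ b) :
    G.lmoLoc f Ω₁ Ω₂ ≤ b :=
  iSup₂_le fun x hx => iSup₂_le fun r hr => iSup_le fun hsub => h x hx r hr hsub

end CarnotGroup
theorem theorem4p8 :
    ∃ K : ℝ, 3 < K ∧
      ∀ (N : ℕ) (G : CarnotGroup N) (A B : ℝ),
        ∃ c : NNReal,
          ∀ k : EuclideanSpace ℝ (Fin N) → EuclideanSpace ℝ (Fin N) → ℝ,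
            G.IsSingularKernel k A B →
          ∀ (xbar : EuclideanSpace ℝ (Fin N)) (R : ℝ), 0 < R →
          ∀ f : EuclideanSpace ℝ (Fin N) → ℝ,
            (∀ᵐ y, y ∉ G.ball xbar R → f y = 0) →
            (G.MemBMOLoc f (G.ball xbar R) (G.ball xbar (K * R)) →
              (∀ᵐ x, G.HasPV k f x (G.singularIntegral k f x)) ∧
              G.MemBMOLoc (G.singularIntegral k f) (G.ball xbar R) (G.ball xbar (3 * R)) ∧
              G.bmoLoc (G.singularIntegral k f) (G.ball xbar R) (G.ball xbar (3 * R)) ≤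
                c * G.bmoLoc f (G.ball xbar R) (G.ball xbar (K * R))) ∧
            (G.MemLMOLoc f (G.ball xbar R) (G.ball xbar (K * R)) →
              (∀ᵐ x, G.HasPV k f x (G.singularIntegral k f x)) ∧
              G.MemLMOLoc (G.singularIntegral k f) (G.ball xbar R) (G.ball xbar (3 * R)) ∧
              G.lmoLoc (G.singularIntegral k f) (G.ball xbar R) (G.ball xbar (3 * R)) ≤
                c * G.lmoLoc f (G.ball xbar R) (G.ball xbar (K * R))) := by
  refine ⟨4, by norm_num, fun N G A B => ?_⟩
  rcases N.eq_zero_or_pos with hN | hN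
  -- For `N = 0` the group is a point and all the quantities are zero.
  · subst hN
    refine ⟨0, fun k _ z R _ f _ => ?_⟩
    obtain ⟨h1, h2⟩ := G.singularIntegral_of_subsingleton k f
    have h3 : ∀ Ω, LocallyIntegrableOn (G.singularIntegral k f) Ω := fun Ω => by
      rw [h1]; exact locallyIntegrableOn_zero
    have h4 : ∀ Ω₁ Ω₂, G.bmoLoc (G.singularIntegral k f) Ω₁ Ω₂ = 0 := fun Ω₁ Ω₂ =>
      le_antisymm (G.bmoLoc_le fun x _ r _ _ => by
        rw [h1, CarnotGroup.meanOsc_zero]) zero_le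
    have h5 : ∀ Ω₁ Ω₂, G.lmoLoc (G.singularIntegral k f) Ω₁ Ω₂ = 0 := fun Ω₁ Ω₂ =>
      le_antisymm (G.lmoLoc_le fun x _ r _ _ => by
        rw [h1, CarnotGroup.meanOsc_zero, mul_zero]) zero_le
    refine ⟨fun _ => ⟨Eventually.of_forall h2, ⟨h3 _, ?_⟩, ?_⟩,
      fun _ => ⟨Eventually.of_forall h2, ⟨h3 _, ?_⟩, ?_⟩⟩
    · rw [h4]; exact ENNReal.zero_lt_top
    · rw [h4]; exact zero_le
    · rw [h5]; exact ENNReal.zero_lt_top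
    · rw [h5]; exact zero_le
  obtain ⟨C, hC, H⟩ := G.exists_meanOsc_singularIntegral_le hN A B
  refine ⟨(6 * C).toNNReal, fun k hk z R hR f hsupp => ?_⟩
  have hsub4 : ∀ x ∈ G.ball z R, ∀ ρ, ρ ≤ 3 * R → G.ball x ρ ⊆ G.ball z (4 * R) := by
    intro x hx ρ hρ
    refine G.ball_subset_ball ?_
    have hx : G.dist z x < R := hx
    rw [G.dist_comm]
    linarith
  have hC6 : ((6 * C).toNNReal : ENNReal) = ENNReal.ofReal (6 * C) := rfl
  rw [hC6]
  constructor
  · rintro ⟨hfl, hfin⟩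
    -- The seminorm may be zero, whereas the bound for the oscillation has to be positive; so it is
    -- replaced by an arbitrary positive majorant `M`.
    have H1 : ∀ M : ℝ, 0 < M → G.bmoLoc f (G.ball z R) (G.ball z (4 * R)) ≤ ENNReal.ofReal M → _ :=
      fun M hM hle => H k hk z R hR f hsupp hfl M (fun _ => 1) hM (fun _ _ => one_pos)
        (fun _ _ _ _ => le_rfl) (fun _ _ => by norm_num) fun x hx ρ hρ hρR => by
          rw [mul_one]
          exact (G.meanOsc_le_bmoLoc hx hρ (hsub4 x hx ρ hρR)).trans hle
    have hbd : G.bmoLoc (G.singularIntegral k f) (G.ball z R) (G.ball z (3 * R)) ≤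
        ENNReal.ofReal (6 * C) * G.bmoLoc f (G.ball z R) (G.ball z (4 * R)) := by
      refine ENNReal.le_mul_of_forall_ofReal hfin.ne (by positivity) fun M hM hle => ?_
      refine G.bmoLoc_le fun x _ r hr _ => ((H1 M hM hle).2.2 x r hr).trans
        (ENNReal.ofReal_le_ofReal ?_)
      nlinarith [mul_nonneg hC hM.le]
    obtain ⟨hPV, hloc, _⟩ := H1 (_ + 1) (add_pos_of_nonneg_of_pos ENNReal.toReal_nonneg one_pos)
      ((ENNReal.ofReal_toReal hfin.ne).ge.trans
        (ENNReal.ofReal_le_ofReal (le_add_of_nonneg_right zero_le_one)))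
    exact ⟨hPV, ⟨hloc.locallyIntegrableOn _,
      hbd.trans_lt (ENNReal.mul_lt_top ENNReal.ofReal_lt_top hfin)⟩, hbd⟩
  · rintro ⟨hfl, hfin⟩
    -- The weight in `lmoLoc` involves the diameters of the two outer balls, which are comparable
    -- with `R`; this costs the factor six.
    have hD4 : 4 * R ≤ G.diam (G.ball z (4 * R)) := G.le_diam_ball hN z (by positivity)
    have hD3 : G.diam (G.ball z (3 * R)) ≤ 6 * R :=
      (G.diam_ball_le z (by positivity)).trans (by linarith)
    have H1 : ∀ M : ℝ, 0 < M → G.lmoLoc f (G.ball z R) (G.ball z (4 * R)) ≤ ENNReal.ofReal M → _ :=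
      fun M hM hle => H k hk z R hR f hsupp hfl M (logWeight R) hM (fun ρ _ => logWeight_pos R ρ)
        (fun _ _ hs hst => logWeight_mono hR.le hs hst) (fun _ hρ => logWeight_two_mul_le hρ)
        fun x hx ρ hρ hρR => by
          have hw := logWeight_pos R ρ
          have h1 := (G.meanOsc_le_lmoLoc hx hρ (hsub4 x hx ρ hρR)).trans hle
          have h2 : ENNReal.ofReal (logWeight R ρ)⁻¹ * CarnotGroup.meanOsc f (G.ball x ρ) ≤
              ENNReal.ofReal M :=
            le_trans (mul_le_mul_left (ENNReal.ofReal_le_ofReal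
              (inv_logWeight_le hR hρ hD4 hρR)) _) h1
          calc CarnotGroup.meanOsc f (G.ball x ρ) = ENNReal.ofReal (logWeight R ρ) *
                (ENNReal.ofReal (logWeight R ρ)⁻¹ * CarnotGroup.meanOsc f (G.ball x ρ)) := by
                rw [← mul_assoc, ← ENNReal.ofReal_mul hw.le, mul_inv_cancel₀ hw.ne',
                  ENNReal.ofReal_one, one_mul]
            _ ≤ ENNReal.ofReal (logWeight R ρ) * ENNReal.ofReal M := by gcongr
            _ = ENNReal.ofReal (M * logWeight R ρ) := by
                rw [← ENNReal.ofReal_mul hw.le, mul_comm]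
    have hbd : G.lmoLoc (G.singularIntegral k f) (G.ball z R) (G.ball z (3 * R)) ≤
        ENNReal.ofReal (6 * C) * G.lmoLoc f (G.ball z R) (G.ball z (4 * R)) := by
      refine ENNReal.le_mul_of_forall_ofReal hfin.ne (by positivity) fun M hM hle => ?_
      refine G.lmoLoc_le fun x _ r hr hsub => ?_
      -- The inclusion of balls bounds the radius, by comparison of volumes.
      have hr3 : r ≤ 3 * R := G.radius_le_of_ball_subset hN hr (by positivity)
        (hsub.trans fun y (hy : G.dist z y < 3 * R) => le_of_lt hy)
      have hw := logWeight_pos R r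
      calc ENNReal.ofReal (1 + Real.log (G.diam (G.ball z (3 * R)) / r)) *
            CarnotGroup.meanOsc (G.singularIntegral k f) (G.ball x r)
          ≤ ENNReal.ofReal (1 + Real.log (G.diam (G.ball z (3 * R)) / r)) *
              ENNReal.ofReal (C * M * logWeight R r) := by
            gcongr
            exact (H1 M hM hle).2.2 x r hr
        _ = ENNReal.ofReal ((1 + Real.log (G.diam (G.ball z (3 * R)) / r)) * logWeight R r *
              (C * M)) := by
            rw [← ENNReal.ofReal_mul' (by positivity)]
            congr 1
            ring
        _ ≤ ENNReal.ofReal (6 * C * M) := by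
            refine ENNReal.ofReal_le_ofReal ?_
            rw [mul_assoc 6]
            exact mul_le_mul_of_nonneg_right (one_add_log_div_mul_logWeight_le (G.diam_nonneg _)
              hD3 hR hr (by linarith)) (by positivity)
    obtain ⟨hPV, hloc, _⟩ := H1 (_ + 1) (add_pos_of_nonneg_of_pos ENNReal.toReal_nonneg one_pos)
      ((ENNReal.ofReal_toReal hfin.ne).ge.trans
        (ENNReal.ofReal_le_ofReal (le_add_of_nonneg_right zero_le_one)))
    exact ⟨hPV, ⟨hloc.locallyIntegrableOn _,
      hbd.trans_lt (ENNReal.mul_lt_top ENNReal.ofReal_lt_top hfin)⟩, hbd⟩
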